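/- Let $p>5$, $\Lambda_r=\frac{2}{p-1}+r\partial_r$, $\Delta_r=\partial_r^2+\frac2r\partial_r$, $\rho_r=e^{-r^2/4}$, $s_c=\frac32-\frac2{p-1}$, $\langle r\rangle=\sqrt{1+r^2}$, and write $u^p$ for $|u|^{p-1}u$. Let $\Phi\in C^\infty([0,\infty))$ be a self-similar profile: $\Delta_r\Phi-\frac12\Lambda_r\Phi+\Phi^p=0$ for $r>0$, $\Phi'(0)=0$, $\Phi(r)\to0$ as $r\to\infty$, $\Phi\gtrsim\langle r\rangle^{-\frac2{p-1}}$ and $|\partial_r^k\Phi|\lesssim_k\langle r\rangle^{-\frac2{p-1}-k}$ for all $k\in\mathbb N$. Let $\mathcal L_r=-\Delta_r+\frac12\Lambda_r-p\Phi^{p-1}$, acting on radial functions of $\mathbb R^3$ in $L^2(r^2\rho_r\,dr)$, and assume the spectral non-degeneracy: no integer $-m$ with $m\in\mathbb N=\{0,1,2,\dots\}$, $m\ne1$, is an eigenvalue of $\mathcal L_r$. Set $G(r,Z)=\mu^{-\frac2{p-1}}\Phi(r/\mu)$ with $\mu=\sqrt{1+Z^2}$, and $$F(v)=(G+v)^p-G^p-pG^{p-1}v+p(G^{p-1}-\Phi^{p-1})v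 .$$ Let $n\in\mathbb N^*$ with $n\ge p$. Then there exist smooth radial functions $V_{i,j}$ of $\mathbb R^3$ ($1\le i\le n$, $0\le j\le n$) and real numbers $c_i,d_i$ ($1\le i\le n$), depending only on $n$, $p$ and $\Phi$, such that, with $$V_b(r,Z)=\sum_{i=1}^n\sum_{j=0}^n b^iV_{i,j}(r)Z^{2j},\qquad B(b)=\sum_{i=1}^nc_ib^i,\qquad M(b)=\sum_{i=1}^nd_ib^i,$$ the following hold. 1. (Decay) $|\partial_r^kV_{i,j}(r)|\lesssim_{n,k}\langle r\rangle^{-\left(\frac2{p-1}-\frac1n+k\right)}$ for all $r\ge 0$ and $k\in\mathbb N$. 2. (Orthogonality) $(V_{i,0},\Lambda_r\Phi)=(V_{i,1},\Lambda_r\Phi)=0$ in $L^2(r^2\rho_r\,dr)$ for $1\le i\le n$. 3. (Error) There are $\delta(n)>0$, $b(n)>0$ such that for all $0<\delta<\delta(n)$ and $0<b<b(n)$ the function $$\Psi_b=\left(\mathcal L_r+\tfrac12Z\partial_Z\right)V_b-b\,\partial_Z^2(G+V_b)-F(V_b)-B(b)\left(\tfrac12Z\partial_Z(G+V_b)+b\,\partial_bV_b\right)-M(b)(\Lambda_r+Z\partial_Z)(G+V_b)$$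 satisfies, for all $r>0$, $|Z|\le\delta$ and $0\le j+k\le2$, $$|\partial_r^j\partial_Z^k\Psi_b|\lesssim_n\frac{b^{n+1}+b|Z|^{2n+2-k}}{\langle r\rangle^{\frac2{p-1}-\frac1n+j}},$$ with a constant independent of $\delta,b,r,Z$. 4. (First terms) $V_{1,0}=0$, $d_1=1$ and $$c_1=2(2-s_c)+\frac{\|r\Lambda_r\Phi\|_{L^2_{\rho_Y}}^2}{2\|\Lambda_r\Phi\|_{L^2_{\rho_Y}}^2},\qquad \|u\|_{L^2_{\rho_Y}}^2=\int_{\mathbb R^3\times\mathbb R}|u(|y|)|^2e^{-\frac{|y|^2+z^2}4}\,dy\,dz .$$ -/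

import Mathlib

open Set Filter Topology MeasureTheory
open scoped ContDiff

namespace CylBlowup

noncomputable section

/-- The Japanese bracket `⟨r⟩ = √(1 + r²)`. -/
def jap (r : ℝ) : ℝ := Real.sqrt (1 + r ^ 2)

/-- The nonlinearity `u ↦ |u|^{p-1} u`, written `u^p` for short. -/
def spow (p u : ℝ) : ℝ := |u| ^ (p - 1) * u

/-- The radial Laplacian of `ℝ³`, `Δ_r = ∂_r² + (2/r) ∂_r` (used for `r > 0`). -/
def lapR (f : ℝ → ℝ) (r : ℝ) : ℝ := iteratedDeriv 2 f r + 2 / r * deriv f r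

/-- The generator of scalings `Λ_r = 2/(p-1) + r ∂_r`. -/
def lamR (p : ℝ) (f : ℝ → ℝ) (r : ℝ) : ℝ := 2 / (p - 1) * f r + r * deriv f r

/-- The linearized operator `L_r = -Δ_r + Λ_r/2 - p Φ^{p-1}`. -/
def linR (p : ℝ) (Φ f : ℝ → ℝ) (r : ℝ) : ℝ :=
  -lapR f r + 1 / 2 * lamR p f r - p * (Φ r) ^ (p - 1) * f r

/-- The weight `ρ_r = e^{-r²/4}`. -/
def rhoR (r : ℝ) : ℝ := Real.exp (-r ^ 2 / 4)

/-- The scalar product of `L²(r² ρ_r dr)` on `(0, ∞)`. -/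
def innerR (f g : ℝ → ℝ) : ℝ := ∫ r in Ioi (0 : ℝ), f r * g r * rhoR r * r ^ 2

/-- The square of the `L²_{ρ_Y}` norm over `Y = (y, z) ∈ ℝ³ × ℝ`, with `ρ_Y = e^{-|Y|²/4}`, of the
function `Y ↦ f(|y|)`. -/
def normSqY (f : ℝ → ℝ) : ℝ :=
  ∫ Y : EuclideanSpace ℝ (Fin 3) × ℝ,
    (f ‖Y.1‖) ^ 2 * Real.exp (-(‖Y.1‖ ^ 2 + Y.2 ^ 2) / 4)

/-- The three dimensional critical exponent `s_c = 3/2 - 2/(p-1)`. -/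
def sc (p : ℝ) : ℝ := 3 / 2 - 2 / (p - 1)

/-- `Φ` is a self similar profile: a solution on `[0, ∞)`, smooth up to `r = 0`, of
`Δ_r Φ - Λ_r Φ / 2 + Φ^p = 0`, `Φ'(0) = 0`, `Φ(r) → 0` as `r → ∞`, with
`Φ ≳ ⟨r⟩^{-2/(p-1)}` and `|∂_r^k Φ| ≲ ⟨r⟩^{-2/(p-1)-k}`. Only the values on `[0, ∞)` matter. -/
structure IsProfile (p : ℝ) (Φ : ℝ → ℝ) : Prop where
  smooth : ContDiffOn ℝ ∞ Φ (Ici 0)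
  deriv_zero : derivWithin Φ (Ici 0) 0 = 0
  eqn : ∀ r : ℝ, 0 < r → lapR Φ r - 1 / 2 * lamR p Φ r + (Φ r) ^ p = 0
  tendsto_zero : Tendsto Φ atTop (𝓝 0)
  lower : ∃ κ : ℝ, 0 < κ ∧ ∀ r : ℝ, 0 ≤ r → κ * jap r ^ (-(2 / (p - 1))) ≤ Φ r
  decay : ∀ k : ℕ, ∃ C : ℝ, ∀ r : ℝ, 0 ≤ r →
    |iteratedDerivWithin k Φ (Ici 0) r| ≤ C * jap r ^ (-(2 / (p - 1) + (k : ℝ)))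

/-- A smooth radial function of `ℝ³`, given by its profile in `r`: the radial function
`y ↦ u(|y|)` is smooth exactly when the even extension of `u` to `ℝ` is. -/
def SmoothRadial (u : ℝ → ℝ) : Prop := ContDiff ℝ ∞ u ∧ Function.Even u

/-- `lam` is an eigenvalue of `L_r` on `L²(r² ρ_r dr)`. By elliptic regularity the eigenfunctions
are smooth radial functions. -/
def IsEigenvalueR (p : ℝ) (Φ : ℝ → ℝ) (lam : ℝ) : Prop :=
  ∃ u : ℝ → ℝ, SmoothRadial u ∧ u ≠ 0 ∧
    IntegrableOn (fun r => (u r) ^ 2 * rhoR r * r ^ 2) (Ioi 0) ∧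
    ∀ r : ℝ, 0 < r → linR p Φ u r = lam * u r

/-- The spectral non degeneracy: `-1` is the only eigenvalue of `L_r` in `{0, -1, -2, …}`. -/
def NonDegenerate (p : ℝ) (Φ : ℝ → ℝ) : Prop :=
  ∀ m : ℕ, IsEigenvalueR p Φ (-(m : ℝ)) → m = 1

/-- The reconnecting profile `G(r, Z) = μ^{-2/(p-1)} Φ(r/μ)`, `μ = √(1 + Z²)`. -/
def G (p : ℝ) (Φ : ℝ → ℝ) (r Z : ℝ) : ℝ :=
  jap Z ^ (-(2 / (p - 1))) * Φ (r / jap Z)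

/-- `V_b(r, Z) = ∑_{i=1}^n ∑_{j=0}^n b^i V_{i,j}(r) Z^{2j}`. -/
def Vb (n : ℕ) (V : ℕ → ℕ → ℝ → ℝ) (b r Z : ℝ) : ℝ :=
  ∑ i ∈ Finset.Icc 1 n, ∑ j ∈ Finset.range (n + 1), b ^ i * V i j r * Z ^ (2 * j)

/-- `∑_{i=1}^n c_i b^i`. -/
def polyB (n : ℕ) (c : ℕ → ℝ) (b : ℝ) : ℝ := ∑ i ∈ Finset.Icc 1 n, c i * b ^ i

/-- `F(v) = (G+v)^p - G^p - p G^{p-1} v + p (G^{p-1} - Φ^{p-1}) v` at `(r, Z)`. -/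
def nonlin (p : ℝ) (Φ : ℝ → ℝ) (r Z v : ℝ) : ℝ :=
  spow p (G p Φ r Z + v) - spow p (G p Φ r Z) - p * (G p Φ r Z) ^ (p - 1) * v
    + p * ((G p Φ r Z) ^ (p - 1) - (Φ r) ^ (p - 1)) * v

/-- The error
`Ψ_b = (L_r + Z∂_Z/2) V_b - b ∂_Z²(G + V_b) - F(V_b) - B(b) (Z∂_Z(G + V_b)/2 + b ∂_b V_b)
  - M(b) (Λ_r + Z∂_Z)(G + V_b)`. -/
def errPsi (p : ℝ) (Φ : ℝ → ℝ) (n : ℕ) (V : ℕ → ℕ → ℝ → ℝ) (c d : ℕ → ℝ)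
    (b r Z : ℝ) : ℝ :=
  (linR p Φ (fun s => Vb n V b s Z) r + 1 / 2 * Z * deriv (fun W => Vb n V b r W) Z)
    - b * iteratedDeriv 2 (fun W => G p Φ r W + Vb n V b r W) Z
    - nonlin p Φ r Z (Vb n V b r Z)
    - polyB n c b *
        (1 / 2 * Z * deriv (fun W => G p Φ r W + Vb n V b r W) Z
          + b * deriv (fun a => Vb n V a r Z) b)
    - polyB n d b *
        (lamR p (fun s => G p Φ s Z + Vb n V b s Z) r
          + Z * deriv (fun W => G p Φ r W + Vb n V b r W) Z)

end

end CylBlowup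

/-! Write α = 2/(p-1) and V_b = b v with v = Σ_{i<n, j≤n} b^i U_{i,j}(r) Z^{2j}; indices are shifted
by one, so that γ_i = c_{i+1} and η_i = d_{i+1}. Since G is a smooth function of Z² with explicit
Taylor coefficients, b⁻¹Ψ_b expands into monomials b^i φ(r) Z^{2j} up to an error O(b^n +
|Z|^{2n+2}). The task is to remove all the monomials.

The equations are triangular for the lexicographic order on (i,j). Adding w to U_{i,j} adds (L_r +
j)w to the coefficient of b^i Z^{2j} and otherwise touches only later coefficients: b∂_Z² sends
(i,j) to (i+1,j-1), the nonlinear and modulation terms gain a factor b, and G^{p-1} - Φ^{p-1} gains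
a factor Z² (`psi_addAt`). A change of η_i acts first at (i,0), a change of γ_i first at (i,1), in
both cases through a multiple of Λ_rΦ. As L_r Λ_rΦ = -Λ_rΦ, the case j = 1 is resonant: γ_i is
chosen to make the source orthogonal to Λ_rΦ, and a multiple of Λ_rΦ is then subtracted from the
solution. For j = 0, η_i makes the source, hence the solution, orthogonal to Λ_rΦ. For j ≥ 2
non-degeneracy suffices (`exists_approx_succ`). At (0,0) the source -∂_Z²G = Λ_rΦ is cancelled by
η_0 = 1, so U_{0,0} = 0; the orthogonality condition at (0,1) gives c_1.

Inverting L_r + j uses ordinary differential equations only. With W = rV the equation becomes -W'' +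
(r/2)W' + qW = rf, regular on ℝ. A fixed point at infinity gives a solution of polynomial growth,
continued to ℝ by linearity (`exists_good_solution`); the growth excludes the other behaviour
e^{r²/4}. Such a W yields a smooth radial V as soon as W(0) = 0. If j ≠ 1, the homogeneous solution
does not vanish at 0, otherwise it would give an eigenfunction, so a multiple of it corrects W(0).
If j = 1, Green's formula against Λ_rΦ gives W(0)Λ_rΦ(0) = 0.

For j = 0 the integration at infinity may lose a logarithm, so decay is measured by symbols of order
-α + ε for every ε > 0 (`SymM`), finally with ε = 1/n. Because of this loss v/G need not be bounded
in r; the Taylor remainder of |1+x|^{p-1}(1+x) is therefore estimated on all of ℝ by |x|^{n+1}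
(`tc_spowRem`), which uses p ≤ n + 1, and the decay of G^p pays for the growth of (v/G)^{n+1}. -/

namespace CylBlowup
noncomputable section
open Asymptotics BoundedContinuousFunction

/-! ### Symbols at infinity -/

/-- `f` has `k` derivatives near `+∞`, with `f^{(l)} = O(r^{-s-l})`. -/
def SyO : ℕ → ℝ → (ℝ → ℝ) → Prop
  | 0, s, f => f =O[atTop] fun r : ℝ => r ^ (-s)
  | k + 1, s, f => (f =O[atTop] fun r : ℝ => r ^ (-s)) ∧
      ∃ f' : ℝ → ℝ, (∀ᶠ r in atTop, HasDerivAt f (f' r) r) ∧ SyO k (s + 1) f'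

theorem rpow_isBigO_rpow {s t : ℝ} (h : t ≤ s) :
    (fun r : ℝ => r ^ (-s)) =O[atTop] fun r : ℝ => r ^ (-t) := by
  refine IsBigO.of_bound 1 ?_
  filter_upwards [eventually_ge_atTop 1] with r hr
  rw [Real.norm_of_nonneg (by positivity), Real.norm_of_nonneg (by positivity), one_mul]
  exact Real.rpow_le_rpow_of_exponent_le hr (by linarith)

theorem SyO.isBigO {k : ℕ} {s : ℝ} {f : ℝ → ℝ} (h : SyO k s f) :
    f =O[atTop] fun r : ℝ => r ^ (-s) := by
  cases k with
  | zero => exact h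
  | succ k => exact h.1

theorem SyO.congr {k : ℕ} : ∀ {s : ℝ} {f g : ℝ → ℝ}, SyO k s f → f =ᶠ[atTop] g → SyO k s g := by
  induction k with
  | zero => intro s f g h hfg; exact IsBigO.congr' h hfg EventuallyEq.rfl
  | succ k ih =>
    intro s f g h hfg
    obtain ⟨h0, f', hd, h1⟩ := h
    refine ⟨h0.congr' hfg EventuallyEq.rfl, f', ?_, h1⟩
    obtain ⟨R, hR⟩ := eventually_atTop.1 hfg
    filter_upwards [hd, eventually_gt_atTop R] with r hr hrR
    refine hr.congr_of_eventuallyEq ?_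
    filter_upwards [eventually_gt_nhds hrR] with x hx
    exact (hR x hx.le).symm

theorem SyO.mono {k : ℕ} : ∀ {s t : ℝ} {f : ℝ → ℝ}, SyO k s f → t ≤ s → SyO k t f := by
  induction k with
  | zero => intro s t f h hst; exact IsBigO.trans h (rpow_isBigO_rpow hst)
  | succ k ih =>
    intro s t f h hst
    obtain ⟨h0, f', hd, h1⟩ := h
    exact ⟨h0.trans (rpow_isBigO_rpow hst), f', hd, ih h1 (by linarith)⟩

theorem SyO.of_succ {k : ℕ} : ∀ {s : ℝ} {f : ℝ → ℝ}, SyO (k + 1) s f → SyO k s f := by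
  induction k with
  | zero => intro s f h; exact h.1
  | succ k ih =>
    intro s f h
    obtain ⟨h0, f', hd, h1⟩ := h
    exact ⟨h0, f', hd, ih h1⟩

theorem SyO.add {k : ℕ} : ∀ {s : ℝ} {f g : ℝ → ℝ}, SyO k s f → SyO k s g →
    SyO k s (fun r => f r + g r) := by
  induction k with
  | zero => intro s f g hf hg; exact IsBigO.add hf hg
  | succ k ih =>
    intro s f g hf hg
    obtain ⟨h0, f', hd, h1⟩ := hf
    obtain ⟨k0, g', kd, k1⟩ := hg
    refine ⟨h0.add k0, fun r => f' r + g' r, ?_, ih h1 k1⟩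
    filter_upwards [hd, kd] with r a b using a.add b

theorem SyO.mul {k : ℕ} : ∀ {s t : ℝ} {f g : ℝ → ℝ}, SyO k s f → SyO k t g →
    SyO k (s + t) (fun r => f r * g r) := by
  have key : ∀ {s t : ℝ} {f g : ℝ → ℝ}, (f =O[atTop] fun r : ℝ => r ^ (-s)) →
      (g =O[atTop] fun r : ℝ => r ^ (-t)) →
      (fun r => f r * g r) =O[atTop] fun r : ℝ => r ^ (-(s + t)) := by
    intro s t f g hf hg
    refine (hf.mul hg).congr' EventuallyEq.rfl ?_
    filter_upwards [eventually_gt_atTop 0] with r hr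
    rw [← Real.rpow_add hr]; ring_nf
  induction k with
  | zero => intro s t f g hf hg; exact key hf hg
  | succ k ih =>
    intro s t f g hf hg
    have hf' := hf.of_succ
    have hg' := hg.of_succ
    obtain ⟨h0, f', hd, h1⟩ := hf
    obtain ⟨k0, g', kd, k1⟩ := hg
    refine ⟨key h0 k0, fun r => f' r * g r + f r * g' r, ?_, ?_⟩
    · filter_upwards [hd, kd] with r a b using a.mul b
    · exact SyO.add ((ih h1 hg').mono (by linarith)) ((ih hf' k1).mono (by linarith))

theorem syO_zero (k : ℕ) : ∀ (s : ℝ), SyO k s (fun _ => 0) := by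
  induction k with
  | zero => intro s; exact isBigO_zero _ _
  | succ k ih =>
    intro s
    exact ⟨isBigO_zero _ _, fun _ => 0, .of_forall fun r => hasDerivAt_const _ _, ih _⟩

theorem SyO.const_mul {k : ℕ} : ∀ {s : ℝ} {f : ℝ → ℝ} (c : ℝ), SyO k s f →
    SyO k s (fun r => c * f r) := by
  induction k with
  | zero => intro s f c h; exact IsBigO.const_mul_left h c
  | succ k ih =>
    intro s f c h
    obtain ⟨h0, f', hd, h1⟩ := h
    refine ⟨h0.const_mul_left c, fun r => c * f' r, ?_, ih c h1⟩
    filter_upwards [hd] with r hr using hr.const_mul c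

theorem SyO.neg {k : ℕ} {s : ℝ} {f : ℝ → ℝ} (h : SyO k s f) : SyO k s (fun r => -f r) := by
  simpa using h.const_mul (-1)

theorem SyO.sub {k : ℕ} {s : ℝ} {f g : ℝ → ℝ} (hf : SyO k s f) (hg : SyO k s g) :
    SyO k s (fun r => f r - g r) := by
  simpa [sub_eq_add_neg] using hf.add hg.neg

theorem syO_rpow (k : ℕ) : ∀ (s : ℝ), SyO k s (fun r : ℝ => r ^ (-s)) := by
  induction k with
  | zero => intro s; exact isBigO_refl _ _
  | succ k ih =>
    intro s
    refine ⟨isBigO_refl _ _, fun r => -s * r ^ (-(s + 1)), ?_, (ih (s + 1)).const_mul (-s)⟩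
    filter_upwards [eventually_gt_atTop 0] with r hr
    have := Real.hasDerivAt_rpow_const (x := r) (p := -s) (Or.inl hr.ne')
    rwa [show -s - 1 = -(s + 1) by ring] at this

theorem syO_const (k : ℕ) (c : ℝ) : SyO k 0 (fun _ => c) := by
  refine ((syO_rpow k 0).const_mul c).congr ?_
  filter_upwards with r; simp

theorem syO_id (k : ℕ) : SyO k (-1) (fun r => r) := by
  refine (syO_rpow k (-1)).congr ?_
  filter_upwards with r; simp

theorem syO_inv (k : ℕ) : SyO k 1 (fun r => r⁻¹) := by
  refine (syO_rpow k 1).congr ?_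
  filter_upwards [eventually_gt_atTop 0] with r hr; rw [Real.rpow_neg_one]

/-- A power of a positive symbol that is bounded below is a symbol. -/
theorem SyO.rpow {k : ℕ} : ∀ {s : ℝ} {f : ℝ → ℝ} (q : ℝ), SyO k s f →
    (∃ κ > 0, ∀ᶠ r in atTop, κ * r ^ (-s) ≤ f r) → SyO k (q * s) (fun r => f r ^ q) := by
  have key : ∀ {s : ℝ} {f : ℝ → ℝ} (q : ℝ), (f =O[atTop] fun r : ℝ => r ^ (-s)) →
      (∃ κ > 0, ∀ᶠ r in atTop, κ * r ^ (-s) ≤ f r) →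
      (fun r => f r ^ q) =O[atTop] fun r : ℝ => r ^ (-(q * s)) := by
    rintro s f q hf ⟨κ, hκ, hl⟩
    obtain ⟨C, hC⟩ := hf.bound
    rcases le_total 0 q with hq | hq
    · refine IsBigO.of_bound (C ^ q) ?_
      filter_upwards [hC, hl, eventually_gt_atTop 0] with r h1 h2 hr
      have hp : 0 < r ^ (-s) := by positivity
      have hfp : 0 < f r := lt_of_lt_of_le (by positivity) h2
      rw [Real.norm_of_nonneg hfp.le, Real.norm_of_nonneg hp.le] at h1
      have hC0 : 0 ≤ C := by
        by_contra hC0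
        push Not at hC0
        nlinarith
      rw [Real.norm_of_nonneg (by positivity), Real.norm_of_nonneg (by positivity)]
      calc f r ^ q ≤ (C * r ^ (-s)) ^ q := Real.rpow_le_rpow hfp.le h1 hq
        _ = C ^ q * r ^ (-(q * s)) := by
          rw [Real.mul_rpow hC0 hp.le, ← Real.rpow_mul hr.le]; ring_nf
    · refine IsBigO.of_bound (κ ^ q) ?_
      filter_upwards [hl, eventually_gt_atTop 0] with r h2 hr
      have hp : 0 < r ^ (-s) := by positivity
      have hfp : 0 < f r := lt_of_lt_of_le (by positivity) h2
      rw [Real.norm_of_nonneg (by positivity), Real.norm_of_nonneg (by positivity)]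
      calc f r ^ q ≤ (κ * r ^ (-s)) ^ q :=
            Real.rpow_le_rpow_of_nonpos (by positivity) h2 hq
        _ = κ ^ q * r ^ (-(q * s)) := by
          rw [Real.mul_rpow hκ.le hp.le, ← Real.rpow_mul hr.le]; ring_nf
  induction k with
  | zero => intro s f q h hl; exact key q h hl
  | succ k ih =>
    intro s f q h hl
    have h' := h.of_succ
    obtain ⟨h0, f', hd, h1⟩ := h
    refine ⟨key q h0 hl, fun r => q * (f r ^ (q - 1) * f' r), ?_, ?_⟩
    · obtain ⟨κ, hκ, hl⟩ := hl
      filter_upwards [hd, hl, eventually_gt_atTop 0] with r h1 h2 hr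
      have hfp : 0 < f r := lt_of_lt_of_le (by positivity) h2
      have := h1.rpow_const (p := q) (Or.inl hfp.ne')
      convert this using 1; ring
    · exact (((ih (q - 1) h' hl).mul h1).mono (by linarith)).const_mul q

/-! ### The first order equation -y' + (r/2 + c/r) y = H at infinity -/

/-- The comparison function `e^{-r²/4} r^e`. -/
def wexp (e r : ℝ) : ℝ := Real.exp (-r ^ 2 / 4) * r ^ e

theorem wexp_pos {e r : ℝ} (hr : 0 < r) : 0 < wexp e r := by unfold wexp; positivity

theorem hasDerivAt_wexp (e : ℝ) {r : ℝ} (hr : 0 < r) :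
    HasDerivAt (wexp e) (-(wexp e r * (r / 2 - e / r))) r := by
  have h1 : HasDerivAt (fun r : ℝ => Real.exp (-r ^ 2 / 4))
      (Real.exp (-r ^ 2 / 4) * (-(2 * r) / 4)) r := by
    have := (((hasDerivAt_pow 2 r).neg).div_const 4).exp
    simpa using this
  have h2 := Real.hasDerivAt_rpow_const (x := r) (p := e) (Or.inl hr.ne')
  refine (h1.mul h2).congr_deriv ?_
  unfold wexp
  rw [Real.rpow_sub hr, Real.rpow_one]
  field_simp
  ring

theorem wexp_mul_rpow {e t r : ℝ} (hr : 0 < r) : wexp e r * r ^ t = wexp (e + t) r := by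
  unfold wexp; rw [Real.rpow_add hr]; ring

theorem tendsto_wexp (e : ℝ) : Tendsto (wexp e) atTop (𝓝 0) := by
  have h : Tendsto (fun r : ℝ => r ^ e * Real.exp (-(1 : ℝ) * r)) atTop (𝓝 0) :=
    tendsto_rpow_mul_exp_neg_mul_atTop_nhds_zero e 1 one_pos
  refine squeeze_zero' ?_ ?_ h
  · filter_upwards [eventually_gt_atTop 0] with r hr using (wexp_pos hr).le
  · filter_upwards [eventually_ge_atTop 4] with r hr
    unfold wexp
    rw [mul_comm]
    have : 0 < r := by linarith
    gcongr
    nlinarith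

/-- Quantitative comparison for `-y' + (r/2 + c/r) y = H`. -/
theorem abs_le_of_firstOrder {c κ C R : ℝ} {y H : ℝ → ℝ} (hR : 0 < R)
    (hRc : 4 * (κ - 1 - c) ≤ R ^ 2)
    (hy : ∀ r, R < r → HasDerivAt y ((r / 2 + c / r) * y r - H r) r)
    (hyR : ContinuousOn y (Ici R))
    (hH : ∀ r, R < r → |H r| ≤ C * r ^ κ)
    (hlim : Tendsto (fun r => wexp (-c) r * y r) atTop (𝓝 0)) :
    ∀ r, R ≤ r → |y r| ≤ 4 * C * r ^ (κ - 1) := by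
  have key : ∀ (y H : ℝ → ℝ), (∀ r, R < r → HasDerivAt y ((r / 2 + c / r) * y r - H r) r) →
      ContinuousOn y (Ici R) → (∀ r, R < r → |H r| ≤ C * r ^ κ) →
      Tendsto (fun r => wexp (-c) r * y r) atTop (𝓝 0) →
      ∀ r, R ≤ r → y r ≤ 4 * C * r ^ (κ - 1) := by
    intro y H hy hyR hH hlim r hr
    -- `4 C r^(κ-1)` is a supersolution. After multiplication by the integrating factor `wexp (-c)`,
    -- its difference with `y` is nonincreasing and tends to 0 at infinity, hence is nonnegative.
    set D : ℝ → ℝ := fun r => 4 * C * wexp (κ - 1 - c) r - wexp (-c) r * y r with hD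
    have hw : ∀ e, ContinuousOn (wexp e) (Ici R) := fun e x hx =>
      (hasDerivAt_wexp e (lt_of_lt_of_le hR hx)).continuousAt.continuousWithinAt
    have hanti : AntitoneOn D (Ici R) := by
      refine antitoneOn_of_hasDerivWithinAt_nonpos
        (f' := fun r => 4 * C * (-(wexp (κ - 1 - c) r * (r / 2 - (κ - 1 - c) / r)))
          - (-(wexp (-c) r * (r / 2 - (-c) / r)) * y r
            + wexp (-c) r * ((r / 2 + c / r) * y r - H r))) (convex_Ici R) ?_ ?_ ?_
      · exact ((hw _).const_smul (4 * C)).sub ((hw _).mul hyR)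
      · intro x hx
        rw [interior_Ici] at hx
        have hx0 : 0 < x := hR.trans hx
        exact (((hasDerivAt_wexp _ hx0).const_mul (4 * C)).sub
          ((hasDerivAt_wexp _ hx0).mul (hy x hx))).hasDerivWithinAt
      · intro x hx
        rw [interior_Ici] at hx
        have hx' : R < x := hx
        have hx0 : 0 < x := hR.trans hx
        have e1 : wexp (κ - 1 - c) x = wexp (-c) x * x ^ κ / x := by
          rw [wexp_mul_rpow hx0, show κ - 1 - c = (-c + κ) + (-1) by ring, ← wexp_mul_rpow hx0,
            Real.rpow_neg_one]; rfl
        have hwp := wexp_pos (e := -c) hx0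
        have hHx := abs_le.1 (hH x hx)
        have hCx : 0 ≤ C * x ^ κ := (abs_nonneg _).trans (hH x hx)
        have e2 : 4 * C * (-(wexp (κ - 1 - c) x * (x / 2 - (κ - 1 - c) / x)))
          - (-(wexp (-c) x * (x / 2 - (-c) / x)) * y x
            + wexp (-c) x * ((x / 2 + c / x) * y x - H x)) =
            wexp (-c) x * (H x - C * x ^ κ * (2 - 4 * (κ - 1 - c) / x ^ 2)) := by
          rw [e1]; field_simp; ring
        rw [e2]
        -- Largeness of `R` enters here: the bracket `2 - 4 (κ - 1 - c) / x ^ 2` stays at least 1,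
        -- so the supersolution dominates `H`.
        have : 4 * (κ - 1 - c) / x ^ 2 ≤ 1 := by
          rw [div_le_one (by positivity)]; nlinarith
        refine mul_nonpos_of_nonneg_of_nonpos hwp.le ?_
        nlinarith
    have hlimD : Tendsto D atTop (𝓝 0) := by
      have := ((tendsto_wexp (κ - 1 - c)).const_mul (4 * C)).sub hlim
      simpa using this
    have h0 : 0 ≤ D r := by
      refine le_of_tendsto hlimD ?_
      filter_upwards [eventually_ge_atTop r] with x hx
      exact hanti hr (hr.trans hx) hx
    have hr0 : 0 < r := lt_of_lt_of_le hR hr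
    have hwp := wexp_pos (e := -c) hr0
    have e1 : wexp (κ - 1 - c) r = wexp (-c) r * r ^ (κ - 1) := by
      rw [wexp_mul_rpow hr0]; ring_nf
    simp only [hD, e1] at h0
    have : wexp (-c) r * y r ≤ wexp (-c) r * (4 * C * r ^ (κ - 1)) := by linarith
    exact le_of_mul_le_mul_left this hwp
  intro r hr
  rw [abs_le]
  refine ⟨?_, key y H hy hyR hH hlim r hr⟩
  have := key (fun r => -y r) (fun r => -H r) (fun r h => ((hy r h).neg).congr_deriv (by ring))
    hyR.neg (fun r h => by simpa using hH r h) (by simpa using hlim.neg) r hr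
  linarith

/-- The homogeneous solutions are multiples of `1 / wexp (-c)`, of size e^{r²/4} r^c; polynomial
growth rules them out, and this limit is the form in which the comparison lemma uses that fact. -/
theorem tendsto_wexp_mul_of_isBigO {c N : ℝ} {y : ℝ → ℝ}
    (h : y =O[atTop] fun r : ℝ => r ^ N) :
    Tendsto (fun r => wexp (-c) r * y r) atTop (𝓝 0) := by
  refine ((isBigO_refl (wexp (-c)) atTop).mul h).trans_tendsto ?_
  refine (tendsto_wexp (-c + N)).congr' ?_
  filter_upwards [eventually_gt_atTop 0] with r hr
  rw [wexp_mul_rpow hr]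

/-- A polynomially bounded solution of `-y' + (r/2 + c/r) y = H` gains one power of `r` over `H`,
with all derivatives. -/
theorem SyO.of_firstOrder {k : ℕ} : ∀ {c N s : ℝ} {y H : ℝ → ℝ},
    (∀ᶠ r in atTop, HasDerivAt y ((r / 2 + c / r) * y r - H r) r) →
    (y =O[atTop] fun r : ℝ => r ^ N) → SyO k s H → SyO k (s + 1) y := by
  have key : ∀ {c N s : ℝ} {y H : ℝ → ℝ},
    (∀ᶠ r in atTop, HasDerivAt y ((r / 2 + c / r) * y r - H r) r) →
    (y =O[atTop] fun r : ℝ => r ^ N) → (H =O[atTop] fun r : ℝ => r ^ (-s)) →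
      y =O[atTop] fun r : ℝ => r ^ (-(s + 1)) := by
    intro c N s y H hy hN hH
    obtain ⟨C, hC⟩ := hH.bound
    obtain ⟨R₀, hR₀⟩ := eventually_atTop.1 (hy.and hC)
    -- `R ≥ 1 + |A|` gives `R ^ 2 ≥ A`, the size condition of the comparison lemma.
    set R := max (max R₀ 1) (1 + |4 * (-s - 1 - c)|) with hRdef
    have hR1 : 1 ≤ R := (le_max_right _ _).trans (le_max_left _ _)
    have hR0 : R₀ ≤ R := (le_max_left _ _).trans (le_max_left _ _)
    have hR2 : 1 + |4 * (-s - 1 - c)| ≤ R := le_max_right _ _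
    refine IsBigO.of_bound (4 * C) ?_
    filter_upwards [eventually_ge_atTop R] with r hr
    have hr0 : 0 < r := by linarith
    have := abs_le_of_firstOrder (c := c) (κ := -s) (C := C) (R := R) (y := y) (H := H)
      (by linarith) (by have := le_abs_self (4 * (-s - 1 - c)); nlinarith)
      (fun r h => (hR₀ r (by linarith)).1)
      (fun x hx => (hR₀ x (hR0.trans hx)).1.continuousAt.continuousWithinAt)
      (fun r h => by
        have h2 := (hR₀ r (by linarith)).2
        have : 0 < r := by linarith
        rwa [Real.norm_eq_abs, Real.norm_of_nonneg (by positivity)] at h2)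
      (tendsto_wexp_mul_of_isBigO hN) r hr
    rw [Real.norm_eq_abs, Real.norm_of_nonneg (by positivity)]
    convert this using 3; ring
  induction k with
  | zero => intro c N s y H hy hN hH; exact key hy hN hH
  | succ k ih =>
    intro c N s y H hy hN hH
    have hyk := ih hy hN hH.of_succ
    have hH0 := hH.isBigO
    have hH' := hH
    obtain ⟨-, H', hdH, hH1⟩ := hH
    refine ⟨key hy hN hH0, _, hy, ?_⟩
    have hc : SyO k 0 (fun r : ℝ => 1 / 2 - c * (r⁻¹ * r⁻¹)) :=
      (syO_const k (1 / 2)).sub ((((syO_inv k).mul (syO_inv k)).mono (by norm_num)).const_mul c)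
    -- Differentiating the equation, `y'` solves the same equation with source `H' - (1/2 - c/r²)
    -- y`. The exponent `N` is only a crude growth bound read off from the equation; the gain comes
    -- from the induction hypothesis.
    refine ih (c := c) (N := max 0 (max (1 - (s + 1)) (-s)))
      (H := fun r => H' r - (1 / 2 - c * (r⁻¹ * r⁻¹)) * y r) ?_ ?_ ?_
    · filter_upwards [hy, hdH, eventually_gt_atTop 0] with r h1 h2 hr
      have h3 : HasDerivAt (fun r : ℝ => r / 2 + c / r) (1 / 2 + c * (-(r ^ 2)⁻¹)) r := by
        have := ((hasDerivAt_id r).div_const 2).add ((hasDerivAt_inv hr.ne').const_mul c)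
        exact this.congr_deriv (by ring)
      refine ((h3.mul h1).sub h2).congr_deriv ?_
      field_simp
      ring
    · have hc2 : SyO 0 (-1) (fun r : ℝ => 2⁻¹ * r + c * r⁻¹) :=
        ((syO_id 0).const_mul _).add (((syO_inv 0).mono (by norm_num)).const_mul c)
      have h1 : SyO 0 (-1 + (s + 1)) (fun r => (2⁻¹ * r + c * r⁻¹) * y r) :=
        hc2.mul (show SyO 0 (s + 1) y from key hy hN hH0)
      have h2 : SyO 0 s (fun r => (2⁻¹ * r + c * r⁻¹) * y r - H r) :=
        (h1.mono (by linarith)).sub hH0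
      refine IsBigO.trans (h2.isBigO.congr_left ?_) (?_ : (fun r : ℝ => r ^ (-s)) =O[atTop] _)
      · intro r; ring
      · have := rpow_isBigO_rpow (s := s) (t := -(max 0 (max (1 - (s + 1)) (-s)))) ?_
        · simpa using this
        · have : -s ≤ max 0 (max (1 - (s + 1)) (-s)) :=
            (le_max_right _ _).trans (le_max_right _ _)
          linarith
    · exact hH1.sub ((hc.mul hyk).mono (by linarith))

/-- A function whose derivative is `O(r^{κ-1})`, `κ > 0`, is `O(r^κ)`. -/
theorem isBigO_of_deriv_isBigO {κ : ℝ} (hκ : 0 < κ) {u y : ℝ → ℝ}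
    (hu : ∀ᶠ r in atTop, HasDerivAt u (y r) r) (hy : y =O[atTop] fun r : ℝ => r ^ (κ - 1)) :
    u =O[atTop] fun r : ℝ => r ^ κ := by
  obtain ⟨C, hC0, hC⟩ := hy.exists_pos
  obtain ⟨R₀, hR₀⟩ := eventually_atTop.1 (hu.and hC.bound)
  set R := max R₀ 1
  have hR1 : 1 ≤ R := le_max_right _ _
  have hR0 : R₀ ≤ R := le_max_left _ _
  refine IsBigO.of_bound (|u R| + C / κ) ?_
  filter_upwards [eventually_ge_atTop R] with r hr
  have hr1 : 1 ≤ r := hR1.trans hr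
  have hb := image_norm_le_of_norm_deriv_right_le_deriv_boundary' (f := u) (f' := y)
    (a := R) (b := r) (B := fun r => |u R| + C / κ * r ^ κ) (B' := fun r => C * r ^ (κ - 1))
    (fun x hx => (hR₀ x (hR0.trans hx.1)).1.continuousAt.continuousWithinAt)
    (fun x hx => (hR₀ x (hR0.trans hx.1)).1.hasDerivWithinAt)
    (by
      have : 0 ≤ C / κ * R ^ κ := by positivity
      simpa using this)
    (fun x hx => ContinuousAt.continuousWithinAt (by
      have : x ≠ 0 := by linarith [hx.1]
      fun_prop (disch := simp [this])))
    (fun x hx => by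
      have hx0 : x ≠ 0 := by linarith [hx.1]
      refine HasDerivAt.hasDerivWithinAt ?_
      refine (((Real.hasDerivAt_rpow_const (p := κ) (Or.inl hx0)).const_mul
        (C / κ)).const_add _).congr_deriv ?_
      field_simp)
    (fun x hx => by
      have h := (hR₀ x (hR0.trans hx.1)).2
      have : 0 ≤ x := by linarith [hx.1]
      rwa [Real.norm_of_nonneg (by positivity : 0 ≤ x ^ (κ - 1))] at h)
    (right_mem_Icc.2 hr)
  rw [Real.norm_of_nonneg (by positivity : 0 ≤ r ^ κ)]
  have : 1 ≤ r ^ κ := Real.one_le_rpow hr1 hκ.le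
  have h2 := abs_nonneg (u R)
  refine hb.trans ?_
  nlinarith

/-! ### From asymptotics at infinity to global bounds by powers of ⟨r⟩ -/

theorem SyO.deriv {k : ℕ} {s : ℝ} {f : ℝ → ℝ} (h : SyO (k + 1) s f) :
    SyO k (s + 1) (deriv f) := by
  obtain ⟨-, f', hd, h1⟩ := h
  exact h1.congr (hd.mono fun r hr => hr.deriv.symm)

theorem SyO.iteratedDeriv_isBigO {s : ℝ} {f : ℝ → ℝ} (h : ∀ k, SyO k s f) (l : ℕ) :
    iteratedDeriv l f =O[atTop] fun r : ℝ => r ^ (-(s + l)) := by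
  induction l generalizing s f with
  | zero => simpa using (h 0).isBigO
  | succ l ih =>
    have := ih (s := s + 1) (f := _root_.deriv f) fun k => (h (k + 1)).deriv
    rw [iteratedDeriv_succ']
    convert this using 3; push_cast; ring

theorem syO_of_iteratedDeriv {s : ℝ} {f : ℝ → ℝ} (hf : ContDiff ℝ ∞ f)
    (h : ∀ l : ℕ, iteratedDeriv l f =O[atTop] fun r : ℝ => r ^ (-(s + l))) (k : ℕ) :
    SyO k s f := by
  induction k generalizing s f with
  | zero => exact (by simpa using h 0 : f =O[atTop] fun r : ℝ => r ^ (-s))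
  | succ k ih =>
    refine ⟨by simpa using h 0, _, .of_forall fun r =>
      (hf.differentiable (by simp) r).hasDerivAt, ih (contDiff_infty_iff_deriv.1 hf).2 ?_⟩
    intro l
    have := h (l + 1)
    rw [iteratedDeriv_succ'] at this
    convert this using 3; push_cast; ring

theorem one_le_jap (r : ℝ) : 1 ≤ jap r := by
  unfold jap; rw [Real.one_le_sqrt]; nlinarith [sq_nonneg r]

theorem jap_pos (r : ℝ) : 0 < jap r := lt_of_lt_of_le one_pos (one_le_jap r)

theorem abs_le_jap (r : ℝ) : |r| ≤ jap r := by
  unfold jap; apply Real.abs_le_sqrt; linarith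

theorem continuous_jap : Continuous jap := by unfold jap; fun_prop

theorem jap_le_two_mul {r : ℝ} (hr : 1 ≤ r) : jap r ≤ 2 * r := by
  unfold jap; rw [Real.sqrt_le_left (by linarith)]; nlinarith

/-- Powers of comparable positive numbers are comparable. -/
theorem rpow_le_of_comparable {x y A : ℝ} (s : ℝ) (hx : 0 < x) (hy : 0 < y) (hA : 1 ≤ A)
    (hxy : x ≤ A * y) (hyx : y ≤ A * x) : x ^ s ≤ A ^ |s| * y ^ s := by
  have hA0 : 0 < A := by linarith
  rcases le_total 0 s with hs | hs
  · rw [abs_of_nonneg hs, ← Real.mul_rpow hA0.le hy.le]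
    exact Real.rpow_le_rpow hx.le hxy hs
  · rw [abs_of_nonpos hs, Real.rpow_neg hA0.le, ← Real.inv_rpow hA0.le,
      ← Real.mul_rpow (by positivity) hy.le]
    refine Real.rpow_le_rpow_of_nonpos (by positivity) ?_ hs
    rw [inv_mul_le_iff₀ hA0]; exact hyx

theorem isBigO_rpow_jap (s : ℝ) :
    (fun r : ℝ => r ^ s) =O[atTop] fun r : ℝ => jap r ^ s := by
  refine IsBigO.of_bound (2 ^ |s|) ?_
  filter_upwards [eventually_ge_atTop 1] with r hr
  have := jap_pos r
  rw [Real.norm_of_nonneg (by positivity), Real.norm_of_nonneg (by positivity)]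
  have h2 := (le_abs_self r).trans (abs_le_jap r)
  exact rpow_le_of_comparable s (by linarith) this (by norm_num) (by linarith) (jap_le_two_mul hr)

theorem isBigO_jap_rpow (s : ℝ) :
    (fun r : ℝ => jap r ^ s) =O[atTop] fun r : ℝ => r ^ s := by
  refine IsBigO.of_bound (2 ^ |s|) ?_
  filter_upwards [eventually_ge_atTop 1] with r hr
  have := jap_pos r
  rw [Real.norm_of_nonneg (by positivity), Real.norm_of_nonneg (by positivity)]
  have h2 := (le_abs_self r).trans (abs_le_jap r)
  exact rpow_le_of_comparable s this (by linarith) (by norm_num) (jap_le_two_mul hr) (by linarith)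

/-- The asymptotics control large `r`; on the remaining compact interval the quotient is continuous,
hence bounded. -/
theorem exists_jap_bound {f : ℝ → ℝ} {s : ℝ} (hf : Continuous f)
    (h : f =O[atTop] fun r : ℝ => r ^ s) : ∃ C, ∀ r, 0 ≤ r → |f r| ≤ C * jap r ^ s := by
  obtain ⟨C, hC⟩ := (h.trans (isBigO_rpow_jap s)).bound
  obtain ⟨R, hR⟩ := eventually_atTop.1 hC
  have hcont : ContinuousOn (fun r => |f r| / jap r ^ s) (Icc 0 R) := by
    refine ContinuousOn.div (by fun_prop) (ContinuousOn.rpow_const continuous_jap.continuousOn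
      fun x _ => Or.inl (jap_pos x).ne') fun x _ => (Real.rpow_pos_of_pos (jap_pos x) _).ne'
  obtain ⟨D, hD⟩ := isCompact_Icc.bddAbove_image hcont
  refine ⟨max C D, fun r hr => ?_⟩
  have hj : 0 < jap r ^ s := Real.rpow_pos_of_pos (jap_pos r) _
  rcases le_total R r with h1 | h1
  · have := hR r h1
    rw [Real.norm_eq_abs, Real.norm_of_nonneg hj.le] at this
    exact this.trans (by gcongr; exact le_max_left _ _)
  · have : |f r| / jap r ^ s ≤ D := hD ⟨r, ⟨hr, h1⟩, rfl⟩
    rw [div_le_iff₀ hj] at this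
    exact this.trans (by gcongr; exact le_max_right _ _)

/-- Smooth functions with symbol bounds of order `-s` at `+∞`. -/
def Sy (s : ℝ) (f : ℝ → ℝ) : Prop := ContDiff ℝ ∞ f ∧ ∀ k, SyO k s f

/-- Smooth even functions which are symbols of order `-s + ε` for all `ε > 0`. -/
def SymM (s : ℝ) (f : ℝ → ℝ) : Prop :=
  ContDiff ℝ ∞ f ∧ Function.Even f ∧ ∀ ε > 0, ∀ k, SyO k (s - ε) f

theorem SymM.sy {s ε : ℝ} {f : ℝ → ℝ} (h : SymM s f) (hε : 0 < ε) : Sy (s - ε) f :=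
  ⟨h.1, h.2.2 ε hε⟩

theorem Sy.symM {s : ℝ} {f : ℝ → ℝ} (h : Sy s f) (he : Function.Even f) : SymM s f :=
  ⟨h.1, he, fun ε hε k => (h.2 k).mono (by linarith)⟩

theorem Sy.deriv {s : ℝ} {f : ℝ → ℝ} (h : Sy s f) : Sy (s + 1) (deriv f) :=
  ⟨(contDiff_infty_iff_deriv.1 h.1).2, fun k => (h.2 (k + 1)).deriv⟩

theorem Sy.differentiable {s : ℝ} {f : ℝ → ℝ} (h : Sy s f) : Differentiable ℝ f :=
  h.1.differentiable (by simp)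

theorem Sy.bound {s : ℝ} {f : ℝ → ℝ} (h : Sy s f) :
    ∃ C, ∀ r, 0 ≤ r → |f r| ≤ C * jap r ^ (-s) :=
  exists_jap_bound h.1.continuous (h.2 0).isBigO

theorem Sy.iteratedDeriv_bound {s : ℝ} {f : ℝ → ℝ} (h : Sy s f) (k : ℕ) :
    ∃ C, ∀ r, 0 ≤ r → |iteratedDeriv k f r| ≤ C * jap r ^ (-(s + k)) :=
  exists_jap_bound (h.1.continuous_iteratedDeriv k (by exact_mod_cast le_top))
    (SyO.iteratedDeriv_isBigO h.2 k)

theorem Sy.add {s : ℝ} {f g : ℝ → ℝ} (hf : Sy s f) (hg : Sy s g) :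
    Sy s (fun r => f r + g r) := ⟨hf.1.add hg.1, fun k => (hf.2 k).add (hg.2 k)⟩

theorem Sy.mul {s t : ℝ} {f g : ℝ → ℝ} (hf : Sy s f) (hg : Sy t g) :
    Sy (s + t) (fun r => f r * g r) := ⟨hf.1.mul hg.1, fun k => (hf.2 k).mul (hg.2 k)⟩

theorem Sy.const_mul {s : ℝ} {f : ℝ → ℝ} (c : ℝ) (hf : Sy s f) :
    Sy s (fun r => c * f r) := ⟨contDiff_const.mul hf.1, fun k => (hf.2 k).const_mul c⟩

theorem Sy.id_mul_deriv {s : ℝ} {f : ℝ → ℝ} (hf : Sy s f) :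
    Sy s (fun r => r * _root_.deriv f r) :=
  ⟨contDiff_id.mul hf.deriv.1, fun k => ((syO_id k).mul (hf.deriv.2 k)).mono (by linarith)⟩

theorem even_id_mul_deriv {f : ℝ → ℝ} (hf : Function.Even f) :
    Function.Even (fun r => r * deriv f r) := by
  intro r
  have h : deriv f (-r) = -deriv f r := by
    have h1 : f = fun x => f (-x) := funext fun x => (hf x).symm
    conv_rhs => rw [h1, deriv_comp_neg]
    simp
  simp [h]

theorem SymM.mono {s t : ℝ} {f : ℝ → ℝ} (h : SymM s f) (hts : t ≤ s) : SymM t f :=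
  ⟨h.1, h.2.1, fun ε hε k => (h.2.2 ε hε k).mono (by linarith)⟩

theorem SymM.add {s : ℝ} {f g : ℝ → ℝ} (hf : SymM s f) (hg : SymM s g) :
    SymM s (fun r => f r + g r) :=
  ⟨hf.1.add hg.1, hf.2.1.add hg.2.1, fun ε hε k => (hf.2.2 ε hε k).add (hg.2.2 ε hε k)⟩

theorem SymM.const_mul {s : ℝ} {f : ℝ → ℝ} (c : ℝ) (hf : SymM s f) :
    SymM s (fun r => c * f r) :=
  ⟨contDiff_const.mul hf.1, fun r => by simp [hf.2.1 r],
    fun ε hε k => (hf.2.2 ε hε k).const_mul c⟩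

theorem symM_zero (s : ℝ) : SymM s (fun _ => 0) :=
  ⟨contDiff_const, fun _ => rfl, fun _ _ k => syO_zero k _⟩

theorem SymM.mul {s t : ℝ} {f g : ℝ → ℝ} (hf : SymM s f) (hg : SymM t g) :
    SymM (s + t) (fun r => f r * g r) :=
  ⟨hf.1.mul hg.1, hf.2.1.mul_even hg.2.1, fun ε hε k =>
    ((hf.2.2 (ε / 2) (by linarith) k).mul (hg.2.2 (ε / 2) (by linarith) k)).mono (by linarith)⟩

theorem SymM.id_mul_deriv {s : ℝ} {f : ℝ → ℝ} (hf : SymM s f) :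
    SymM s (fun r => r * _root_.deriv f r) :=
  ⟨contDiff_id.mul (contDiff_infty_iff_deriv.1 hf.1).2, even_id_mul_deriv hf.2.1,
    fun _ hε => (hf.sy hε).id_mul_deriv.2⟩

/-! ### Global solutions of linear differential equations -/

/-- With K the primitive of `k` vanishing at `t₀`, the integrand is, on each side of `t₀`, up to
sign the derivative of e^{|K|}. This makes e^{|K|} a good weight for Picard iteration on the whole
line. -/
theorem abs_integral_mul_exp_le {k : ℝ → ℝ} (hk : Continuous k) (hk0 : ∀ s, 0 ≤ k s) (t₀ t : ℝ) :
    |∫ s in t₀..t, k s * Real.exp (|∫ τ in t₀..s, k τ|)| ≤ Real.exp |∫ τ in t₀..t, k τ| := by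
  have hd : ∀ s, HasDerivAt (fun s => ∫ τ in t₀..s, k τ) (k s) s := fun s =>
    intervalIntegral.integral_hasDerivAt_right (hk.intervalIntegrable _ _)
      hk.aestronglyMeasurable.stronglyMeasurableAtFilter hk.continuousAt
  have hc : Continuous fun s => ∫ τ in t₀..s, k τ :=
    continuous_iff_continuousAt.2 fun s => (hd s).continuousAt
  rcases le_total t₀ t with h | h
  · have e1 : ∀ s ∈ uIcc t₀ t, k s * Real.exp |∫ τ in t₀..s, k τ| =
        Real.exp (∫ τ in t₀..s, k τ) * k s := by
      intro s hs
      rw [uIcc_of_le h] at hs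
      rw [abs_of_nonneg (intervalIntegral.integral_nonneg hs.1 fun u _ => hk0 u), mul_comm]
    rw [intervalIntegral.integral_congr e1, intervalIntegral.integral_eq_sub_of_hasDerivAt
      (fun s _ => (hd s).exp) (Continuous.intervalIntegrable (by fun_prop) _ _)]
    have h0 : 0 ≤ ∫ τ in t₀..t, k τ := intervalIntegral.integral_nonneg h fun u _ => hk0 u
    simp only [intervalIntegral.integral_same, Real.exp_zero]
    have := Real.one_le_exp h0
    rw [abs_of_nonneg (by linarith), abs_of_nonneg h0]; linarith
  · have hneg : ∀ s ≤ t₀, ∫ τ in t₀..s, k τ ≤ 0 := fun s hs => by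
      rw [intervalIntegral.integral_symm]
      linarith [intervalIntegral.integral_nonneg (μ := volume) hs fun u _ => hk0 u]
    have e1 : ∀ s ∈ uIcc t₀ t, k s * Real.exp |∫ τ in t₀..s, k τ| =
        -(Real.exp (-(∫ τ in t₀..s, k τ)) * (- k s)) := by
      intro s hs
      rw [uIcc_of_ge h] at hs
      rw [abs_of_nonpos (hneg s hs.2)]; ring
    rw [intervalIntegral.integral_congr e1, intervalIntegral.integral_neg,
      intervalIntegral.integral_eq_sub_of_hasDerivAt
      (f := fun s => Real.exp (-(∫ τ in t₀..s, k τ)))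
      (f' := fun s => Real.exp (-(∫ τ in t₀..s, k τ)) * (-k s)) (fun s _ => (hd s).neg.exp) (Continuous.intervalIntegrable (by fun_prop) _ _)]
    have h0 := hneg t h
    simp only [intervalIntegral.integral_same, Real.exp_zero, neg_zero]
    have := Real.one_le_exp (neg_nonneg.2 h0)
    rw [abs_of_nonpos (by linarith), abs_of_nonpos h0]; linarith

section LinearODE
variable {E : Type*} [NormedAddCommGroup E] [NormedSpace ℝ E]

theorem norm_integral_le_of_weight {k : ℝ → ℝ} (hk : Continuous k) (hk0 : ∀ s, 0 ≤ k s)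
    {F : ℝ → E} (t₀ : ℝ) {C : ℝ}
    (hF : ∀ s, ‖F s‖ ≤ C * (k s * Real.exp |∫ τ in t₀..s, k τ|)) (t : ℝ) :
    ‖∫ s in t₀..t, F s‖ ≤ |C| * Real.exp |∫ τ in t₀..t, k τ| := by
  have hc : Continuous fun s => ∫ τ in t₀..s, k τ :=
    continuous_iff_continuousAt.2 fun s => (intervalIntegral.integral_hasDerivAt_right
      (hk.intervalIntegrable _ _)
      hk.aestronglyMeasurable.stronglyMeasurableAtFilter hk.continuousAt).continuousAt
  have h1 := intervalIntegral.norm_integral_le_abs_of_norm_le (a := t₀) (b := t) (f := F)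
    (g := fun s => C * (k s * Real.exp |∫ τ in t₀..s, k τ|)) (μ := volume)
    (.of_forall fun s => hF s) (Continuous.intervalIntegrable (by fun_prop) _ _)
  rw [intervalIntegral.integral_const_mul, abs_mul] at h1
  exact h1.trans (mul_le_mul_of_nonneg_left (abs_integral_mul_exp_le hk hk0 t₀ t) (abs_nonneg C))

/-- `A` is bounded on the compact interval, so the right-hand side is uniformly Lipschitz there. -/
theorem solution_linear_unique {A : ℝ → E →L[ℝ] E} {g : ℝ → E} (hA : Continuous A)
    {a b t₀ : ℝ} (ht₀ : t₀ ∈ Ioo a b) {x z : ℝ → E}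
    (hx : ∀ t ∈ Ioo a b, HasDerivAt x (A t (x t) + g t) t)
    (hz : ∀ t ∈ Ioo a b, HasDerivAt z (A t (z t) + g t) t) (h0 : x t₀ = z t₀) :
    EqOn x z (Ioo a b) := by
  obtain ⟨K, hK⟩ := isCompact_Icc.bddAbove_image (f := fun t => ‖A t‖) (K := Icc a b)
    (by fun_prop)
  refine ODE_solution_unique_of_mem_Ioo (v := fun t x => A t x + g t) (s := fun _ => univ)
    (K := K.toNNReal) ?_ ht₀ (fun t ht => ⟨hx t ht, mem_univ _⟩)
    (fun t ht => ⟨hz t ht, mem_univ _⟩) h0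
  intro t ht
  refine LipschitzWith.lipschitzOnWith (LipschitzWith.of_dist_le_mul fun u v => ?_)
  rw [dist_add_right, dist_eq_norm, ← map_sub, dist_eq_norm]
  refine (ContinuousLinearMap.le_opNorm _ _).trans ?_
  gcongr
  exact (hK ⟨t, ⟨ht.1.le, ht.2.le⟩, rfl⟩).trans (Real.le_coe_toNNReal K)

variable [CompleteSpace E]

/-- Linear ordinary differential equations have global solutions. -/
theorem exists_global_solution_linear {A : ℝ → E →L[ℝ] E} {g : ℝ → E} (hA : Continuous A)
    (hg : Continuous g) (t₀ : ℝ) (x₀ : E) :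
    ∃ x : ℝ → E, x t₀ = x₀ ∧ ∀ t, HasDerivAt x (A t (x t) + g t) t := by
  -- The factor 2 makes the Picard map a 1/2-contraction for the weight `ϖ`; the summand `‖g s‖`
  -- lets the same weight absorb the source without any growth assumption.
  set k : ℝ → ℝ := fun s => 2 * ‖A s‖ + ‖g s‖ with hkdef
  have hk : Continuous k := by fun_prop
  have hk0 : ∀ s, 0 ≤ k s := fun s => by positivity
  set ϖ : ℝ → ℝ := fun t => Real.exp |∫ τ in t₀..t, k τ| with hϖ
  have hc : Continuous fun s => ∫ τ in t₀..s, k τ :=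
    continuous_iff_continuousAt.2 fun s => (intervalIntegral.integral_hasDerivAt_right
      (hk.intervalIntegrable _ _)
      hk.aestronglyMeasurable.stronglyMeasurableAtFilter hk.continuousAt).continuousAt
  have hϖc : Continuous ϖ := by fun_prop
  have hϖp : ∀ t, 0 < ϖ t := fun t => Real.exp_pos _
  have hϖ1 : ∀ t, 1 ≤ ϖ t := fun t => Real.one_le_exp (abs_nonneg _)
  have hIc : ∀ F : ℝ → E, Continuous F → ∀ t, HasDerivAt (fun t => ∫ s in t₀..t, F s) (F t) t :=
    fun F hF t => intervalIntegral.integral_hasDerivAt_right (hF.intervalIntegrable _ _)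
      hF.aestronglyMeasurable.stronglyMeasurableAtFilter hF.continuousAt
  set X : (ℝ →ᵇ E) → ℝ → E := fun y t => x₀ + ∫ s in t₀..t, (A s (ϖ s • y s) + g s) with hX
  have hXd : ∀ y t, HasDerivAt (X y) (A t (ϖ t • y t) + g t) t := fun y t =>
    (hIc _ (by fun_prop) t).const_add x₀
  have hXc : ∀ y, Continuous (X y) := fun y =>
    continuous_iff_continuousAt.2 fun t => (hXd y t).continuousAt
  have hXb : ∀ y t, ‖(ϖ t)⁻¹ • X y t‖ ≤ ‖x₀‖ + (‖y‖ + 1) := by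
    intro y t
    have h1 : ‖∫ s in t₀..t, (A s (ϖ s • y s) + g s)‖ ≤ |‖y‖ + 1| * ϖ t := by
      refine norm_integral_le_of_weight hk hk0 t₀ (fun s => ?_) t
      have ha : ‖A s (ϖ s • y s)‖ ≤ ‖A s‖ * (ϖ s * ‖y‖) := by
        refine (ContinuousLinearMap.le_opNorm _ _).trans ?_
        rw [norm_smul, Real.norm_of_nonneg (hϖp s).le]
        have := y.norm_coe_le_norm s
        have := (hϖp s).le
        gcongr
      have hn := norm_add_le (A s (ϖ s • y s)) (g s)
      have h3 : ‖g s‖ * 1 ≤ ‖g s‖ * ϖ s := by gcongr; exact hϖ1 s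
      have e : (‖y‖ + 1) * (k s * ϖ s) = ‖A s‖ * (ϖ s * ‖y‖) + ‖g s‖ * ϖ s +
        (‖A s‖ * (ϖ s * ‖y‖) + 2 * ‖A s‖ * ϖ s + ‖g s‖ * ‖y‖ * ϖ s) := by
        simp only [hkdef]; ring
      have : 0 ≤ ‖A s‖ * (ϖ s * ‖y‖) + 2 * ‖A s‖ * ϖ s + ‖g s‖ * ‖y‖ * ϖ s := by
        have := (hϖp s).le; positivity
      change _ ≤ (‖y‖ + 1) * (k s * ϖ s)
      rw [e]; linarith
    rw [norm_smul, norm_inv, Real.norm_of_nonneg (hϖp t).le, inv_mul_le_iff₀ (hϖp t)]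
    rw [abs_of_nonneg (by positivity)] at h1
    have h2 := norm_add_le x₀ (∫ s in t₀..t, (A s (ϖ s • y s) + g s))
    have h3 : ‖x₀‖ * 1 ≤ ‖x₀‖ * ϖ t := by gcongr; exact hϖ1 t
    simp only [hX]
    nlinarith
  -- The Picard map in the unknown `x / ϖ`, which is bounded even though `x` need not be.
  set T : (ℝ →ᵇ E) → (ℝ →ᵇ E) := fun y =>
    BoundedContinuousFunction.ofNormedAddCommGroup (fun t => (ϖ t)⁻¹ • X y t)
      ((hϖc.inv₀ fun t => (hϖp t).ne').smul (hXc y)) _ (hXb y) with hT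
  have hTc : ContractingWith (1 / 2) T := by
    refine ⟨by norm_num, LipschitzWith.of_dist_le_mul fun y z => ?_⟩
    rw [BoundedContinuousFunction.dist_le (by positivity)]
    intro t
    change dist ((ϖ t)⁻¹ • X y t) ((ϖ t)⁻¹ • X z t) ≤ _
    rw [dist_eq_norm, ← smul_sub]
    have e : X y t - X z t = ∫ s in t₀..t, A s (ϖ s • (y s - z s)) := by
      simp only [hX, add_sub_add_left_eq_sub]
      rw [← intervalIntegral.integral_sub (Continuous.intervalIntegrable (by fun_prop) _ _)
        (Continuous.intervalIntegrable (by fun_prop) _ _)]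
      congr 1; ext s; rw [smul_sub, map_sub]; abel
    have h1 : ‖∫ s in t₀..t, A s (ϖ s • (y s - z s))‖ ≤ |1 / 2 * dist y z| * ϖ t := by
      refine norm_integral_le_of_weight hk hk0 t₀ (fun s => ?_) t
      have ha : ‖A s (ϖ s • (y s - z s))‖ ≤ ‖A s‖ * (ϖ s * dist y z) := by
        refine (ContinuousLinearMap.le_opNorm _ _).trans ?_
        rw [norm_smul, Real.norm_of_nonneg (hϖp s).le, ← dist_eq_norm]
        have := BoundedContinuousFunction.dist_coe_le_dist (f := y) (g := z) s
        have := (hϖp s).le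
        gcongr
      refine ha.trans ?_
      change _ ≤ 1 / 2 * dist y z * ((2 * ‖A s‖ + ‖g s‖) * ϖ s)
      have h0 : 0 ≤ ‖g s‖ * dist y z * ϖ s := by have := (hϖp s).le; positivity
      nlinarith
    rw [norm_smul, norm_inv, Real.norm_of_nonneg (hϖp t).le, inv_mul_le_iff₀ (hϖp t), e]
    rw [abs_of_nonneg (by positivity)] at h1
    refine h1.trans (le_of_eq ?_)
    push_cast; ring
  set y := hTc.fixedPoint
  have hy : T y = y := hTc.fixedPoint_isFixedPt
  have hyt : ∀ t, ϖ t • y t = X y t := fun t => by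
    have : y t = (ϖ t)⁻¹ • X y t := (congrArg (fun z : ℝ →ᵇ E => z t) hy).symm
    rw [this, smul_smul, mul_inv_cancel₀ (hϖp t).ne', one_smul]
  refine ⟨X y, by simp [hX], fun t => ?_⟩
  have := hXd y t
  rwa [hyt] at this

end LinearODE

/-! ### The equation for W = rV on the whole line -/

/-- The matrix of the equation `W'' = (r/2) W' + q W`. -/
def odeMat (q : ℝ → ℝ) (t : ℝ) : ℝ × ℝ →L[ℝ] ℝ × ℝ :=
  (ContinuousLinearMap.inl ℝ ℝ ℝ).comp (ContinuousLinearMap.snd ℝ ℝ ℝ)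
    + (t / 2) • (ContinuousLinearMap.inr ℝ ℝ ℝ).comp (ContinuousLinearMap.snd ℝ ℝ ℝ)
    + q t • (ContinuousLinearMap.inr ℝ ℝ ℝ).comp (ContinuousLinearMap.fst ℝ ℝ ℝ)

theorem odeMat_apply (q : ℝ → ℝ) (t : ℝ) (x : ℝ × ℝ) :
    odeMat q t x = (x.2, t / 2 * x.2 + q t * x.1) := by
  ext <;> simp [odeMat]

theorem continuous_odeMat {q : ℝ → ℝ} (hq : Continuous q) : Continuous (odeMat q) := by
  unfold odeMat; fun_prop

/-- `W` solves `-W'' + (r/2) W' + q W = h` on `ℝ`. -/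
def SolvesW (q h W : ℝ → ℝ) : Prop :=
  ContDiff ℝ ∞ W ∧ ∀ r, HasDerivAt (deriv W) (r / 2 * deriv W r + q r * W r - h r) r

/-- Existence is that of the first order system for (W, W'). Regularity is a bootstrap: if both
components are C^k, their derivatives, given by the system, are C^k as well. -/
theorem exists_solvesW {q h : ℝ → ℝ} (hq : ContDiff ℝ ∞ q) (hh : ContDiff ℝ ∞ h)
    (t₀ A B : ℝ) : ∃ W, SolvesW q h W ∧ W t₀ = A ∧ deriv W t₀ = B := by
  obtain ⟨x, hx0, hx⟩ := exists_global_solution_linear (continuous_odeMat hq.continuous)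
    (g := fun t => (0, -h t)) (by have := hh.continuous; fun_prop) t₀ (A, B)
  have h1 : ∀ t, HasDerivAt (fun t => (x t).1) (x t).2 t := fun t => by
    have := (hasFDerivAt_fst (p := x t) (𝕜 := ℝ) (E := ℝ) (F := ℝ)).comp_hasDerivAt t (hx t)
    exact this.congr_deriv (by simp [odeMat_apply])
  have h2 : ∀ t, HasDerivAt (fun t => (x t).2) (t / 2 * (x t).2 + q t * (x t).1 - h t) t :=
    fun t => by
    have := (hasFDerivAt_snd (p := x t) (𝕜 := ℝ) (E := ℝ) (F := ℝ)).comp_hasDerivAt t (hx t)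
    exact this.congr_deriv (by simp [odeMat_apply, sub_eq_add_neg])
  have hd : deriv (fun t => (x t).1) = fun t => (x t).2 := funext fun t => (h1 t).deriv
  have hd2 : deriv (fun t => (x t).2) = fun t => t / 2 * (x t).2 + q t * (x t).1 - h t :=
    funext fun t => (h2 t).deriv
  have hs : ∀ k : ℕ, ContDiff ℝ k (fun t => (x t).1) ∧ ContDiff ℝ k (fun t => (x t).2) := by
    intro k
    induction k with
    | zero =>
      simp only [CharP.cast_eq_zero, contDiff_zero]
      exact ⟨continuous_iff_continuousAt.2 fun t => (h1 t).continuousAt,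
        continuous_iff_continuousAt.2 fun t => (h2 t).continuousAt⟩
    | succ k ih =>
      have hq' : ContDiff ℝ k q := hq.of_le (by exact_mod_cast le_top)
      have hh' : ContDiff ℝ k h := hh.of_le (by exact_mod_cast le_top)
      have ih1 := ih.1
      have ih2 := ih.2
      push_cast
      rw [contDiff_succ_iff_deriv, contDiff_succ_iff_deriv, hd, hd2]
      refine ⟨⟨fun t => (h1 t).differentiableAt, by simp, ih.2⟩,
        fun t => (h2 t).differentiableAt, by simp, ?_⟩
      fun_prop
  refine ⟨fun t => (x t).1, ⟨contDiff_infty.2 fun k => (hs k).1, fun r => ?_⟩, by simp [hx0],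
    by rw [hd]; simp [hx0]⟩
  rw [hd]; exact h2 r

/-- Both pairs solve the equation only beyond `R`: this serves to identify a solution built near
infinity with a global one having the same Cauchy data. -/
theorem eqOn_of_solves {q h W Y W₂ Y₂ : ℝ → ℝ} (hq : Continuous q) {R t₀ : ℝ} (ht₀ : R < t₀)
    (h1 : ∀ r, R < r → HasDerivAt W (Y r) r)
    (h2 : ∀ r, R < r → HasDerivAt Y (r / 2 * Y r + q r * W r - h r) r)
    (k1 : ∀ r, R < r → HasDerivAt W₂ (Y₂ r) r)
    (k2 : ∀ r, R < r → HasDerivAt Y₂ (r / 2 * Y₂ r + q r * W₂ r - h r) r)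
    (e1 : W t₀ = W₂ t₀) (e2 : Y t₀ = Y₂ t₀) : ∀ r, R < r → W r = W₂ r := by
  intro r hr
  have := solution_linear_unique (A := odeMat q) (g := fun t => (0, -h t)) (continuous_odeMat hq)
    (a := R) (b := max t₀ r + 1) (t₀ := t₀) ⟨ht₀, by linarith [le_max_left t₀ r]⟩
    (x := fun t => (W t, Y t)) (z := fun t => (W₂ t, Y₂ t))
    (fun t ht => ((h1 t ht.1).prodMk (h2 t ht.1)).congr_deriv
      (by simp [odeMat_apply, sub_eq_add_neg]))
    (fun t ht => ((k1 t ht.1).prodMk (k2 t ht.1)).congr_deriv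
      (by simp [odeMat_apply, sub_eq_add_neg]))
    (by simp [e1, e2])
  exact congrArg Prod.fst (@this r ⟨hr, by linarith [le_max_right t₀ r]⟩)

theorem SolvesW.differentiable {q h W : ℝ → ℝ} (hW : SolvesW q h W) : Differentiable ℝ W :=
  hW.1.differentiable (by simp)

/-- A solution with odd data that vanishes at `0` is odd. -/
theorem SolvesW.odd {q h W : ℝ → ℝ} (hq : Continuous q) (hqe : Function.Even q)
    (hho : Function.Odd h) (hW : SolvesW q h W) (h0 : W 0 = 0) : Function.Odd W := by
  -- The reflected function solves the same equation and has the same Cauchy data at 0 because `W 0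
  -- = 0`.
  have key : ∀ r, W r = -W (-r) := by
    intro r
    refine eqOn_of_solves (q := q) (h := h) (W := W) (Y := deriv W) (W₂ := fun r => -W (-r))
      (Y₂ := fun r => deriv W (-r)) hq (R := min r 0 - 1) (t₀ := 0)
      (by linarith [min_le_right r 0]) (fun r _ => (hW.differentiable r).hasDerivAt)
      (fun r _ => hW.2 r) (fun r _ => ?_) (fun r _ => ?_) (by simp [h0]) (by simp) r
      (by linarith [min_le_left r 0])
    · have := ((hW.differentiable (-r)).hasDerivAt.scomp r (hasDerivAt_neg r)).neg
      exact this.congr_deriv (by simp)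
    · have := (hW.2 (-r)).scomp r (hasDerivAt_neg r)
      refine this.congr_deriv ?_
      rw [hqe r, hho r]; simp; ring
  intro r
  rw [key r]; simp

/-! ### Solutions of polynomial growth at infinity -/

theorem integrableOn_wexp (e : ℝ) {R : ℝ} (hR : 1 ≤ R) : IntegrableOn (wexp e) (Ioi R) := by
  have h1 := (integrableOn_rpow_mul_exp_neg_mul_sq (b := 1 / 4) (by norm_num) (s := |e|)
    (by linarith [abs_nonneg e])).mono_set (Ioi_subset_Ioi (by linarith : (0 : ℝ) ≤ R))
  refine Integrable.mono' h1 ?_ ?_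
  · refine ContinuousOn.aestronglyMeasurable (fun x hx => ?_) measurableSet_Ioi
    have : R < x := hx
    exact (hasDerivAt_wexp e (by linarith)).continuousAt.continuousWithinAt
  · refine (ae_restrict_mem measurableSet_Ioi).mono fun x hx => ?_
    have : R < x := hx
    have hx0 : 0 < x := by linarith
    rw [Real.norm_of_nonneg (wexp_pos hx0).le, wexp, mul_comm,
      show -x ^ 2 / 4 = -(1 / 4) * x ^ 2 by ring]
    gcongr
    · linarith
    · exact le_abs_self e

theorem hasDerivAt_integral_of_continuous {F : ℝ → ℝ} (hF : Continuous F) (a t : ℝ) :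
    HasDerivAt (fun t => ∫ s in a..t, F s) (F t) t :=
  intervalIntegral.integral_hasDerivAt_right (hF.intervalIntegrable _ _)
    hF.aestronglyMeasurable.stronglyMeasurableAtFilter hF.continuousAt

theorem continuous_integral_of_continuous {F : ℝ → ℝ} (hF : Continuous F) (a : ℝ) :
    Continuous (fun t => ∫ s in a..t, F s) :=
  continuous_iff_continuousAt.2 fun t => (hasDerivAt_integral_of_continuous hF a t).continuousAt

/-- Since `m ≥ 1`, the factor 1/m produced by the integration is at most 1, so the constant does not
deteriorate. -/
theorem abs_integral_le_rpow {m R D : ℝ} (hm : 1 ≤ m) (hR : 1 ≤ R) (hD : 0 ≤ D) {y : ℝ → ℝ}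
    (hy : ∀ r, R ≤ r → |y r| ≤ D * r ^ (m - 1)) {r : ℝ} (hr : R ≤ r) :
    |∫ s in R..r, y s| ≤ D * r ^ m := by
  have h1 := intervalIntegral.norm_integral_le_of_norm_le (a := R) (b := r) (f := y)
    (g := fun s => D * s ^ (m - 1)) (μ := volume) hr
    (.of_forall fun s hs => hy s hs.1.le)
    ((intervalIntegral.intervalIntegrable_rpow' (by linarith)).const_mul D)
  rw [intervalIntegral.integral_const_mul, integral_rpow (Or.inl (by linarith))] at h1
  refine h1.trans (mul_le_mul_of_nonneg_left ?_ hD)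
  rw [sub_add_cancel]
  have h2 : 0 ≤ R ^ m := by positivity
  have h3 : 0 ≤ r ^ m := by have : 0 ≤ r := by linarith
                            positivity
  calc (r ^ m - R ^ m) / m ≤ (r ^ m - 0) / 1 := by gcongr
    _ = r ^ m := by ring

/-- The decaying solution of `-y' + (r/2 + c/r) y = H` on `[R, ∞)`. -/
def decaySol (c R : ℝ) (H : ℝ → ℝ) (r : ℝ) : ℝ :=
  ((∫ t in Ioi R, wexp (-c) (max t R) * H t) - ∫ t in R..r, wexp (-c) (max t R) * H t) /
    wexp (-c) (max r R)

theorem continuous_wexp_max (c : ℝ) {R : ℝ} (hR : 1 ≤ R) :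
    Continuous fun t => wexp c (max t R) := by
  refine continuous_iff_continuousAt.2 fun t => ?_
  have h : 0 < max t R := lt_of_lt_of_le (by linarith) (le_max_right t R)
  exact (hasDerivAt_wexp c h).continuousAt.comp (f := fun t => max t R) (by fun_prop)

section decaySol
variable {c R : ℝ} {H : ℝ → ℝ}

theorem continuous_decaySol (hR : 1 ≤ R) (hH : Continuous H) : Continuous (decaySol c R H) := by
  unfold decaySol
  have h1 := continuous_wexp_max (-c) hR
  refine Continuous.div (continuous_const.sub
    (continuous_integral_of_continuous (h1.mul hH) R)) h1 fun t => ?_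
  exact (wexp_pos (lt_of_lt_of_le (by linarith) (le_max_right t R))).ne'

theorem hasDerivAt_decaySol (hR : 1 ≤ R) (hH : Continuous H) {r : ℝ} (hr : R < r) :
    HasDerivAt (decaySol c R H) ((r / 2 + c / r) * decaySol c R H r - H r) r := by
  have h1 := continuous_wexp_max (-c) hR
  have hr0 : 0 < r := by linarith
  have hw : HasDerivAt (fun t => wexp (-c) (max t R)) (-(wexp (-c) r * (r / 2 - -c / r))) r := by
    refine (hasDerivAt_wexp (-c) hr0).congr_of_eventuallyEq ?_
    filter_upwards [eventually_gt_nhds hr] with x hx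
    rw [max_eq_left hx.le]
  have hpos := (wexp_pos (e := -c) hr0).ne'
  have hm : max r R = r := max_eq_left hr.le
  have := ((hasDerivAt_integral_of_continuous (h1.mul hH) R r).const_sub
    (∫ t in Ioi R, wexp (-c) (max t R) * H t)).div hw (by rw [hm]; exact hpos)
  refine this.congr_deriv ?_
  simp only [decaySol, hm, Pi.mul_apply]
  field_simp
  ring

/-- The numerator of `decaySol` is the tail of a convergent integral, so the weighted solution tends
to 0 and the comparison lemma applies. -/
theorem abs_decaySol_le (hR : 1 ≤ R) (hH : Continuous H) {m C : ℝ}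
    (hRc : 4 * (m - 1 - c) ≤ R ^ 2) (hb : ∀ r, R ≤ r → |H r| ≤ C * r ^ m) :
    Tendsto (fun r => wexp (-c) r * decaySol c R H r) atTop (𝓝 0) ∧
    ∀ r, R ≤ r → |decaySol c R H r| ≤ 4 * C * r ^ (m - 1) := by
  have h1 := continuous_wexp_max (-c) hR
  have hint : IntegrableOn (fun t => wexp (-c) (max t R) * H t) (Ioi R) := by
    refine Integrable.mono' ((integrableOn_wexp (-c + m) hR).const_mul C)
      (h1.mul hH).aestronglyMeasurable ?_
    refine (ae_restrict_mem measurableSet_Ioi).mono fun x hx => ?_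
    have hx' : R < x := hx
    have hx0 : 0 < x := by linarith
    rw [norm_mul, max_eq_left hx'.le, Real.norm_of_nonneg (wexp_pos hx0).le, Real.norm_eq_abs,
      ← wexp_mul_rpow hx0]
    calc wexp (-c) x * |H x| ≤ wexp (-c) x * (C * x ^ m) :=
          mul_le_mul_of_nonneg_left (hb x hx'.le) (wexp_pos hx0).le
      _ = _ := by ring
  have hlim : Tendsto (fun r => wexp (-c) r * decaySol c R H r) atTop (𝓝 0) := by
    have h2 := (intervalIntegral_tendsto_integral_Ioi R hint tendsto_id).const_sub
      (∫ t in Ioi R, wexp (-c) (max t R) * H t)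
    rw [sub_self] at h2
    refine h2.congr' ?_
    filter_upwards [eventually_ge_atTop R] with r hr
    have hr0 : 0 < r := by linarith
    have := (wexp_pos (e := -c) hr0).ne'
    simp only [decaySol, max_eq_left hr, id]
    field_simp
  exact ⟨hlim, abs_le_of_firstOrder (by linarith) hRc (fun r hr => hasDerivAt_decaySol hR hH hr)
    (continuous_decaySol hR hH).continuousOn (fun r hr => hb r hr.le) hlim⟩

end decaySol

/-- Solutions of `-u'' + (r/2 + c/r) u' = e u + g` on `[R, ∞)` with polynomial growth and a
prescribed value at `R`, when `e = O(r^{-2})` and `R` is large. -/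
theorem exists_solution_near_infinity {c m R D Cg : ℝ} {e g : ℝ → ℝ} (u₀ : ℝ)
    (he : Continuous e) (hg : Continuous g) (hm : 1 ≤ m) (hR : 1 ≤ R) (hD : 0 ≤ D)
    (hRc : 4 * (m - 1 - c) ≤ R ^ 2) (hRD : 8 * D ≤ R ^ 2)
    (heb : ∀ r, R ≤ r → |e r| ≤ D * r ^ (-2 : ℝ)) (hgb : ∀ r, R ≤ r → |g r| ≤ Cg * r ^ m) :
    ∃ u y : ℝ → ℝ, u R = u₀ ∧ Continuous u ∧ (∀ r, HasDerivAt u (y r) r) ∧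
      (∀ r, R < r → HasDerivAt y ((r / 2 + c / r) * y r - (e r * u r + g r)) r) ∧
      ∃ C, (∀ r, R ≤ r → |u r| ≤ C * r ^ m) ∧ ∀ r, R ≤ r → |y r| ≤ C * r ^ (m - 1) := by
  have hmx : ∀ r, 0 < max r R := fun r => lt_of_lt_of_le (by linarith) (le_max_right r R)
  have hpc : Continuous fun r => (max r R) ^ m :=
    Continuous.rpow_const (by fun_prop) fun x => Or.inl (hmx x).ne'
  have hCg : 0 ≤ Cg := by
    have h1 := (abs_nonneg _).trans (hgb R le_rfl)
    have : 0 < R ^ m := by positivity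
    exact nonneg_of_mul_nonneg_left h1 this
  -- The unknown of the fixed point is φ = u / r^m, a bounded function. Freezing the variable at `R`
  -- with `max` keeps every weight continuous on all of ℝ.
  set H : (ℝ →ᵇ ℝ) → ℝ → ℝ := fun φ t => e t * ((max t R) ^ m * φ t) + g t with hH
  have hHc : ∀ φ, Continuous (H φ) := fun φ => by
    exact (he.mul (hpc.mul φ.continuous)).add hg
  have hHb : ∀ φ r, R ≤ r → |H φ r| ≤ (D * ‖φ‖ + Cg) * r ^ m := by
    intro φ r hr
    have hr0 : 0 < r := by linarith
    have h1 := φ.norm_coe_le_norm r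
    rw [Real.norm_eq_abs] at h1
    have h2 : r ^ (-2 : ℝ) ≤ 1 := Real.rpow_le_one_of_one_le_of_nonpos (by linarith) (by norm_num)
    have h3 := heb r hr
    have h4 := hgb r hr
    simp only [hH, max_eq_left hr]
    have h0 : 0 < r ^ m := by positivity
    calc |e r * (r ^ m * φ r) + g r| ≤ |e r * (r ^ m * φ r)| + |g r| := abs_add_le _ _
      _ = |e r| * (r ^ m * |φ r|) + |g r| := by rw [abs_mul, abs_mul, abs_of_pos h0]
      _ ≤ (D * 1) * (r ^ m * ‖φ‖) + Cg * r ^ m := by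
        gcongr; exact h3.trans (by gcongr)
      _ = _ := by ring
  set y : (ℝ →ᵇ ℝ) → ℝ → ℝ := fun φ => decaySol c R (H φ) with hy
  have hyc : ∀ φ, Continuous (y φ) := fun φ => continuous_decaySol hR (hHc φ)
  have hyb : ∀ φ r, R ≤ r → |y φ r| ≤ (4 * (D * ‖φ‖ + Cg)) * r ^ (m - 1) := fun φ =>
    (abs_decaySol_le hR (hHc φ) hRc (hHb φ)).2
  set u : (ℝ →ᵇ ℝ) → ℝ → ℝ := fun φ r => u₀ + ∫ s in R..r, y φ s with hu
  have hud : ∀ φ r, HasDerivAt (u φ) (y φ r) r := fun φ r =>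
    (hasDerivAt_integral_of_continuous (hyc φ) R r).const_add u₀
  have huc : ∀ φ, Continuous (u φ) := fun φ =>
    continuous_iff_continuousAt.2 fun t => (hud φ t).continuousAt
  have hub : ∀ φ r, R ≤ r → |u φ r| ≤ (|u₀| + 4 * (D * ‖φ‖ + Cg)) * r ^ m := by
    intro φ r hr
    have h1 := abs_integral_le_rpow hm hR (by positivity) (hyb φ) hr
    have h2 : 1 ≤ r ^ m := Real.one_le_rpow (by linarith) (by linarith)
    have h3 := abs_add_le u₀ (∫ s in R..r, y φ s)
    have h4 := abs_nonneg u₀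
    simp only [hu]
    nlinarith
  have hTb : ∀ φ r, ‖u φ (max r R) / (max r R) ^ m‖ ≤ |u₀| + 4 * (D * ‖φ‖ + Cg) := by
    intro φ r
    have h0 : 0 < (max r R) ^ m := Real.rpow_pos_of_pos (hmx r) _
    rw [norm_div, Real.norm_eq_abs, Real.norm_of_nonneg h0.le, div_le_iff₀ h0]
    exact hub φ _ (le_max_right _ _)
  set T : (ℝ →ᵇ ℝ) → (ℝ →ᵇ ℝ) := fun φ =>
    BoundedContinuousFunction.ofNormedAddCommGroup (fun r => u φ (max r R) / (max r R) ^ m)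
      (Continuous.div ((huc φ).comp (by fun_prop)) hpc
        fun r => (Real.rpow_pos_of_pos (hmx r) _).ne') _ (hTb φ) with hT
  have hTc : ContractingWith (1 / 2) T := by
    refine ⟨by norm_num, LipschitzWith.of_dist_le_mul fun φ ψ => ?_⟩
    rw [BoundedContinuousFunction.dist_le (by positivity)]
    intro r
    change dist (u φ (max r R) / (max r R) ^ m) (u ψ (max r R) / (max r R) ^ m) ≤ _
    have h0 : 0 < (max r R) ^ m := Real.rpow_pos_of_pos (hmx r) _
    rw [Real.dist_eq, ← sub_div, abs_div, abs_of_pos h0, div_le_iff₀ h0]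
    -- In the difference the source `g` disappears and `e = O(r^{-2})` remains, which gains two
    -- powers; as `8 D ≤ R ^ 2`, they turn the constant `4 D` into at most 1/2.
    have hyd : ∀ r, R ≤ r → |y φ r - y ψ r| ≤ (4 * (D * dist φ ψ)) * r ^ (m - 2 - 1) := by
      refine abs_le_of_firstOrder (c := c) (H := fun r => H φ r - H ψ r) (by linarith)
        (by linarith) (fun r hr => ?_) ((hyc φ).sub (hyc ψ)).continuousOn (fun r hr => ?_) ?_
      · exact ((hasDerivAt_decaySol hR (hHc φ) hr).sub
          (hasDerivAt_decaySol hR (hHc ψ) hr)).congr_deriv (by ring)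
      · have hr0 : 0 < r := by linarith
        have h1 := BoundedContinuousFunction.dist_coe_le_dist (f := φ) (g := ψ) r
        rw [Real.dist_eq] at h1
        simp only [hH, max_eq_left hr.le]
        have h2 : 0 < r ^ m := by positivity
        rw [show e r * (r ^ m * φ r) + g r - (e r * (r ^ m * ψ r) + g r) =
          e r * (r ^ m * (φ r - ψ r)) by ring, abs_mul, abs_mul, abs_of_pos h2,
          show m - 2 = -2 + m by ring, Real.rpow_add hr0]
        calc |e r| * (r ^ m * |φ r - ψ r|) ≤ (D * r ^ (-2 : ℝ)) * (r ^ m * dist φ ψ) := by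
              gcongr; exact heb r hr.le
          _ = _ := by ring
      · have := (abs_decaySol_le hR (hHc φ) hRc (hHb φ)).1.sub
          (abs_decaySol_le hR (hHc ψ) hRc (hHb ψ)).1
        rw [sub_zero] at this
        exact this.congr fun r => by ring
    have hyd2 : ∀ r, R ≤ r → |y φ r - y ψ r| ≤ (1 / 2 * dist φ ψ) * r ^ (m - 1) := by
      intro r hr
      have hr0 : 0 < r := by linarith
      refine (hyd r hr).trans ?_
      rw [show m - 2 - 1 = (m - 1) - 2 by ring, Real.rpow_sub hr0, Real.rpow_two]
      have h2 : 0 < r ^ (m - 1) := by positivity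
      have h3 : D / r ^ 2 ≤ 1 / 8 := by
        rw [div_le_iff₀ (by positivity)]; nlinarith
      calc 4 * (D * dist φ ψ) * (r ^ (m - 1) / r ^ 2)
          = 4 * (D / r ^ 2) * dist φ ψ * r ^ (m - 1) := by ring
        _ ≤ 4 * (1 / 8) * dist φ ψ * r ^ (m - 1) := by gcongr
        _ = _ := by ring
    have := abs_integral_le_rpow hm hR (by positivity) hyd2 (le_max_right r R)
    rw [intervalIntegral.integral_sub ((hyc φ).intervalIntegrable _ _)
      ((hyc ψ).intervalIntegrable _ _)] at this
    simp only [hu, add_sub_add_left_eq_sub]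
    simpa using this
  set φ := hTc.fixedPoint
  have hφ : T φ = φ := hTc.fixedPoint_isFixedPt
  have hφr : ∀ r, R ≤ r → r ^ m * φ r = u φ r := fun r hr => by
    have : φ r = u φ (max r R) / (max r R) ^ m := (congrArg (fun z : ℝ →ᵇ ℝ => z r) hφ).symm
    have h0 : 0 < (max r R) ^ m := Real.rpow_pos_of_pos (hmx r) _
    rw [max_eq_left hr] at this h0
    rw [this]; field_simp
  refine ⟨u φ, y φ, by simp [hu], huc φ, hud φ, fun r hr => ?_,
    |u₀| + 4 * (D * ‖φ‖ + Cg), hub φ, fun r hr => (hyb φ r hr).trans ?_⟩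
  · refine (hasDerivAt_decaySol hR (hHc φ) hr).congr_deriv ?_
    simp only [hH, max_eq_left hr.le, hφr r hr.le]
    rfl
  · have hr0 : 0 < r := by linarith
    have := abs_nonneg u₀
    gcongr
    linarith

/-- Passing from `u` to `V = r^{-2a} u` and back to the equation for `V`. -/
theorem hasDerivAt_rpow_neg_mul {a r : ℝ} (hr : 0 < r) {u : ℝ → ℝ} {y : ℝ}
    (hu : HasDerivAt u y r) :
    HasDerivAt (fun r => r ^ (-(2 * a)) * u r) (r ^ (-(2 * a)) * (y - 2 * a * u r / r)) r := by
  refine ((Real.hasDerivAt_rpow_const (p := -(2 * a)) (Or.inl hr.ne')).mul hu).congr_deriv ?_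
  rw [Real.rpow_sub hr, Real.rpow_one]
  field_simp
  ring

theorem isBigO_rpow_mul {s t : ℝ} {f : ℝ → ℝ} (h : f =O[atTop] fun r : ℝ => r ^ t) :
    (fun r => r ^ s * f r) =O[atTop] fun r : ℝ => r ^ (s + t) := by
  refine ((isBigO_refl (fun r : ℝ => r ^ s) atTop).mul h).congr' EventuallyEq.rfl ?_
  filter_upwards [eventually_gt_atTop 0] with r hr
  rw [Real.rpow_add hr]

/-- Solutions of the equation with symbol bounds at infinity. -/
theorem exists_good_solution {P f : ℝ → ℝ} {a σ : ℝ} (hP : ContDiff ℝ ∞ P)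
    (hPs : ∀ k, SyO k 2 P) (ha : σ ≤ 2 * a) (hf : SymM σ f) (x : ℝ) :
    ∃ W, SolvesW (fun r => a - 1 / 2 - P r) (fun r => r * f r) W ∧
      (∀ ε > 0, ∀ k, SyO k (σ - ε) (fun r => W r / r)) ∧ ∃ R, W R = x := by
  -- With V = r^{-2a} u, the power r^{-2a} being annihilated by (r/2)∂_r + a, the zeroth order term
  -- reduces to `e = O(r^{-2})`, and the drift acquires the coefficient `c`. The exponent `m` is 2a
  -- - σ + ε with ε = 1, a first crude growth rate.
  set c : ℝ := 4 * a - 2 with hc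
  set m : ℝ := 2 * a - σ + 1 with hm
  set e : ℝ → ℝ := fun r => P r + 2 * a * (2 * a - 1) * (max r 1) ^ (-2 : ℝ) with he
  set g : ℝ → ℝ := fun r => (max r 1) ^ (2 * a) * f r with hg
  have hmx : ∀ r : ℝ, max r 1 ≠ 0 := fun r => (lt_of_lt_of_le one_pos (le_max_right r 1)).ne'
  have hrc : ∀ s : ℝ, Continuous fun r : ℝ => (max r 1) ^ s := fun s =>
    Continuous.rpow_const (by fun_prop) fun r => Or.inl (hmx r)
  have hec : Continuous e := hP.continuous.add (continuous_const.mul (hrc _))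
  have hgc : Continuous g := (hrc _).mul hf.1.continuous
  have hme : ∀ s : ℝ, (fun r : ℝ => (max r 1) ^ s) =ᶠ[atTop] fun r => r ^ s := fun s => by
    filter_upwards [eventually_ge_atTop 1] with r hr
    rw [max_eq_left hr]
  have heO : e =O[atTop] fun r : ℝ => r ^ (-2 : ℝ) :=
    (hPs 0).isBigO.add ((hme (-2)).isBigO.const_mul_left _)
  have hgO : ∀ ε > 0, g =O[atTop] fun r : ℝ => r ^ (2 * a - σ + ε) := fun ε hε => by
    refine (isBigO_rpow_mul (s := 2 * a) (hf.2.2 ε hε 0).isBigO).congr' ?_ ?_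
    · filter_upwards [hme (2 * a)] with r hr
      simp only [hg]; rw [hr]
    · filter_upwards with r
      congr 1; ring
  obtain ⟨D, hD0, hD⟩ := heO.exists_pos
  obtain ⟨Cg, hCg⟩ := (hgO 1 one_pos).bound
  obtain ⟨R₀, hR₀⟩ := eventually_atTop.1 (hD.bound.and hCg)
  set R := max (max R₀ 1) (max (1 + |4 * (m - 1 - c)|) (1 + 8 * D)) with hR
  have hR1 : 1 ≤ R := (le_max_right _ _).trans (le_max_left _ _)
  have hRR : R₀ ≤ R := (le_max_left _ _).trans (le_max_left _ _)
  have hR2 : 1 + |4 * (m - 1 - c)| ≤ R := (le_max_left _ _).trans (le_max_right _ _)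
  have hR3 : 1 + 8 * D ≤ R := (le_max_right _ _).trans (le_max_right _ _)
  -- The value prescribed at `R` is normalised so that W(R) = R^{1-2a} u(R) = x. With x = 1 and f =
  -- 0 this will give a nontrivial homogeneous solution.
  obtain ⟨u, y, huR, huc, hu, hy, C, hCu, hCy⟩ := exists_solution_near_infinity (c := c) (m := m)
    (R := R) (D := D) (Cg := Cg) (x * R ^ (2 * a - 1)) hec hgc (by rw [hm]; linarith) hR1 hD0.le
    (by have := le_abs_self (4 * (m - 1 - c)); nlinarith) (by nlinarith)
    (fun r hr => by
      have h := (hR₀ r (hRR.trans hr)).1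
      have : 0 < r := by linarith
      rwa [Real.norm_eq_abs, Real.norm_of_nonneg (by positivity)] at h)
    (fun r hr => by
      have h := (hR₀ r (hRR.trans hr)).2
      have : 0 < r := by linarith
      rwa [Real.norm_eq_abs, Real.norm_of_nonneg (by positivity)] at h)
  have hpos : ∀ r, R < r → 0 < r := fun r hr => by linarith
  set V₀ : ℝ → ℝ := fun r => r ^ (-(2 * a)) * u r with hV₀
  set z₀ : ℝ → ℝ := fun r => r ^ (-(2 * a)) * (y r - 2 * a * u r / r) with hz₀
  have hVd : ∀ r, R < r → HasDerivAt V₀ (z₀ r) r := fun r hr =>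
    hasDerivAt_rpow_neg_mul (hpos r hr) (hu r)
  have hzd : ∀ r, R < r →
      HasDerivAt z₀ ((r / 2 + -2 / r) * z₀ r - (f r + (P r - a) * V₀ r)) r := by
    intro r hr
    have hr0 := hpos r hr
    have h1 : HasDerivAt (fun r => y r - 2 * a * u r / r)
        ((r / 2 + c / r) * y r - (e r * u r + g r)
          - (2 * a * y r * r - 2 * a * u r * 1) / r ^ 2) r :=
      (hy r hr).sub (((hu r).const_mul (2 * a)).div (hasDerivAt_id r) hr0.ne')
    refine (hasDerivAt_rpow_neg_mul hr0 h1).congr_deriv ?_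
    have h2 : r ^ (-(2 * a)) * r ^ (2 * a) = 1 := by
      rw [← Real.rpow_add hr0]; simp
    simp only [hz₀, hV₀, he, hg, hc, max_eq_left (by linarith : (1 : ℝ) ≤ r)]
    rw [Real.rpow_neg hr0.le 2, Real.rpow_two]
    have h3 : r ^ (-(2 * a)) * ((r / 2 + (4 * a - 2) / r) * y r -
        ((P r + 2 * a * (2 * a - 1) * (r ^ 2)⁻¹) * u r + r ^ (2 * a) * f r) -
        (2 * a * y r * r - 2 * a * u r * 1) / r ^ 2 - 2 * a * (y r - 2 * a * u r / r) / r) =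
      r ^ (-(2 * a)) * ((r / 2 + (4 * a - 2) / r) * y r -
        ((P r + 2 * a * (2 * a - 1) * (r ^ 2)⁻¹) * u r) -
        (2 * a * y r * r - 2 * a * u r * 1) / r ^ 2 - 2 * a * (y r - 2 * a * u r / r) / r)
        - (r ^ (-(2 * a)) * r ^ (2 * a)) * f r := by ring
    rw [h3, h2]
    field_simp
    ring
  have hWd : ∀ r, R < r → HasDerivAt (fun r => r * V₀ r) (V₀ r + r * z₀ r) r := fun r hr =>
    ((hasDerivAt_id r).mul (hVd r hr)).congr_deriv (by simp)
  have hWd2 : ∀ r, R < r → HasDerivAt (fun r => V₀ r + r * z₀ r)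
      (r / 2 * (V₀ r + r * z₀ r) + (a - 1 / 2 - P r) * (r * V₀ r) - r * f r) r := fun r hr => by
    have := hpos r hr
    refine ((hVd r hr).add ((hasDerivAt_id r).mul (hzd r hr))).congr_deriv ?_
    simp only [id]
    field_simp
    ring
  have hq : ContDiff ℝ ∞ (fun r => a - 1 / 2 - P r) := contDiff_const.sub hP
  -- The solution is continued to ℝ through its Cauchy data at `R + 1`, a point interior to the
  -- region where the second order equation is known.
  obtain ⟨W, hW, hW0, hW1⟩ := exists_solvesW hq (contDiff_id.mul hf.1) (R + 1)
    ((R + 1) * V₀ (R + 1)) (V₀ (R + 1) + (R + 1) * z₀ (R + 1))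
  have heq : ∀ r, R < r → W r = r * V₀ r :=
    eqOn_of_solves hq.continuous (t₀ := R + 1) (by linarith)
      (fun r _ => (hW.differentiable r).hasDerivAt) (fun r _ => hW.2 r) hWd hWd2 hW0 hW1
  have hVW : V₀ =ᶠ[atTop] fun r => W r / r := by
    filter_upwards [eventually_gt_atTop R] with r hr
    have := hpos r hr
    rw [heq r hr]; field_simp
  refine ⟨W, hW, ?_, R, ?_⟩
  · have huO : u =O[atTop] fun r : ℝ => r ^ m := by
      refine IsBigO.of_bound C ?_
      filter_upwards [eventually_gt_atTop R] with r hr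
      have := hpos r hr
      rw [Real.norm_eq_abs, Real.norm_of_nonneg (by positivity)]
      exact hCu r hr.le
    have hyO : y =O[atTop] fun r : ℝ => r ^ (m - 1) := by
      refine IsBigO.of_bound C ?_
      filter_upwards [eventually_gt_atTop R] with r hr
      have := hpos r hr
      rw [Real.norm_eq_abs, Real.norm_of_nonneg (by positivity)]
      exact hCy r hr.le
    intro ε hε k
    -- The first order equation gives u' = O(r^{2a-σ+ε-1}). Here ε keeps the exponent after
    -- integration positive when 2a = σ, where a logarithm may appear.
    have huε : u =O[atTop] fun r : ℝ => r ^ (2 * a - σ + ε) := by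
      refine isBigO_of_deriv_isBigO (by linarith) (.of_forall hu) ?_
      have h1 : SyO 0 (-(2 * a - σ + ε)) (fun r => e r * u r + g r) := by
        refine SyO.add (SyO.mono (SyO.mul (s := 2) (t := -m) (k := 0) heO ?_) ?_) ?_
        · change u =O[atTop] fun r : ℝ => r ^ (-(-m)); simpa using huO
        · rw [hm]; linarith
        · change g =O[atTop] fun r : ℝ => r ^ (-(-(2 * a - σ + ε))); simpa using hgO ε hε
      have h2 := (h1.of_firstOrder (c := c) (y := y) (N := m - 1)
        ((eventually_gt_atTop R).mono hy) hyO).isBigO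
      refine h2.congr_right fun r => ?_
      congr 1; ring
    have hV0 : SyO 0 (σ - ε) V₀ := by
      refine (isBigO_rpow_mul (s := -(2 * a)) huε).congr_right fun r => ?_
      congr 1; ring
    have hzO : z₀ =O[atTop] fun r : ℝ => r ^ (-(2 * a) + m) := by
      refine isBigO_rpow_mul (IsBigO.sub ?_ ?_)
      · have := rpow_isBigO_rpow (s := -(m - 1)) (t := -m) (by linarith)
        simp only [neg_neg] at this
        exact hyO.trans this
      · have h1 : SyO 0 (1 + -m) (fun r => r⁻¹ * u r) := (syO_inv 0).mul (by
          change u =O[atTop] fun r : ℝ => r ^ (-(-m)); simpa using huO)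
        have h2 := ((h1.mono (by linarith : -m ≤ 1 + -m)).const_mul (2 * a)).isBigO
        simp only [neg_neg] at h2
        refine h2.congr_left fun r => ?_
        rw [div_eq_mul_inv]; ring
    have hVk : SyO k (σ - ε) V₀ := by
      induction k with
      | zero => exact hV0
      | succ k ih =>
        refine ⟨hV0, z₀, (eventually_gt_atTop R).mono hVd, ?_⟩
        refine SyO.of_firstOrder (c := -2) (H := fun r => f r + (P r - a) * V₀ r)
          ((eventually_gt_atTop R).mono hzd) hzO ?_
        refine (hf.2.2 ε hε k).add ?_
        have h1 : SyO k 0 (fun r => P r - a) :=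
          ((hPs k).mono (by norm_num)).sub (syO_const k a)
        exact (h1.mul ih).mono (by linarith)
    exact hVk.congr hVW
  · have h1 : Tendsto W (𝓝[>] R) (𝓝 (W R)) :=
      (hW.1.continuous.tendsto R).mono_left nhdsWithin_le_nhds
    have h2 : Tendsto (fun r => r * V₀ r) (𝓝[>] R) (𝓝 (R * V₀ R)) := by
      have : ContinuousAt (fun r => r * V₀ r) R := by
        have hc1 : ContinuousAt (fun r : ℝ => r ^ (-(2 * a))) R :=
          Real.continuousAt_rpow_const _ _ (Or.inl (by linarith))
        exact continuousAt_id.mul (hc1.mul huc.continuousAt)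
      exact this.tendsto.mono_left nhdsWithin_le_nhds
    have h3 := tendsto_nhds_unique (h1.congr' (by
      filter_upwards [self_mem_nhdsWithin] with r hr using heq r hr)) h2
    rw [h3]
    change R * (R ^ (-(2 * a)) * u R) = x
    rw [huR]
    have hR0 : 0 < R := by linarith
    have : R * (R ^ (-(2 * a)) * (x * R ^ (2 * a - 1))) =
        x * (R ^ (1 : ℝ) * R ^ (-(2 * a)) * R ^ (2 * a - 1)) := by rw [Real.rpow_one]; ring
    rw [this, ← Real.rpow_add hR0, ← Real.rpow_add hR0,
      show 1 + -(2 * a) + (2 * a - 1) = 0 by ring, Real.rpow_zero, mul_one]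

/-! ### Division of smooth functions by r -/

/-- The average `∫₀¹ t^m f(t r) dt`. -/
def avg (m : ℕ) (f : ℝ → ℝ) (r : ℝ) : ℝ := ∫ t in (0 : ℝ)..1, t ^ m * f (t * r)

/-- The power of `t` in the average absorbs the factor produced by the chain rule, so the family is
stable under differentiation and inherits all regularity of `f`. -/
theorem hasDerivAt_avg (m : ℕ) {f : ℝ → ℝ} (hf : ContDiff ℝ 1 f) (r : ℝ) :
    HasDerivAt (avg m f) (avg (m + 1) (deriv f) r) r := by
  have hdc : Continuous (deriv f) := hf.continuous_deriv le_rfl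
  have hfc := hf.continuous
  obtain ⟨C, hC⟩ := isCompact_Icc.bddAbove_image (f := fun x => |deriv f x|)
    (K := Icc (-(|r| + 1)) (|r| + 1)) (by fun_prop)
  refine (intervalIntegral.hasDerivAt_integral_of_dominated_loc_of_deriv_le
    (F := fun r t => t ^ m * f (t * r)) (F' := fun r t => t ^ (m + 1) * deriv f (t * r))
    (bound := fun _ => C) (Metric.ball_mem_nhds r one_pos) ?_ ?_ ?_ ?_ ?_ ?_).2
  · exact .of_forall fun x => Continuous.aestronglyMeasurable (by fun_prop)
  · exact Continuous.intervalIntegrable (by fun_prop) _ _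
  · exact Continuous.aestronglyMeasurable (by fun_prop)
  · refine .of_forall fun t ht x hx => ?_
    rw [uIoc_of_le zero_le_one] at ht
    rw [Metric.mem_ball, Real.dist_eq] at hx
    have hx' : |x| ≤ |r| + 1 := by
      have := abs_sub_abs_le_abs_sub x r; linarith
    have htx : |t * x| ≤ |r| + 1 := by
      rw [abs_mul, abs_of_pos ht.1]
      nlinarith [abs_nonneg x, ht.2]
    have h1 : |deriv f (t * x)| ≤ C := hC ⟨t * x, abs_le.1 htx, rfl⟩
    rw [Real.norm_eq_abs, abs_mul, abs_of_nonneg (pow_nonneg ht.1.le _)]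
    have h2 : t ^ (m + 1) ≤ 1 := pow_le_one₀ ht.1.le ht.2
    nlinarith [abs_nonneg (deriv f (t * x)), pow_nonneg ht.1.le (m + 1)]
  · exact intervalIntegrable_const
  · refine .of_forall fun t _ x _ => ?_
    have h1 : HasDerivAt (fun x => t * x) t x := by simpa using (hasDerivAt_id x).const_mul t
    have h2 := ((hf.differentiable one_ne_zero (t * x)).hasDerivAt.comp x h1).const_mul (t ^ m)
    refine h2.congr_deriv ?_
    ring

theorem continuous_avg (m : ℕ) {f : ℝ → ℝ} (hf : Continuous f) : Continuous (avg m f) := by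
  unfold avg
  exact intervalIntegral.continuous_parametric_intervalIntegral_of_continuous'
    (f := fun r t => t ^ m * f (t * r)) (by fun_prop) 0 1

theorem contDiff_avg_nat (k : ℕ) : ∀ (m : ℕ) {f : ℝ → ℝ}, ContDiff ℝ k f →
    ContDiff ℝ k (avg m f) := by
  induction k with
  | zero =>
    intro m f hf
    simp only [CharP.cast_eq_zero, contDiff_zero] at hf ⊢
    exact continuous_avg m hf
  | succ k ih =>
    intro m f hf
    push_cast at hf ⊢
    have h1 : ContDiff ℝ 1 f := hf.of_le (by simp)
    have hd : deriv (avg m f) = avg (m + 1) (deriv f) :=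
      funext fun r => (hasDerivAt_avg m h1 r).deriv
    rw [contDiff_succ_iff_deriv]
    refine ⟨fun r => (hasDerivAt_avg m h1 r).differentiableAt, by simp, ?_⟩
    rw [hd]
    exact ih _ (contDiff_succ_iff_deriv.1 hf).2.2

theorem contDiff_avg (m : ℕ) {f : ℝ → ℝ} (hf : ContDiff ℝ ∞ f) : ContDiff ℝ ∞ (avg m f) :=
  contDiff_infty.2 fun k => contDiff_avg_nat k m (contDiff_infty.1 hf k)

theorem mul_avg_zero_deriv {W : ℝ → ℝ} (hW : ContDiff ℝ 1 W) (h0 : W 0 = 0) (r : ℝ) :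
    r * avg 0 (deriv W) r = W r := by
  have h := intervalIntegral.mul_integral_comp_mul_right (a := 0) (b := 1) (f := deriv W) r
  simp only [zero_mul, one_mul] at h
  rw [avg]
  simp only [pow_zero, one_mul]
  rw [h, intervalIntegral.integral_deriv_eq_sub (fun x _ => hW.differentiable one_ne_zero x)
    ((hW.continuous_deriv le_rfl).intervalIntegrable _ _), h0, sub_zero]

/-- An odd solution `W` gives a smooth even `V` with `W = r V`. -/
theorem exists_eq_id_mul {W : ℝ → ℝ} (hW : ContDiff ℝ ∞ W) (ho : Function.Odd W) :
    ∃ V : ℝ → ℝ, ContDiff ℝ ∞ V ∧ Function.Even V ∧ ∀ r, W r = r * V r := by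
  have h0 : W 0 = 0 := by have := ho 0; simp at this; linarith
  refine ⟨avg 0 (deriv W), contDiff_avg 0 (contDiff_infty_iff_deriv.1 hW).2, fun r => ?_,
    fun r => (mul_avg_zero_deriv (hW.of_le (by simp)) h0 r).symm⟩
  have hd : ∀ x, deriv W (-x) = deriv W x := by
    intro x
    have h1 : W = fun x => -W (-x) := funext fun x => by rw [ho x, neg_neg]
    conv_rhs => rw [h1]
    rw [deriv.fun_neg, deriv_comp_neg]
    simp
  unfold avg
  congr 1; ext t; rw [mul_neg, hd]

/-- The equation for `W = r V` in terms of `V`. -/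
theorem SolvesW.eqn {q f W V : ℝ → ℝ} (hW : SolvesW q (fun r => r * f r) W)
    (hV : ContDiff ℝ ∞ V) (h : ∀ r, W r = r * V r) {r : ℝ} (hr : 0 < r) :
    -lapR V r + 1 / 2 * (r * deriv V r) + (q r + 1 / 2) * V r = f r := by
  have hVd := hV.differentiable (by simp)
  have hVdd := (contDiff_infty_iff_deriv.1 hV).2.differentiable (by simp)
  have h1 : deriv W = fun r => V r + r * deriv V r := by
    have : W = fun r => r * V r := funext h
    rw [this]
    ext x
    refine (((hasDerivAt_id x).mul (hVd x).hasDerivAt).congr_deriv ?_).deriv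
    simp
  have h2 := hW.2 r
  rw [h1] at h2
  have h3 : HasDerivAt (fun r => V r + r * deriv V r)
      (deriv V r + (deriv V r + r * deriv (deriv V) r)) r :=
    ((hVd r).hasDerivAt.add ((hasDerivAt_id r).mul (hVdd r).hasDerivAt)).congr_deriv (by simp)
  have h4 := h2.unique h3
  simp only [h] at h4
  rw [lapR, iteratedDeriv_succ, iteratedDeriv_one]
  have h5 : r * (-(deriv (deriv V) r + 2 / r * deriv V r) + 1 / 2 * (r * deriv V r)
      + (q r + 1 / 2) * V r) = r * f r := by
    field_simp
    linarith
  exact mul_left_cancel₀ hr.ne' h5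

/-! ### The profile: even extension, scaling generator -/

/-- A self-similar profile which is smooth, even and positive on `ℝ`. -/
structure EvenProfile (p : ℝ) (Φ : ℝ → ℝ) : Prop where
  hp : 5 < p
  even : Function.Even Φ
  pos : ∀ r, 0 < Φ r
  sy : Sy (2 / (p - 1)) Φ
  lower : ∃ κ > 0, ∀ᶠ r in atTop, κ * r ^ (-(2 / (p - 1))) ≤ Φ r
  eqn : ∀ r : ℝ, 0 < r → lapR Φ r - 1 / 2 * lamR p Φ r + (Φ r) ^ p = 0

theorem rhoR_pos (r : ℝ) : 0 < rhoR r := Real.exp_pos _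

theorem contDiff_rhoR : ContDiff ℝ ∞ rhoR := by unfold rhoR; fun_prop

theorem hasDerivAt_rhoR (r : ℝ) : HasDerivAt rhoR (-(r / 2) * rhoR r) r := by
  unfold rhoR
  have := (((hasDerivAt_pow 2 r).neg).div_const 4).exp
  refine this.congr_deriv ?_
  simp only [Pi.neg_apply]
  push_cast
  ring

theorem eventuallyEq_abs_of_pos {r : ℝ} (hr : 0 < r) (Φ : ℝ → ℝ) :
    (fun x => Φ |x|) =ᶠ[𝓝 r] Φ := by
  filter_upwards [eventually_gt_nhds hr] with x hx
  rw [abs_of_pos hx]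

theorem lapR_eq (f : ℝ → ℝ) (r : ℝ) : lapR f r = deriv (deriv f) r + 2 / r * deriv f r := by
  rw [lapR, iteratedDeriv_succ, iteratedDeriv_one]

theorem lapR_congr {f g : ℝ → ℝ} {r : ℝ} (h : f =ᶠ[𝓝 r] g) : lapR f r = lapR g r := by
  rw [lapR_eq, lapR_eq, h.deriv_eq, h.deriv.deriv_eq]

theorem lamR_congr (p : ℝ) {f g : ℝ → ℝ} {r : ℝ} (h : f =ᶠ[𝓝 r] g) :
    lamR p f r = lamR p g r := by
  unfold lamR; rw [h.deriv_eq, h.eq_of_nhds]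

/-- The first integral of the profile equation. -/
theorem IsProfile.deriv_eq_avg {p : ℝ} (hp : 5 < p) {Φ : ℝ → ℝ} (h : IsProfile p Φ) {r : ℝ}
    (hr : 0 < r) : HasDerivAt (fun x => Φ |x|) (r * ((rhoR r)⁻¹ *
      avg 2 (fun s => rhoR s * (1 / (p - 1) * Φ |s| - (Φ |s|) ^ p)) r)) r := by
  have hsm : ContDiffOn ℝ ∞ Φ (Ioi 0) := h.smooth.mono Ioi_subset_Ici_self
  have hat : ∀ x, 0 < x → ContDiffAt ℝ ∞ Φ x := fun x hx => hsm.contDiffAt (Ioi_mem_nhds hx)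
  have hd1 : ∀ x, 0 < x → HasDerivAt Φ (deriv Φ x) x := fun x hx =>
    ((hat x hx).differentiableAt (by simp)).hasDerivAt
  have hd2 : ∀ x, 0 < x → HasDerivAt (deriv Φ) (deriv (deriv Φ) x) x := fun x hx => by
    have h1 := contDiffOn_infty_iff_deriv_of_isOpen isOpen_Ioi |>.1 hsm
    exact ((h1.2.contDiffAt (Ioi_mem_nhds hx)).differentiableAt (by simp)).hasDerivAt
  set h₀ : ℝ → ℝ := fun s => rhoR s * (1 / (p - 1) * Φ |s| - (Φ |s|) ^ p) with hh₀
  have hΦc : Continuous fun x => Φ |x| :=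
    h.smooth.continuousOn.comp_continuous continuous_abs fun x => abs_nonneg x
  have hc0 : Continuous h₀ := by
    have h1 : Continuous fun x => (Φ |x|) ^ p :=
      Continuous.rpow_const hΦc fun x => Or.inr (by linarith)
    exact contDiff_rhoR.continuous.mul ((continuous_const.mul hΦc).sub h1)
  -- The profile equation in divergence form is (r²ρΦ')' = r²ρ(Φ/(p-1) - Φ^p). The one-sided
  -- derivative makes `Q` continuous up to 0, where it vanishes.
  set Q : ℝ → ℝ := fun x => x ^ 2 * rhoR x * derivWithin Φ (Ici 0) x with hQ
  have hQd : ∀ x, 0 < x → HasDerivAt Q (x ^ 2 * h₀ x) x := by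
    intro x hx
    have e1 : Q =ᶠ[𝓝 x] fun x => x ^ 2 * rhoR x * deriv Φ x := by
      filter_upwards [eventually_gt_nhds hx] with y hy
      rw [hQ]; simp only; rw [derivWithin_of_mem_nhds (Ici_mem_nhds hy)]
    refine HasDerivAt.congr_of_eventuallyEq ?_ e1
    refine (((hasDerivAt_pow 2 x).mul (hasDerivAt_rhoR x)).mul (hd2 x hx)).congr_deriv ?_
    have h3 := h.eqn x hx
    rw [lapR_eq, lamR] at h3
    have h4 : 1 / (p - 1) * Φ x - Φ x ^ p =
        deriv (deriv Φ) x + 2 / x * deriv Φ x - 1 / 2 * (x * deriv Φ x) := by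
      have : (1 : ℝ) / 2 * (2 / (p - 1) * Φ x) = 1 / (p - 1) * Φ x := by ring
      linarith
    simp only [hh₀, abs_of_pos hx, h4, Pi.mul_apply]
    field_simp
    push_cast
    ring
  have hQc : ContinuousOn Q (Ici 0) := by
    have h1 : ContinuousOn (derivWithin Φ (Ici 0)) (Ici 0) :=
      h.smooth.continuousOn_derivWithin (uniqueDiffOn_Ici 0) (by simp)
    have h2 := contDiff_rhoR.continuous
    fun_prop
  have hint : ∫ s in (0 : ℝ)..r, s ^ 2 * h₀ s = Q r := by
    rw [intervalIntegral.integral_eq_sub_of_hasDerivAt_of_le hr.le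
      (hQc.mono Icc_subset_Ici_self) (fun x hx => hQd x hx.1)
      (Continuous.intervalIntegrable (by fun_prop) _ _)]
    simp [hQ]
  have hav : r ^ 3 * avg 2 h₀ r = Q r := by
    rw [← hint]
    have h1 := intervalIntegral.mul_integral_comp_mul_right (a := 0) (b := 1)
      (f := fun s => s ^ 2 * h₀ s) r
    simp only [zero_mul, one_mul] at h1
    rw [← h1, avg]
    have : ∀ t, (t * r) ^ 2 * h₀ (t * r) = r ^ 2 * (t ^ 2 * h₀ (t * r)) := fun t => by ring
    simp only [this, intervalIntegral.integral_const_mul]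
    ring
  refine ((hd1 r hr).congr_of_eventuallyEq (eventuallyEq_abs_of_pos hr Φ)).congr_deriv ?_
  have h5 : Q r = r ^ 2 * rhoR r * deriv Φ r := by
    rw [hQ]; simp only; rw [derivWithin_of_mem_nhds (Ici_mem_nhds hr)]
  rw [h5] at hav
  have h6 := (rhoR_pos r).ne'
  field_simp
  have : r ^ 2 * (r * avg 2 h₀ r) = r ^ 2 * (rhoR r * deriv Φ r) := by linarith
  have := mul_left_cancel₀ (by positivity) this
  linarith

theorem even_avg (m : ℕ) {f : ℝ → ℝ} (hf : Function.Even f) : Function.Even (avg m f) := by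
  intro r
  unfold avg
  congr 1; ext t; rw [mul_neg, hf]

/-- The even extension of a profile. -/
theorem IsProfile.evenProfile {p : ℝ} (hp : 5 < p) {Φ : ℝ → ℝ} (h : IsProfile p Φ) :
    EvenProfile p (fun r => Φ |r|) := by
  have hα : 0 < 2 / (p - 1) := by have : 0 < p - 1 := by linarith
                                  positivity
  obtain ⟨κ, hκ, hlow⟩ := h.lower
  have hpos : ∀ r, 0 < Φ |r| := fun r =>
    lt_of_lt_of_le (mul_pos hκ (Real.rpow_pos_of_pos (jap_pos _) _)) (hlow |r| (abs_nonneg r))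
  have heven : Function.Even fun r => Φ |r| := fun r => by simp
  set h₀ : ℝ → ℝ := fun s => rhoR s * (1 / (p - 1) * Φ |s| - (Φ |s|) ^ p) with hh₀
  set ψ : ℝ → ℝ := fun r => r * ((rhoR r)⁻¹ * avg 2 h₀ r) with hψ
  have hΦc : Continuous fun x => Φ |x| :=
    h.smooth.continuousOn.comp_continuous continuous_abs fun x => abs_nonneg x
  have hreg : ∀ k : ℕ, ContDiff ℝ k (fun x => Φ |x|) → ContDiff ℝ k ψ := by
    intro k hk
    have hρ : ContDiff ℝ k rhoR := contDiff_rhoR.of_le (by exact_mod_cast le_top)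
    have h1 : ContDiff ℝ k fun x => (Φ |x|) ^ p := hk.rpow_const_of_ne fun x => (hpos x).ne'
    have h2 : ContDiff ℝ k h₀ := hρ.mul ((contDiff_const.mul hk).sub h1)
    exact contDiff_id.mul ((hρ.inv fun x => (rhoR_pos x).ne').mul (contDiff_avg_nat k 2 h2))
  have hρe : ∀ r, rhoR (-r) = rhoR r := fun r => by simp [rhoR]
  have hh₀e : Function.Even h₀ := fun r => by simp [hh₀, hρe]
  have hd : ∀ r, r ≠ 0 → HasDerivAt (fun x => Φ |x|) (ψ r) r := by
    intro r hr
    rcases lt_or_gt_of_ne hr with hr | hr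
    · have h1 := (h.deriv_eq_avg hp (neg_pos.2 hr)).scomp r (hasDerivAt_neg r)
      have e : ((fun x => Φ |x|) ∘ fun x : ℝ => -x) = fun x => Φ |x| := by ext x; simp
      have h2 : HasDerivAt (fun x => Φ |x|) _ r := e ▸ h1
      refine h2.congr_deriv ?_
      simp only [hψ, hρe, smul_eq_mul]
      have := even_avg 2 hh₀e r
      simp only [hh₀] at this
      simp only [hh₀, this]
      ring
    · exact h.deriv_eq_avg hp hr
  have hd' : ∀ r, HasDerivAt (fun x => Φ |x|) (ψ r) r := by
    intro r
    rcases eq_or_ne r 0 with rfl | hr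
    -- At the origin, differentiability follows from the continuity of the candidate derivative `ψ`.
    · exact hasDerivAt_of_hasDerivAt_of_ne (fun y hy => hd y hy) hΦc.continuousAt
        (((hreg 0 (by simpa using hΦc)).continuous).continuousAt)
    · exact hd r hr
  have hsm : ContDiff ℝ ∞ fun x => Φ |x| := by
    -- Bootstrap: the derivative `ψ` is an average of a smooth function of the positive extension,
    -- hence as regular as the extension itself.
    refine contDiff_infty.2 fun k => ?_
    induction k with
    | zero => simpa using hΦc
    | succ k ih =>
      push_cast
      rw [contDiff_succ_iff_deriv]
      refine ⟨fun r => (hd' r).differentiableAt, by simp, ?_⟩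
      rw [show deriv (fun x => Φ |x|) = ψ from funext fun r => (hd' r).deriv]
      exact hreg k ih
  refine ⟨hp, heven, hpos, ⟨hsm, syO_of_iteratedDeriv hsm fun l => ?_⟩, ?_, fun r hr => ?_⟩
  · obtain ⟨C, hC⟩ := h.decay l
    refine IsBigO.trans (IsBigO.of_bound C ?_) (isBigO_jap_rpow _)
    filter_upwards [eventually_gt_atTop 0] with r hr
    rw [Real.norm_eq_abs, Real.norm_of_nonneg (Real.rpow_nonneg (jap_pos r).le _)]
    have e1 : iteratedDerivWithin l Φ (Ici 0) r = iteratedDeriv l (fun x => Φ |x|) r := by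
      rw [← iteratedDerivWithin_eq_iteratedDeriv (s := Ici (0 : ℝ)) (uniqueDiffOn_Ici 0)
        ((hsm.of_le (by exact_mod_cast le_top)).contDiffAt) hr.le]
      refine iteratedDerivWithin_congr (fun x hx => ?_) hr.le
      simp [abs_of_nonneg (mem_Ici.1 hx)]
    rw [← e1]
    exact hC r hr.le
  · refine ⟨κ * 2 ^ (-(2 / (p - 1))), by positivity, ?_⟩
    filter_upwards [eventually_ge_atTop 1] with r hr
    have hr0 : 0 < r := by linarith
    rw [abs_of_pos hr0, mul_assoc, ← Real.mul_rpow (by norm_num) hr0.le]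
    refine le_trans ?_ (hlow r hr0.le)
    gcongr κ * ?_
    exact Real.rpow_le_rpow_of_nonpos (jap_pos r) (jap_le_two_mul hr) (by linarith)
  · have e := eventuallyEq_abs_of_pos hr Φ
    rw [lapR_congr e, lamR_congr p e]
    simpa [abs_of_pos hr] using h.eqn r hr

namespace EvenProfile
variable {p : ℝ} {Φ : ℝ → ℝ}

theorem alpha_pos (h : EvenProfile p Φ) : 0 < 2 / (p - 1) := by
  have := h.hp
  have : 0 < p - 1 := by linarith
  positivity

theorem alpha_mul (h : EvenProfile p Φ) : 2 / (p - 1) * (p - 1) = 2 := by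
  have := h.hp
  have : p - 1 ≠ 0 := by linarith
  field_simp

/-- Every real exponent is allowed, in particular -1 and p - m, because Φ is positive and bounded
below by a multiple of r^{-α} at infinity. -/
theorem sy_rpow (h : EvenProfile p Φ) (q : ℝ) : Sy (q * (2 / (p - 1))) (fun r => Φ r ^ q) :=
  ⟨h.sy.1.rpow_const_of_ne fun r => (h.pos r).ne', fun k => (h.sy.2 k).rpow q h.lower⟩

theorem even_rpow (h : EvenProfile p Φ) (q : ℝ) : Function.Even (fun r => Φ r ^ q) := fun r => by
  simp only [h.even r]

theorem sy_potential (h : EvenProfile p Φ) : Sy 2 (fun r => p * Φ r ^ (p - 1)) := by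
  have := (h.sy_rpow (p - 1)).const_mul p
  rwa [mul_comm, h.alpha_mul] at this

theorem sy_lam (h : EvenProfile p Φ) : Sy (2 / (p - 1)) (lamR p Φ) :=
  (h.sy.const_mul _).add h.sy.id_mul_deriv

theorem even_lam (h : EvenProfile p Φ) : Function.Even (lamR p Φ) :=
  Function.Even.add (fun r => by simp only [h.even r]) (even_id_mul_deriv h.even)

theorem lam_zero_ne (h : EvenProfile p Φ) : lamR p Φ 0 ≠ 0 := by
  simp only [lamR, zero_mul, add_zero]
  exact (mul_pos h.alpha_pos (h.pos 0)).ne'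

/-- `Λ_r Φ` is an eigenfunction with eigenvalue `-1`. -/
theorem linR_lam (h : EvenProfile p Φ) {r : ℝ} (hr : 0 < r) : linR p Φ (lamR p Φ) r = -lamR p Φ r := by
  have d0 : ∀ x, HasDerivAt Φ (deriv Φ x) x := fun x => (h.sy.differentiable x).hasDerivAt
  have d1 : ∀ x, HasDerivAt (deriv Φ) (deriv (deriv Φ) x) x := fun x =>
    (h.sy.deriv.differentiable x).hasDerivAt
  have d2 : ∀ x, HasDerivAt (deriv (deriv Φ)) (deriv (deriv (deriv Φ)) x) x := fun x =>
    (h.sy.deriv.deriv.differentiable x).hasDerivAt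
  set α := 2 / (p - 1) with hα
  have g1 : deriv (lamR p Φ) = fun x => α * deriv Φ x + (deriv Φ x + x * deriv (deriv Φ) x) := by
    ext x
    refine ((((d0 x).const_mul α).add ((hasDerivAt_id x).mul (d1 x))).congr_deriv ?_).deriv
    simp
  have g2 : deriv (deriv (lamR p Φ)) r = α * deriv (deriv Φ) r +
      (deriv (deriv Φ) r + (deriv (deriv Φ) r + r * deriv (deriv (deriv Φ)) r)) := by
    rw [g1]
    refine ((((d1 r).const_mul α).add ((d1 r).add ((hasDerivAt_id r).mul (d2 r)))).congr_deriv
      ?_).deriv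
    simp
  have e0 := h.eqn r hr
  -- The r-derivative of the profile equation; together with the equation itself it gives the
  -- generator of scalings applied to the equation.
  have e1 : deriv (deriv (deriv Φ)) r + (2 / r * deriv (deriv Φ) r - 2 / r ^ 2 * deriv Φ r)
      - 1 / 2 * (α * deriv Φ r + (deriv Φ r + r * deriv (deriv Φ) r))
      + p * Φ r ^ (p - 1) * deriv Φ r = 0 := by
    have hz : (fun x => deriv (deriv Φ) x + 2 / x * deriv Φ x
        - 1 / 2 * (α * Φ x + x * deriv Φ x) + Φ x ^ p) =ᶠ[𝓝 r] fun _ => 0 := by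
      filter_upwards [eventually_gt_nhds hr] with x hx
      have := h.eqn x hx
      rwa [lapR_eq, lamR] at this
    have hz' := hz.hasDerivAt_iff.2 (hasDerivAt_const r (0 : ℝ))
    have h2r : HasDerivAt (fun x : ℝ => 2 / x) (-2 / r ^ 2) r :=
      ((hasDerivAt_const r (2 : ℝ)).div (hasDerivAt_id r) hr.ne').congr_deriv (by simp)
    have hz2 := (((d2 r).add (h2r.mul (d1 r))).sub ((((d0 r).const_mul α).add
      ((hasDerivAt_id r).mul (d1 r))).const_mul (1 / 2))).add
      ((d0 r).rpow_const (p := p) (Or.inl (h.pos r).ne'))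
    have := hz'.unique hz2
    simp only [id] at this
    rw [this]; ring
  rw [lapR_eq, lamR] at e0
  rw [linR, lapR_eq, g2, lamR, g1, lamR]
  have hpow : Φ r ^ p = Φ r ^ (p - 1) * Φ r := by
    rw [← Real.rpow_add_one (h.pos r).ne']; ring_nf
  rw [hpow] at e0
  -- Scaling invariance: Φ^p scales like ΔΦ, with two more powers than Φ, while the non-invariant
  -- term Λ_rΦ/2 produces the eigenvalue -1.
  have hpα : p * α = α + 2 := by have := h.alpha_mul; linarith
  have e1' : r * deriv (deriv (deriv Φ)) r = -2 * deriv (deriv Φ) r + 2 / r * deriv Φ r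
      + r * (1 / 2 * (α * deriv Φ r + (deriv Φ r + r * deriv (deriv Φ) r)))
      - r * (p * Φ r ^ (p - 1) * deriv Φ r) := by
    have : r * deriv (deriv (deriv Φ)) r = r * (deriv (deriv (deriv Φ)) r) - r * 0 := by ring
    rw [this, ← e1]; field_simp; ring
  rw [← hα] at e0 ⊢
  linear_combination -e1' - (α + 2) * e0 - Φ r ^ (p - 1) * Φ r * hpα
    - 2 * deriv (deriv Φ) r * mul_inv_cancel₀ hr.ne'

end EvenProfile

/-! ### The Gaussian scalar product on the half line -/

/-- For r ≥ 8 the Gaussian is at most e^{-2r}; one factor e^{-r} absorbs the power of r and the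
other is the bound. -/
theorem wexp_isBigO_exp (N : ℝ) : wexp N =O[atTop] fun r : ℝ => Real.exp (-1 * r) := by
  have h1 : (fun r : ℝ => Real.exp (-1 * r)) =O[atTop] fun r : ℝ => r ^ (-N) :=
    (isLittleO_exp_neg_mul_rpow_atTop one_pos (-N)).isBigO
  have h2 : wexp N =O[atTop] fun r : ℝ => r ^ N * (Real.exp (-1 * r) * Real.exp (-1 * r)) := by
    refine IsBigO.of_bound 1 ?_
    filter_upwards [eventually_ge_atTop 8] with r hr
    have hr0 : 0 < r := by linarith
    rw [Real.norm_of_nonneg (wexp_pos hr0).le, Real.norm_of_nonneg (by positivity), one_mul, wexp,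
      mul_comm, ← Real.exp_add]
    gcongr
    nlinarith
  refine h2.trans ?_
  refine (((isBigO_refl (fun r : ℝ => r ^ N) atTop).mul (h1.mul (isBigO_refl _ _)))).trans ?_
  refine IsBigO.of_bound 1 ?_
  filter_upwards [eventually_gt_atTop 0] with r hr
  rw [← mul_assoc, ← Real.rpow_add hr, add_neg_cancel, Real.rpow_zero, one_mul, one_mul]

theorem isBigO_mul_rhoR {F : ℝ → ℝ} {N : ℝ} (h : F =O[atTop] fun r : ℝ => r ^ N) :
    (fun r => F r * rhoR r) =O[atTop] wexp N :=
  (h.mul (isBigO_refl rhoR atTop)).congr_right fun r => by simp [wexp, rhoR, mul_comm]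

theorem integrableOn_mul_rhoR {F : ℝ → ℝ} {N : ℝ} (hF : Continuous F)
    (h : F =O[atTop] fun r : ℝ => r ^ N) : IntegrableOn (fun r => F r * rhoR r) (Ioi 0) :=
  integrable_of_isBigO_exp_neg one_pos (hF.mul contDiff_rhoR.continuous).continuousOn
    ((isBigO_mul_rhoR h).trans (wexp_isBigO_exp N))

theorem tendsto_mul_rhoR {F : ℝ → ℝ} {N : ℝ} (h : F =O[atTop] fun r : ℝ => r ^ N) :
    Tendsto (fun r => F r * rhoR r) atTop (𝓝 0) :=
  (isBigO_mul_rhoR h).trans_tendsto (tendsto_wexp N)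

theorem integrableOn_inner {s t : ℝ} {f g : ℝ → ℝ} (hf : Sy s f) (hg : Sy t g) :
    IntegrableOn (fun r => f r * g r * rhoR r * r ^ 2) (Ioi 0) := by
  have h1 : SyO 0 (s + t + (-1 + -1)) (fun r => f r * g r * (r * r)) :=
    ((hf.2 0).mul (hg.2 0)).mul ((syO_id 0).mul (syO_id 0))
  refine (integrableOn_mul_rhoR ?_ h1.isBigO).congr_fun (fun r _ => ?_) measurableSet_Ioi
  · have := hf.1.continuous
    have := hg.1.continuous
    fun_prop
  · ring

theorem innerR_add {s s' t : ℝ} {f f' g : ℝ → ℝ} (hf : Sy s f) (hf' : Sy s' f') (hg : Sy t g) :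
    innerR (fun r => f r + f' r) g = innerR f g + innerR f' g := by
  unfold innerR
  rw [← integral_add (integrableOn_inner hf hg) (integrableOn_inner hf' hg)]
  congr 1; ext r; ring

theorem innerR_const_mul (c : ℝ) (f g : ℝ → ℝ) :
    innerR (fun r => c * f r) g = c * innerR f g := by
  unfold innerR
  rw [← integral_const_mul]
  congr 1; ext r; ring

theorem innerR_congr {f f' g g' : ℝ → ℝ} (h : ∀ r, 0 < r → f r = f' r)
    (h' : ∀ r, 0 < r → g r = g' r) : innerR f g = innerR f' g' := by
  unfold innerR
  refine setIntegral_congr_fun measurableSet_Ioi fun r hr => ?_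
  simp only [h r hr, h' r hr]

namespace EvenProfile
variable {p : ℝ} {Φ : ℝ → ℝ}

theorem inner_lam_pos (h : EvenProfile p Φ) : 0 < innerR (lamR p Φ) (lamR p Φ) := by
  unfold innerR
  rw [setIntegral_pos_iff_support_of_nonneg_ae]
  · have hc : Continuous fun r => lamR p Φ r * lamR p Φ r := by
      have := h.sy_lam.1.continuous; fun_prop
    have h0 : (0 : ℝ) < lamR p Φ 0 * lamR p Φ 0 := mul_self_pos.2 h.lam_zero_ne
    have h1 := (hc.tendsto 0).eventually (lt_mem_nhds h0)
    obtain ⟨δ, hδ, hb⟩ := Metric.eventually_nhds_iff_ball.1 h1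
    refine lt_of_lt_of_le (b := volume (Ioo (0 : ℝ) δ)) (by simp [hδ]) (measure_mono fun x hx => ?_)
    refine ⟨?_, hx.1⟩
    have := hb x (by simp [abs_of_pos hx.1, hx.2])
    have h2 := rhoR_pos x
    have h3 := hx.1
    exact (by positivity : 0 < lamR p Φ x * lamR p Φ x * rhoR x * x ^ 2).ne'
  · refine .of_forall fun r => ?_
    have h2 := rhoR_pos r
    have := mul_self_nonneg (lamR p Φ r)
    simp only [Pi.zero_apply]
    positivity
  · exact integrableOn_inner h.sy_lam h.sy_lam

theorem contDiff_pot (h : EvenProfile p Φ) (a : ℝ) :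
    ContDiff ℝ ∞ (fun r => a - 1 / 2 - p * Φ r ^ (p - 1)) := contDiff_const.sub h.sy_potential.1

theorem even_pot (h : EvenProfile p Φ) (a : ℝ) :
    Function.Even (fun r => a - 1 / 2 - p * Φ r ^ (p - 1)) := fun r => by simp only [h.even r]

/-! ### Solvability of L_r + j in symbol classes -/

/-- Green's formula against `Λ_r Φ`. -/
theorem green (h : EvenProfile p Φ) {j σ τ : ℝ} {W f : ℝ → ℝ}
    (hW : SolvesW (fun r => 2 / (p - 1) / 2 + j - 1 / 2 - p * Φ r ^ (p - 1))
      (fun r => r * f r) W) (hWs : SyO 1 σ (fun r => W r / r)) (hf : Sy τ f) :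
    (1 - j) * (∫ r in Ioi (0 : ℝ), W r * (r * lamR p Φ r) * rhoR r)
      + innerR f (lamR p Φ) = -(W 0 * lamR p Φ 0) := by
  set g := lamR p Φ with hg
  have hgs := h.sy_lam
  rw [← hg] at hgs
  have hW1 : SyO 1 (-1 + σ) W := by
    refine ((syO_id 1).mul hWs).congr ?_
    filter_upwards [eventually_gt_atTop 0] with r hr
    field_simp
  have hW0 : SyO 0 (-1 + σ) W := hW1.of_succ
  have hWd : SyO 0 (-1 + σ + 1) (deriv W) := hW1.deriv
  set γ : ℝ → ℝ := fun r => r * g r with hγ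
  have hγs : Sy (-1 + 2 / (p - 1)) γ :=
    ⟨contDiff_id.mul hgs.1, fun k => (syO_id k).mul (hgs.2 k)⟩
  have hγd : ∀ r, deriv γ r = g r + r * deriv g r := fun r =>
    (((hasDerivAt_id r).mul (hgs.differentiable r).hasDerivAt).congr_deriv (by simp)).deriv
  have hγdd : ∀ r, 0 < r → HasDerivAt (deriv γ)
      (r / 2 * deriv γ r + (2 / (p - 1) / 2 + 1 - 1 / 2 - p * Φ r ^ (p - 1)) * γ r) r := by
    intro r hr
    have e1 : deriv γ = fun r => g r + r * deriv g r := funext hγd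
    rw [e1]
    refine (((hgs.differentiable r).hasDerivAt.add ((hasDerivAt_id r).mul
      (hgs.deriv.differentiable r).hasDerivAt))).congr_deriv ?_
    have := h.linR_lam hr
    rw [← hg, linR, lapR_eq, lamR] at this
    simp only [id, hγ]
    linear_combination (-r) * this - 2 * deriv g r * mul_inv_cancel₀ hr.ne'
  -- The Wronskian of `W` with γ = rΛ_rΦ, which solves the homogeneous equation for j = 1.
  -- Multiplied by the integrating factor ρ, its derivative contains only the gap 1 - j and the
  -- source; at 0 it equals W(0)Λ_rΦ(0).
  set F : ℝ → ℝ := fun r => W r * deriv γ r - deriv W r * γ r with hF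
  have hWc := hW.1.continuous
  have hWdc := (contDiff_infty_iff_deriv.1 hW.1).2.continuous
  have hγc := hγs.1.continuous
  have hγdc := hγs.deriv.1.continuous
  have hFO : F =O[atTop] fun r : ℝ => r ^ (-(-1 + σ + (-1 + 2 / (p - 1) + 1))) :=
    (SyO.sub (hW0.mul (hγs.deriv.2 0)) ((hWd.mul (hγs.2 0)).mono (by linarith))).isBigO
  have h1 : (fun r => W r * (r * g r)) =O[atTop] fun r : ℝ =>
      r ^ (-(-1 + σ + (-1 + 2 / (p - 1)))) :=
    (hW0.mul (hγs.2 0)).isBigO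
  have i1 : IntegrableOn (fun r => W r * (r * g r) * rhoR r) (Ioi 0) :=
    integrableOn_mul_rhoR (hWc.mul hγc) h1
  have i2 := integrableOn_inner hf hgs
  have hd : ∀ r ∈ Ioi (0 : ℝ), HasDerivAt (fun r => F r * rhoR r)
      ((1 - j) * (W r * (r * g r) * rhoR r) + f r * g r * rhoR r * r ^ 2) r := by
    intro r hr
    refine ((((hW.differentiable r).hasDerivAt.mul (hγdd r hr)).sub
      ((hW.2 r).mul (hγs.differentiable r).hasDerivAt)).mul (hasDerivAt_rhoR r)).congr_deriv ?_
    simp only [hγ, Pi.mul_apply, Pi.sub_apply]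
    ring
  have := integral_Ioi_of_hasDerivAt_of_tendsto (a := (0 : ℝ)) (f := fun r => F r * rhoR r)
    (Continuous.continuousWithinAt (by
      have := contDiff_rhoR.continuous
      exact ((hWc.mul hγdc).sub (hWdc.mul hγc)).mul this)) hd
    ((i1.const_mul (1 - j)).add i2) (tendsto_mul_rhoR hFO)
  rw [integral_add (i1.const_mul (1 - j)) i2, integral_const_mul] at this
  change (1 - j) * _ + ∫ r in Ioi (0 : ℝ), f r * g r * rhoR r * r ^ 2 = _
  refine this.trans ?_
  simp only [hF, hγd]
  simp [hγ, rhoR]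

/-- From an odd solution with symbol bounds to the solution of the radial problem. -/
theorem symM_of_solvesW (h : EvenProfile p Φ) {j : ℝ} {W f : ℝ → ℝ} (hf : SymM (2 / (p - 1)) f)
    (hW : SolvesW (fun r => 2 / (p - 1) / 2 + j - 1 / 2 - p * Φ r ^ (p - 1))
      (fun r => r * f r) W) (hWs : ∀ ε > 0, ∀ k, SyO k (2 / (p - 1) - ε) (fun r => W r / r))
    (hW0 : W 0 = 0) :
    ∃ w, SymM (2 / (p - 1)) w ∧ (∀ r, W r = r * w r) ∧
      (∀ r, 0 < r → linR p Φ w r + j * w r = f r) ∧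
      (1 - j) * innerR w (lamR p Φ) + innerR f (lamR p Φ) = 0 := by
  have hodd : Function.Odd W := hW.odd (h.contDiff_pot _).continuous (h.even_pot _)
    (fun r => by simp [hf.2.1 r]) hW0
  obtain ⟨w, hw, hwe, hWw⟩ := exists_eq_id_mul hW.1 hodd
  have hws : SymM (2 / (p - 1)) w := by
    refine ⟨hw, hwe, fun ε hε k => (hWs ε hε k).congr ?_⟩
    filter_upwards [eventually_gt_atTop 0] with r hr
    rw [hWw]; field_simp
  refine ⟨w, hws, hWw, fun r hr => ?_, ?_⟩
  · have := hW.eqn hw hWw hr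
    rw [linR, lamR]
    linarith
  · have := h.green hW (hWs 1 one_pos 1) (hf.sy one_pos)
    rw [hW0, zero_mul, neg_zero] at this
    rw [← this]
    congr 2
    unfold innerR
    refine setIntegral_congr_fun measurableSet_Ioi fun r _ => ?_
    simp only [hWw]
    ring

/-- Solvability away from the eigenvalue `-1`. -/
theorem exists_solution_of_ne_one (h : EvenProfile p Φ) (hspec : NonDegenerate p Φ) {j : ℕ}
    (hj : j ≠ 1) {f : ℝ → ℝ} (hf : SymM (2 / (p - 1)) f) :
    ∃ w, SymM (2 / (p - 1)) w ∧ (∀ r, 0 < r → linR p Φ w r + j * w r = f r) ∧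
      (1 - (j : ℝ)) * innerR w (lamR p Φ) + innerR f (lamR p Φ) = 0 := by
  have ha : 2 / (p - 1) ≤ 2 * (2 / (p - 1) / 2 + (j : ℝ)) := by
    have : (0 : ℝ) ≤ j := Nat.cast_nonneg j
    linarith
  obtain ⟨W, hW, hWs, -⟩ := exists_good_solution h.sy_potential.1 h.sy_potential.2 ha hf 0
  obtain ⟨Y, hY, hYs, R, hR⟩ := exists_good_solution h.sy_potential.1 h.sy_potential.2 ha
    (symM_zero (2 / (p - 1))) 1
  -- Otherwise `Y` is odd and Y/r is a radial eigenfunction for -j, nonzero because `Y R = 1`; this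
  -- is excluded for j ≠ 1.
  have hY0 : Y 0 ≠ 0 := by
    intro hY0
    obtain ⟨w, hw, hYw, hwe, -⟩ := h.symM_of_solvesW (symM_zero _) hY hYs hY0
    refine hj (hspec j ⟨w, ⟨hw.1, hw.2.1⟩, ?_, ?_, fun r hr => ?_⟩)
    · rintro rfl
      have := hYw R
      rw [hR] at this
      simp at this
    · exact (integrableOn_inner (hw.sy one_pos) (hw.sy one_pos)).congr_fun
        (fun r _ => by ring) measurableSet_Ioi
    · have := hwe r hr
      linarith
  set c := W 0 / Y 0 with hc
  have hX : SolvesW (fun r => 2 / (p - 1) / 2 + j - 1 / 2 - p * Φ r ^ (p - 1))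
      (fun r => r * f r) (fun r => W r - c * Y r) := by
    refine ⟨hW.1.sub (contDiff_const.mul hY.1), fun r => ?_⟩
    have e1 : deriv (fun r => W r - c * Y r) = fun r => deriv W r - c * deriv Y r :=
      funext fun r => ((hW.differentiable r).hasDerivAt.sub
        ((hY.differentiable r).hasDerivAt.const_mul c)).deriv
    rw [e1]
    refine ((hW.2 r).sub ((hY.2 r).const_mul c)).congr_deriv ?_
    ring
  obtain ⟨w, hw, -, h1, h2⟩ := h.symM_of_solvesW hf hX (fun ε hε k =>
    ((hWs ε hε k).sub ((hYs ε hε k).const_mul c)).congr (.of_forall fun r => by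
      simp only; ring)) (by rw [hc]; field_simp; ring)
  exact ⟨w, hw, h1, h2⟩

/-- Solvability at the eigenvalue `-1`. -/
theorem exists_solution_one (h : EvenProfile p Φ) {f : ℝ → ℝ} (hf : SymM (2 / (p - 1)) f)
    (hfo : innerR f (lamR p Φ) = 0) :
    ∃ w, SymM (2 / (p - 1)) w ∧ (∀ r, 0 < r → linR p Φ w r + 1 * w r = f r) ∧
      innerR w (lamR p Φ) = 0 := by
  have ha : 2 / (p - 1) ≤ 2 * (2 / (p - 1) / 2 + (1 : ℝ)) := by linarith
  obtain ⟨W, hW, hWs, -⟩ := exists_good_solution h.sy_potential.1 h.sy_potential.2 ha hf 0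
  -- At j = 1 the bulk term of Green's formula vanishes, and orthogonality of the source leaves
  -- W(0)Λ_rΦ(0) = 0.
  have hW0 : W 0 = 0 := by
    have := h.green hW (hWs 1 one_pos 1) (hf.sy one_pos)
    rw [hfo, sub_self, zero_mul, zero_add, zero_eq_neg] at this
    exact (mul_eq_zero.1 this).resolve_right h.lam_zero_ne
  obtain ⟨w, hw, -, h1, -⟩ := h.symM_of_solvesW hf hW hWs hW0
  -- Λ_rΦ lies in the kernel of L_r + 1, so projecting it out does not affect the equation.
  set c := innerR w (lamR p Φ) / innerR (lamR p Φ) (lamR p Φ) with hc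
  have hl : SymM (2 / (p - 1)) (lamR p Φ) := h.sy_lam.symM h.even_lam
  refine ⟨fun r => w r + -c * lamR p Φ r, hw.add (hl.const_mul (-c)), fun r hr => ?_, ?_⟩
  · have hwd := (hw.sy one_pos).differentiable
    have hwdd := (hw.sy one_pos).deriv.differentiable
    have hld := h.sy_lam.differentiable
    have hldd := h.sy_lam.deriv.differentiable
    have e1 : deriv (fun r => w r + -c * lamR p Φ r) =
        fun r => deriv w r + -c * deriv (lamR p Φ) r := funext fun r =>
      ((hwd r).hasDerivAt.add ((hld r).hasDerivAt.const_mul (-c))).deriv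
    have e2 : deriv (deriv (fun r => w r + -c * lamR p Φ r)) r =
        deriv (deriv w) r + -c * deriv (deriv (lamR p Φ)) r := by
      rw [e1]
      exact ((hwdd r).hasDerivAt.add ((hldd r).hasDerivAt.const_mul (-c))).deriv
    have h3 := h1 r hr
    have h4 := h.linR_lam hr
    rw [linR, lapR_eq, lamR] at h3 h4 ⊢
    rw [e2, e1]
    linear_combination h3 - c * h4
  · rw [innerR_add (hw.sy one_pos) (h.sy_lam.const_mul (-c)) h.sy_lam, innerR_const_mul, hc]
    have := h.inner_lam_pos.ne'
    field_simp
    ring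

end EvenProfile

/-! ### Bounds for functions of (b, r, Z), uniform in b -/

/-- The bound `|f(b,r,Z)| ≲ (b^e + |Z|^N) ⟨r⟩^{-s}` for `0 < b < 1`, `r > 0`, `|Z| < 1`. -/
def BdOn (s : ℝ) (e N : ℕ) (f : ℝ → ℝ → ℝ → ℝ) : Prop :=
  ∃ C, 0 ≤ C ∧ ∀ b r Z : ℝ, 0 < b → b < 1 → 0 < r → |Z| < 1 →
    |f b r Z| ≤ C * (b ^ e + |Z| ^ N) * jap r ^ (-s)

/-- Functions of `(b, r, Z)` with `m` derivatives in `(r, Z)` and bounds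
`|∂_r^j ∂_Z^k f| ≲ (b^e + |Z|^{N-k}) ⟨r⟩^{-s-j}`. -/
def Cl : ℕ → ℝ → ℕ → ℕ → (ℝ → ℝ → ℝ → ℝ) → Prop
  | 0, s, e, N, f => BdOn s e N f
  | m + 1, s, e, N, f => BdOn s e N f ∧ ∃ fr fZ : ℝ → ℝ → ℝ → ℝ,
      (∀ b r Z : ℝ, 0 < b → b < 1 → 0 < r → |Z| < 1 →
        HasDerivAt (fun r => f b r Z) (fr b r Z) r ∧ HasDerivAt (fun Z => f b r Z) (fZ b r Z) Z) ∧
      Cl m (s + 1) e N fr ∧ Cl m s e (N - 1) fZ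

theorem jap_rpow_pos (r s : ℝ) : 0 < jap r ^ s := Real.rpow_pos_of_pos (jap_pos r) s

theorem BdOn.mono {s t : ℝ} {e N e' N' : ℕ} {f : ℝ → ℝ → ℝ → ℝ} (h : BdOn s e N f) (hs : t ≤ s)
    (he : e' ≤ e) (hN : N' ≤ N) : BdOn t e' N' f := by
  obtain ⟨C, hC, h⟩ := h
  refine ⟨C, hC, fun b r Z hb hb1 hr hZ => (h b r Z hb hb1 hr hZ).trans ?_⟩
  have h1 : b ^ e ≤ b ^ e' := pow_le_pow_of_le_one hb.le hb1.le he
  have h2 : |Z| ^ N ≤ |Z| ^ N' := pow_le_pow_of_le_one (abs_nonneg Z) hZ.le hN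
  have h3 : jap r ^ (-s) ≤ jap r ^ (-t) :=
    Real.rpow_le_rpow_of_exponent_le (one_le_jap r) (by linarith)
  have := jap_rpow_pos r (-s)
  gcongr

theorem BdOn.add {s : ℝ} {e N : ℕ} {f g : ℝ → ℝ → ℝ → ℝ} (hf : BdOn s e N f) (hg : BdOn s e N g) :
    BdOn s e N (fun b r Z => f b r Z + g b r Z) := by
  obtain ⟨C, hC, h⟩ := hf
  obtain ⟨D, hD, k⟩ := hg
  refine ⟨C + D, by positivity, fun b r Z hb hb1 hr hZ => (abs_add_le _ _).trans ?_⟩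
  have := h b r Z hb hb1 hr hZ
  have := k b r Z hb hb1 hr hZ
  linarith

/-- The first factor is merely bounded in (b, Z): with exponents (0, 0) the weight is 1 + 1, whence
the factor 2. All the smallness is carried by the second factor. -/
theorem BdOn.mul {s t : ℝ} {e N : ℕ} {f g : ℝ → ℝ → ℝ → ℝ} (hf : BdOn s 0 0 f)
    (hg : BdOn t e N g) : BdOn (s + t) e N (fun b r Z => f b r Z * g b r Z) := by
  obtain ⟨C, hC, h⟩ := hf
  obtain ⟨D, hD, k⟩ := hg
  refine ⟨C * 2 * D, by positivity, fun b r Z hb hb1 hr hZ => ?_⟩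
  have h1 := h b r Z hb hb1 hr hZ
  have h2 := k b r Z hb hb1 hr hZ
  rw [abs_mul]
  have e1 : jap r ^ (-(s + t)) = jap r ^ (-s) * jap r ^ (-t) := by
    rw [← Real.rpow_add (jap_pos r)]; ring_nf
  rw [e1]
  calc |f b r Z| * |g b r Z| ≤ _ := mul_le_mul h1 h2 (abs_nonneg _) ((abs_nonneg _).trans h1)
    _ = _ := by simp only [pow_zero]; ring

theorem Cl.bd {m : ℕ} {s : ℝ} {e N : ℕ} {f : ℝ → ℝ → ℝ → ℝ} (h : Cl m s e N f) :
    BdOn s e N f := by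
  cases m with
  | zero => exact h
  | succ m => exact h.1

theorem Cl.of_succ {m : ℕ} : ∀ {s : ℝ} {e N : ℕ} {f : ℝ → ℝ → ℝ → ℝ}, Cl (m + 1) s e N f →
    Cl m s e N f := by
  induction m with
  | zero => intro s e N f h; exact h.1
  | succ m ih =>
    intro s e N f h
    obtain ⟨h0, fr, fZ, hd, h1, h2⟩ := h
    exact ⟨h0, fr, fZ, hd, ih h1, ih h2⟩

theorem Cl.mono {m : ℕ} : ∀ {s t : ℝ} {e N e' N' : ℕ} {f : ℝ → ℝ → ℝ → ℝ}, Cl m s e N f →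
    t ≤ s → e' ≤ e → N' ≤ N → Cl m t e' N' f := by
  induction m with
  | zero => intro s t e N e' N' f h hs he hN; exact BdOn.mono h hs he hN
  | succ m ih =>
    intro s t e N e' N' f h hs he hN
    obtain ⟨h0, fr, fZ, hd, h1, h2⟩ := h
    exact ⟨h0.mono hs he hN, fr, fZ, hd, ih h1 (by linarith) he hN, ih h2 hs he (by omega)⟩

theorem Cl.congr {m : ℕ} {s : ℝ} {e N : ℕ} {f g : ℝ → ℝ → ℝ → ℝ}
    (h : Cl m s e N f) (hfg : ∀ b r Z : ℝ, 0 < b → b < 1 → 0 < r → |Z| < 1 → f b r Z = g b r Z) :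
    Cl m s e N g := by
  have h0 : BdOn s e N g := by
    obtain ⟨C, hC, hb⟩ := h.bd
    refine ⟨C, hC, fun b r Z hb0 hb1 hr hZ => ?_⟩
    rw [← hfg b r Z hb0 hb1 hr hZ]
    exact hb b r Z hb0 hb1 hr hZ
  cases m with
  | zero => exact h0
  | succ m =>
    obtain ⟨-, fr, fZ, hd, h1, h2⟩ := h
    refine ⟨h0, fr, fZ, fun b r Z hb0 hb1 hr hZ => ⟨?_, ?_⟩, h1, h2⟩
    · refine (hd b r Z hb0 hb1 hr hZ).1.congr_of_eventuallyEq ?_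
      filter_upwards [eventually_gt_nhds hr] with x hx
      exact (hfg b x Z hb0 hb1 hx hZ).symm
    · refine (hd b r Z hb0 hb1 hr hZ).2.congr_of_eventuallyEq ?_
      filter_upwards [(continuous_abs.tendsto Z).eventually (gt_mem_nhds hZ)] with x hx
      exact (hfg b r x hb0 hb1 hr hx).symm

theorem Cl.add {m : ℕ} : ∀ {s : ℝ} {e N : ℕ} {f g : ℝ → ℝ → ℝ → ℝ}, Cl m s e N f →
    Cl m s e N g → Cl m s e N (fun b r Z => f b r Z + g b r Z) := by
  induction m with
  | zero => intro s e N f g hf hg; exact BdOn.add hf hg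
  | succ m ih =>
    intro s e N f g hf hg
    obtain ⟨h0, fr, fZ, hd, h1, h2⟩ := hf
    obtain ⟨k0, gr, gZ, kd, k1, k2⟩ := hg
    exact ⟨h0.add k0, _, _, fun b r Z hb hb1 hr hZ =>
      ⟨(hd b r Z hb hb1 hr hZ).1.add (kd b r Z hb hb1 hr hZ).1,
        (hd b r Z hb hb1 hr hZ).2.add (kd b r Z hb hb1 hr hZ).2⟩, ih h1 k1, ih h2 k2⟩

theorem Cl.mul {m : ℕ} : ∀ {s t : ℝ} {e N : ℕ} {f g : ℝ → ℝ → ℝ → ℝ}, Cl m s 0 0 f →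
    Cl m t e N g → Cl m (s + t) e N (fun b r Z => f b r Z * g b r Z) := by
  induction m with
  | zero => intro s t e N f g hf hg; exact BdOn.mul hf hg
  | succ m ih =>
    intro s t e N f g hf hg
    have hf' := hf.of_succ
    have hg' := hg.of_succ
    obtain ⟨h0, fr, fZ, hd, h1, h2⟩ := hf
    obtain ⟨k0, gr, gZ, kd, k1, k2⟩ := hg
    refine ⟨h0.mul k0, _, _, fun b r Z hb hb1 hr hZ =>
      ⟨(hd b r Z hb hb1 hr hZ).1.mul (kd b r Z hb hb1 hr hZ).1,
        (hd b r Z hb hb1 hr hZ).2.mul (kd b r Z hb hb1 hr hZ).2⟩,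
      Cl.add ((ih h1 hg').mono (by linarith) le_rfl le_rfl)
        ((ih hf' k1).mono (by linarith) le_rfl le_rfl),
      Cl.add ((ih h2 hg').mono le_rfl le_rfl (by omega)) (ih hf' k2)⟩

/-- Monomials. -/
theorem cl_mono {m : ℕ} : ∀ {s : ℝ} {e N i k : ℕ} {φ : ℝ → ℝ}, Sy s φ → (e ≤ i ∨ N ≤ k) →
    Cl m s e N (fun b r Z => b ^ i * φ r * Z ^ k) := by
  have key : ∀ {s : ℝ} {e N i k : ℕ} {φ : ℝ → ℝ}, Sy s φ → (e ≤ i ∨ N ≤ k) →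
      BdOn s e N (fun b r Z => b ^ i * φ r * Z ^ k) := by
    intro s e N i k φ hφ h
    obtain ⟨C, hC⟩ := hφ.bound
    have hC0 : 0 ≤ C := nonneg_of_mul_nonneg_left ((abs_nonneg _).trans (hC 0 le_rfl))
      (jap_rpow_pos 0 (-s))
    refine ⟨C, hC0, fun b r Z hb hb1 hr hZ => ?_⟩
    have h1 : b ^ i * |Z| ^ k ≤ b ^ e + |Z| ^ N := by
      have hz := abs_nonneg Z
      have a1 : b ^ i ≤ 1 := pow_le_one₀ hb.le hb1.le
      have a2 : |Z| ^ k ≤ 1 := pow_le_one₀ hz hZ.le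
      have a3 : 0 ≤ b ^ i := by positivity
      have a4 : 0 ≤ |Z| ^ k := by positivity
      rcases h with h | h
      · have : b ^ i ≤ b ^ e := pow_le_pow_of_le_one hb.le hb1.le h
        have : 0 ≤ |Z| ^ N := by positivity
        nlinarith
      · have : |Z| ^ k ≤ |Z| ^ N := pow_le_pow_of_le_one hz hZ.le h
        have : 0 ≤ b ^ e := by positivity
        nlinarith
    rw [abs_mul, abs_mul, abs_pow, abs_pow, abs_of_pos hb]
    have h2 := hC r hr.le
    have h3 := jap_rpow_pos r (-s)
    calc b ^ i * |φ r| * |Z| ^ k = |φ r| * (b ^ i * |Z| ^ k) := by ring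
      _ ≤ (C * jap r ^ (-s)) * (b ^ e + |Z| ^ N) := by gcongr
      _ = _ := by ring
  induction m with
  | zero => intro s e N i k φ hφ h; exact key hφ h
  | succ m ih =>
    intro s e N i k φ hφ h
    refine ⟨key hφ h, fun b r Z => b ^ i * deriv φ r * Z ^ k,
      fun b r Z => b ^ i * ((k : ℝ) * φ r) * Z ^ (k - 1), fun b r Z hb hb1 hr hZ => ⟨?_, ?_⟩,
      ih hφ.deriv h, ih (hφ.const_mul _) (by omega)⟩
    · exact (((hφ.differentiable r).hasDerivAt.const_mul (b ^ i)).mul_const (Z ^ k))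
    · refine ((hasDerivAt_pow k Z).const_mul (b ^ i * φ r)).congr_deriv ?_
      ring

theorem sy_const (c : ℝ) : Sy 0 (fun _ => c) := ⟨contDiff_const, fun k => syO_const k c⟩

theorem Cl.const_mul {m : ℕ} {s : ℝ} {e N : ℕ} {f : ℝ → ℝ → ℝ → ℝ} (c : ℝ) (h : Cl m s e N f) :
    Cl m s e N (fun b r Z => c * f b r Z) := by
  have := (cl_mono (m := m) (e := 0) (N := 0) (i := 0) (k := 0) (sy_const c) (by simp)).mul h
  simpa using this

theorem cl_zero (m : ℕ) (s : ℝ) (e N : ℕ) : Cl m s e N (fun _ _ _ => 0) := by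
  have := cl_mono (m := m) (s := s) (e := e) (N := N) (i := e) (k := 0)
    (φ := fun _ => 0) ⟨contDiff_const, fun k => syO_zero k s⟩ (Or.inl le_rfl)
  simpa using this

theorem Cl.Z_mul {m : ℕ} : ∀ {s : ℝ} {e N : ℕ} {f : ℝ → ℝ → ℝ → ℝ}, Cl m s e N f →
    Cl m s e (N + 1) (fun b r Z => Z * f b r Z) := by
  have key : ∀ {s : ℝ} {e N : ℕ} {f : ℝ → ℝ → ℝ → ℝ}, BdOn s e N f →
      BdOn s e (N + 1) (fun b r Z => Z * f b r Z) := by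
    rintro s e N f ⟨C, hC, h⟩
    refine ⟨C, hC, fun b r Z hb hb1 hr hZ => ?_⟩
    rw [abs_mul]
    have h1 : |Z| * (b ^ e + |Z| ^ N) ≤ b ^ e + |Z| ^ (N + 1) := by
      have : 0 < b ^ e := by positivity
      rw [pow_succ]; nlinarith [abs_nonneg Z]
    have h2 := jap_rpow_pos r (-s)
    calc |Z| * |f b r Z| ≤ |Z| * (C * (b ^ e + |Z| ^ N) * jap r ^ (-s)) := by
          gcongr; exact h b r Z hb hb1 hr hZ
      _ = C * (|Z| * (b ^ e + |Z| ^ N)) * jap r ^ (-s) := by ring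
      _ ≤ _ := by gcongr
  induction m with
  | zero => intro s e N f h; exact key h
  | succ m ih =>
    intro s e N f h
    have h' := h.of_succ
    obtain ⟨h0, fr, fZ, hd, h1, h2⟩ := h
    refine ⟨key h0, fun b r Z => Z * fr b r Z, fun b r Z => f b r Z + Z * fZ b r Z,
      fun b r Z hb hb1 hr hZ => ⟨?_, ?_⟩, ih h1, h'.add ((ih h2).mono le_rfl le_rfl (by omega))⟩
    · exact (hd b r Z hb hb1 hr hZ).1.const_mul Z
    · exact ((hasDerivAt_id Z).mul (hd b r Z hb hb1 hr hZ).2).congr_deriv (by simp)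

/-- The bounds on iterated derivatives contained in `Cl 2`. -/
theorem Cl.iteratedDeriv_bound {s : ℝ} {e N : ℕ} {f : ℝ → ℝ → ℝ → ℝ} (h : Cl 2 s e N f) :
    ∃ C, 0 ≤ C ∧ ∀ b r Z : ℝ, 0 < b → b < 1 → 0 < r → |Z| < 1 → ∀ j k : ℕ, j + k ≤ 2 →
      |iteratedDeriv j (fun x => iteratedDeriv k (fun W => f b x W) Z) r| ≤
        C * (b ^ e + |Z| ^ (N - k)) * jap r ^ (-(s + j)) := by
  obtain ⟨⟨C0, hC0, h0⟩, fr, fZ, hd, ⟨⟨C1, hC1, h1⟩, frr, frZ, hd1, ⟨C2, hC2, h2⟩, -⟩,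
    ⟨⟨C3, hC3, h3⟩, fZr, fZZ, hd2, ⟨C4, hC4, h4⟩, ⟨C5, hC5, h5⟩⟩⟩ := h
  have key : ∀ {C D x y : ℝ}, 0 ≤ D → C ≤ D → 0 ≤ x → 0 ≤ y → C * x * y ≤ D * x * y := by
    intro C D x y _ h2 h3 h4; gcongr
  refine ⟨C0 + C1 + C2 + C3 + C4 + C5, by positivity, fun b r Z hb hb1 hr hZ j k hjk => ?_⟩
  have hx : ∀ M : ℕ, 0 ≤ b ^ e + |Z| ^ M := fun M => by have := abs_nonneg Z; positivity
  have hev : ∀ᶠ x in 𝓝 r, 0 < x := eventually_gt_nhds hr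
  have hevZ : ∀ᶠ x in 𝓝 Z, |x| < 1 := (continuous_abs.tendsto Z).eventually (gt_mem_nhds hZ)
  have eZ : ∀ x, 0 < x → deriv (fun W => f b x W) Z = fZ b x Z := fun x hx =>
    (hd b x Z hb hb1 hx hZ).2.deriv
  obtain ⟨rfl, rfl⟩ | ⟨rfl, rfl⟩ | ⟨rfl, rfl⟩ | ⟨rfl, rfl⟩ | ⟨rfl, rfl⟩ | ⟨rfl, rfl⟩ :
    (j = 0 ∧ k = 0) ∨ (j = 1 ∧ k = 0) ∨ (j = 0 ∧ k = 1) ∨ (j = 2 ∧ k = 0) ∨ (j = 1 ∧ k = 1) ∨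
    (j = 0 ∧ k = 2) := by omega
  · simp only [iteratedDeriv_zero, Nat.cast_zero, add_zero, Nat.sub_zero]
    exact (h0 b r Z hb hb1 hr hZ).trans
      (key (by positivity) (by linarith) (hx _) (jap_rpow_pos _ _).le)
  · simp only [iteratedDeriv_zero, iteratedDeriv_one, Nat.cast_one, Nat.sub_zero]
    rw [(hd b r Z hb hb1 hr hZ).1.deriv]
    exact (h1 b r Z hb hb1 hr hZ).trans
      (key (by positivity) (by linarith) (hx _) (jap_rpow_pos _ _).le)
  · simp only [iteratedDeriv_zero, iteratedDeriv_one, Nat.cast_zero, add_zero]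
    rw [eZ r hr]
    exact (h3 b r Z hb hb1 hr hZ).trans
      (key (by positivity) (by linarith) (hx _) (jap_rpow_pos _ _).le)
  · simp only [iteratedDeriv_zero, Nat.cast_ofNat, Nat.sub_zero]
    rw [iteratedDeriv_succ, iteratedDeriv_one]
    have : deriv (fun x => f b x Z) =ᶠ[𝓝 r] fun x => fr b x Z := by
      filter_upwards [hev] with x hx using (hd b x Z hb hb1 hx hZ).1.deriv
    rw [this.deriv_eq, (hd1 b r Z hb hb1 hr hZ).1.deriv, show s + 2 = s + 1 + 1 by ring]
    exact (h2 b r Z hb hb1 hr hZ).trans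
      (key (by positivity) (by linarith) (hx _) (jap_rpow_pos _ _).le)
  · simp only [iteratedDeriv_one, Nat.cast_one]
    have : (fun x => deriv (fun W => f b x W) Z) =ᶠ[𝓝 r] fun x => fZ b x Z := by
      filter_upwards [hev] with x hx using eZ x hx
    rw [this.deriv_eq, (hd2 b r Z hb hb1 hr hZ).1.deriv]
    exact (h4 b r Z hb hb1 hr hZ).trans
      (key (by positivity) (by linarith) (hx _) (jap_rpow_pos _ _).le)
  · simp only [iteratedDeriv_zero, Nat.cast_zero, add_zero]
    rw [iteratedDeriv_succ, iteratedDeriv_one]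
    have : deriv (fun W => f b r W) =ᶠ[𝓝 Z] fun W => fZ b r W := by
      filter_upwards [hevZ] with x hx using (hd b r x hb hb1 hr hx).2.deriv
    rw [this.deriv_eq, (hd2 b r Z hb hb1 hr hZ).2.deriv]
    exact (h5 b r Z hb hb1 hr hZ).trans
      (key (by positivity) (by linarith) (hx _) (jap_rpow_pos _ _).le)

/-! ### Taylor expansion of rescaled functions in Z² -/

/-- The rescaled function `μ^{-a} h(r/μ)`, `μ = ⟨Z⟩`. -/
def gs (a : ℝ) (h : ℝ → ℝ) (r Z : ℝ) : ℝ := jap Z ^ (-a) * h (r / jap Z)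

/-- `∂_{Z²}` of `gs a h` is `gs (a+2) (aop a h)`. -/
def aop (a : ℝ) (h : ℝ → ℝ) (r : ℝ) : ℝ := -1 / 2 * (a * h r + r * deriv h r)

theorem hasDerivAt_jap (Z : ℝ) : HasDerivAt jap (Z / jap Z) Z := by
  have h1 : HasDerivAt (fun Z : ℝ => 1 + Z ^ 2) (2 * Z) Z := by
    simpa using (hasDerivAt_pow 2 Z).const_add 1
  have := h1.sqrt (by positivity)
  refine this.congr_deriv ?_
  unfold jap
  field_simp

theorem hasDerivAt_gs_r (a : ℝ) {h : ℝ → ℝ} (hh : Differentiable ℝ h) (r Z : ℝ) :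
    HasDerivAt (fun r => gs a h r Z) (gs (a + 1) (deriv h) r Z) r := by
  have h1 : HasDerivAt (fun r => r / jap Z) (1 / jap Z) r := (hasDerivAt_id r).div_const _
  refine (((hh _).hasDerivAt.comp r h1).const_mul (jap Z ^ (-a))).congr_deriv ?_
  unfold gs
  rw [show -(a + 1) = -a - 1 by ring, Real.rpow_sub (jap_pos Z), Real.rpow_one]
  ring

/-- As ⟨Z⟩' = Z/⟨Z⟩, a Z-derivative produces 2Z times another rescaled function. The family is thus
stable under ∂_{Z²}, which makes all Taylor coefficients explicit. -/
theorem hasDerivAt_gs_Z (a : ℝ) {h : ℝ → ℝ} (hh : Differentiable ℝ h) (r Z : ℝ) :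
    HasDerivAt (fun Z => gs a h r Z) (2 * (Z * gs (a + 2) (aop a h) r Z)) Z := by
  have hj := (jap_pos Z).ne'
  have h1 : HasDerivAt (fun Z => r / jap Z) ((0 * jap Z - r * (Z / jap Z)) / jap Z ^ 2) Z :=
    (hasDerivAt_const Z r).div (hasDerivAt_jap Z) hj
  have h2 := (hasDerivAt_jap Z).rpow_const (p := -a) (Or.inl hj)
  refine (h2.mul ((hh _).hasDerivAt.comp Z h1)).congr_deriv ?_
  unfold gs aop
  rw [show -(a + 2) = -a - 2 by ring, Real.rpow_sub (jap_pos Z), Real.rpow_sub (jap_pos Z),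
    Real.rpow_one, Real.rpow_two]
  simp only [Function.comp]
  field_simp
  ring

theorem Sy.aop {s : ℝ} (a : ℝ) {h : ℝ → ℝ} (hh : Sy s h) : Sy s (aop a h) :=
  ((hh.const_mul a).add hh.id_mul_deriv).const_mul (-1 / 2)

theorem even_aop (a : ℝ) {h : ℝ → ℝ} (hh : Function.Even h) : Function.Even (aop a h) := by
  intro r
  have := even_id_mul_deriv hh r
  simp only at this
  unfold aop
  rw [hh r, this]

theorem deriv_aop {s : ℝ} (a : ℝ) {h : ℝ → ℝ} (hh : Sy s h) :
    deriv (aop a h) = aop (a + 1) (deriv h) := by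
  ext r
  refine ((((hh.differentiable r).hasDerivAt.const_mul a).add ((hasDerivAt_id r).mul
    (hh.deriv.differentiable r).hasDerivAt)).const_mul (-1 / 2)).deriv.trans ?_
  simp only [aop, id]
  ring

/-- Taylor coefficients of `gs a h` in `Z²`. -/
def coef : ℕ → ℝ → (ℝ → ℝ) → ℝ → ℝ
  | 0, _, h => h
  | k + 1, a, h => fun r => 1 / ((k : ℝ) + 1) * coef k (a + 2) (aop a h) r

theorem sy_coef (k : ℕ) : ∀ {s : ℝ} (a : ℝ) {h : ℝ → ℝ}, Sy s h → Sy s (coef k a h) := by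
  induction k with
  | zero => intro s a h hh; exact hh
  | succ k ih => intro s a h hh; exact (ih (a + 2) (hh.aop a)).const_mul _

theorem even_coef (k : ℕ) : ∀ (a : ℝ) {h : ℝ → ℝ}, Function.Even h →
    Function.Even (coef k a h) := by
  induction k with
  | zero => intro a h hh; exact hh
  | succ k ih =>
    intro a h hh r
    simp only [coef, ih (a + 2) (even_aop a hh) r]

/-- Taylor expansion in Z² commutes with ∂_r, and ∂_r turns `gs a h` into `gs (a + 1) (deriv h)`. -/
theorem deriv_coef (k : ℕ) : ∀ {s : ℝ} (a : ℝ) {h : ℝ → ℝ}, Sy s h →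
    deriv (coef k a h) = coef k (a + 1) (deriv h) := by
  induction k with
  | zero => intro s a h hh; rfl
  | succ k ih =>
    intro s a h hh
    ext r
    have h1 := sy_coef k (a + 2) (hh.aop a)
    refine ((h1.differentiable r).hasDerivAt.const_mul _).deriv.trans ?_
    rw [ih (a + 2) (hh.aop a), deriv_aop a hh]
    simp only [coef]
    rw [show a + 2 + 1 = a + 1 + 2 by ring]

/-- Taylor remainder of `gs a h` in `Z²`. -/
def gsRem (K : ℕ) (a : ℝ) (h : ℝ → ℝ) (r Z : ℝ) : ℝ :=
  gs a h r Z - ∑ k ∈ Finset.range K, coef k a h r * Z ^ (2 * k)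

theorem hasDerivAt_gsRem_r (K : ℕ) {s : ℝ} (a : ℝ) {h : ℝ → ℝ} (hh : Sy s h) (r Z : ℝ) :
    HasDerivAt (fun r => gsRem K a h r Z) (gsRem K (a + 1) (deriv h) r Z) r := by
  refine (hasDerivAt_gs_r a hh.differentiable r Z).sub ?_
  refine HasDerivAt.fun_sum fun k _ => ?_
  rw [← deriv_coef k a hh]
  exact ((sy_coef k a hh).differentiable r).hasDerivAt.mul_const _

theorem hasDerivAt_gsRem_Z (K : ℕ) {s : ℝ} (a : ℝ) {h : ℝ → ℝ} (hh : Sy s h) (r Z : ℝ) :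
    HasDerivAt (fun Z => gsRem K a h r Z)
      (2 * (Z * gsRem (K - 1) (a + 2) (aop a h) r Z)) Z := by
  have h1 := (hasDerivAt_gs_Z a hh.differentiable r Z).sub
    (HasDerivAt.fun_sum (u := Finset.range K) fun k _ =>
      (hasDerivAt_pow (2 * k) Z).const_mul (coef k a h r))
  refine h1.congr_deriv ?_
  unfold gsRem
  cases K with
  | zero => simp
  | succ K =>
    rw [Finset.sum_range_succ', Nat.add_sub_cancel]
    simp only [mul_sub, Finset.mul_sum, Nat.cast_mul, mul_zero, Nat.cast_zero,
      zero_mul, add_zero]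
    congr 1
    refine Finset.sum_congr rfl fun k _ => ?_
    simp only [coef]
    rw [show 2 * (k + 1) - 1 = 2 * k + 1 by omega, pow_succ]
    push_cast
    field_simp

theorem jap_zero : jap 0 = 1 := by simp [jap]

theorem gsRem_succ_zero (K : ℕ) (a : ℝ) (h : ℝ → ℝ) (r : ℝ) : gsRem (K + 1) a h r 0 = 0 := by
  unfold gsRem gs
  rw [Finset.sum_range_succ']
  simp [jap_zero, coef]

theorem jap_le_two {Z : ℝ} (hZ : |Z| < 1) : jap Z ≤ 2 := by
  have h1 := sq_abs Z
  unfold jap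
  rw [Real.sqrt_le_left (by norm_num)]
  nlinarith [abs_nonneg Z]

theorem bd_gs {s : ℝ} (a : ℝ) {h : ℝ → ℝ} (hh : Sy s h) (e : ℕ) :
    BdOn s e 0 (fun _ r Z => gs a h r Z) := by
  obtain ⟨C, hC⟩ := hh.bound
  have hC0 : 0 ≤ C := nonneg_of_mul_nonneg_left ((abs_nonneg _).trans (hC 0 le_rfl))
    (jap_rpow_pos 0 (-s))
  refine ⟨2 ^ |(-a)| * (C * 2 ^ |(-s)|), by positivity, fun b r Z hb hb1 hr hZ => ?_⟩
  have hj := jap_pos Z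
  have hj1 := one_le_jap Z
  have hj2 := jap_le_two hZ
  have h1 : jap Z ^ (-a) ≤ 2 ^ |(-a)| * 1 ^ (-a) :=
    rpow_le_of_comparable (-a) hj one_pos (by norm_num) (by linarith) (by linarith)
  rw [Real.one_rpow, mul_one] at h1
  have hrr : r / jap Z ≤ r := div_le_self hr.le hj1
  have hrr2 : r ≤ 2 * (r / jap Z) := by
    rw [← mul_div_assoc, le_div_iff₀ hj]; nlinarith
  have hr0 : 0 < r / jap Z := by positivity
  have h2 : jap (r / jap Z) ^ (-s) ≤ 2 ^ |(-s)| * jap r ^ (-s) := by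
    refine rpow_le_of_comparable (-s) (jap_pos _) (jap_pos _) (by norm_num) ?_ ?_
    · have : jap (r / jap Z) ≤ jap r := by
        unfold jap at *; apply Real.sqrt_le_sqrt; gcongr
      linarith [jap_pos r]
    · have e2 : 2 * jap (r / jap Z) = Real.sqrt (4 * (1 + (r / jap Z) ^ 2)) := by
        rw [Real.sqrt_mul (by norm_num), show (4 : ℝ) = 2 ^ 2 by norm_num,
          Real.sqrt_sq (by norm_num)]; rfl
      rw [e2, jap]
      apply Real.sqrt_le_sqrt
      nlinarith
  have h3 := hC (r / jap Z) hr0.le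
  have h4 := jap_rpow_pos r (-s)
  unfold gs
  rw [abs_mul, abs_of_pos (jap_rpow_pos Z (-a)), pow_zero]
  calc jap Z ^ (-a) * |h (r / jap Z)|
      ≤ 2 ^ |(-a)| * (C * (2 ^ |(-s)| * jap r ^ (-s))) := by
        gcongr
        exact h3.trans (by gcongr)
    _ = 2 ^ |(-a)| * (C * 2 ^ |(-s)|) * (0 + 1) * jap r ^ (-s) := by ring
    _ ≤ _ := by
      have : 0 ≤ b ^ e := by positivity
      gcongr

/-- The Z-derivative of the remainder of order K + 1 is 2Z times a remainder of order K, and the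
remainder vanishes at Z = 0. The mean value inequality therefore gains Z² at each step of the
induction. -/
theorem bd_gsRem (K : ℕ) : ∀ {s : ℝ} (a : ℝ) {h : ℝ → ℝ}, Sy s h → ∀ e : ℕ,
    BdOn s e (2 * K) (fun _ r Z => gsRem K a h r Z) := by
  induction K with
  | zero =>
    intro s a h hh e
    simpa [gsRem] using bd_gs a hh e
  | succ K ih =>
    intro s a h hh e
    obtain ⟨C, hC, hb⟩ := ih (a + 2) (hh.aop a) e
    refine ⟨2 * C, by positivity, fun b r Z hb0 hb1 hr hZ => ?_⟩
    have h3 := jap_rpow_pos r (-s)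
    have hz := abs_nonneg Z
    set D := 2 * (|Z| * (C * (b ^ e + |Z| ^ (2 * K)) * jap r ^ (-s))) with hD
    have hmv := (convex_Icc (-|Z|) |Z|).norm_image_sub_le_of_norm_hasDerivWithin_le
      (f := fun Z => gsRem (K + 1) a h r Z) (C := D) (x := 0) (y := Z)
      (fun x _ => (hasDerivAt_gsRem_Z (K + 1) a hh r x).hasDerivWithinAt) (fun x hx => ?_)
      ⟨by linarith, hz⟩ ⟨neg_abs_le Z, le_abs_self Z⟩
    · simp only [gsRem_succ_zero, sub_zero, Real.norm_eq_abs] at hmv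
      refine hmv.trans ?_
      rw [hD]
      have h4 : |Z| * |Z| * (b ^ e + |Z| ^ (2 * K)) ≤ b ^ e + |Z| ^ (2 * (K + 1)) := by
        have : 0 < b ^ e := by positivity
        rw [show 2 * (K + 1) = 2 * K + 1 + 1 by ring, pow_succ, pow_succ]
        have : |Z| * |Z| ≤ 1 := by nlinarith
        nlinarith
      calc 2 * (|Z| * (C * (b ^ e + |Z| ^ (2 * K)) * jap r ^ (-s))) * |Z|
          = 2 * C * (|Z| * |Z| * (b ^ e + |Z| ^ (2 * K))) * jap r ^ (-s) := by ring
        _ ≤ _ := by gcongr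
    · have hx' : |x| ≤ |Z| := abs_le.2 hx
      rw [Real.norm_eq_abs, abs_mul, abs_mul, abs_of_pos (by norm_num : (0 : ℝ) < 2), hD,
        Nat.add_sub_cancel]
      have := hb b r x hb0 hb1 hr (lt_of_le_of_lt hx' hZ)
      have hx0 := abs_nonneg x
      gcongr
      refine this.trans ?_
      gcongr

theorem cl_gsRem {m : ℕ} : ∀ (K : ℕ) {s : ℝ} (a : ℝ) {h : ℝ → ℝ}, Sy s h → ∀ e : ℕ,
    Cl m s e (2 * K) (fun _ r Z => gsRem K a h r Z) := by
  induction m with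
  | zero => intro K s a h hh e; exact bd_gsRem K a hh e
  | succ m ih =>
    intro K s a h hh e
    refine ⟨bd_gsRem K a hh e, _, _, fun b r Z _ _ _ _ => ⟨hasDerivAt_gsRem_r K a hh r Z,
      hasDerivAt_gsRem_Z K a hh r Z⟩, ih K (a + 1) hh.deriv e, ?_⟩
    have := ((ih (K - 1) (a + 2) (hh.aop a) e).Z_mul).const_mul 2
    exact this.mono le_rfl le_rfl (by omega)

theorem cl_gs {m : ℕ} {s : ℝ} (a : ℝ) {h : ℝ → ℝ} (hh : Sy s h) :
    Cl m s 0 0 (fun _ r Z => gs a h r Z) := by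
  simpa [gsRem] using cl_gsRem (m := m) 0 a hh 0

/-! ### Calculus of expansions in b and Z² -/

/-- Functions `f(b, r, Z)` with an expansion in monomials `b^i φ(r) Z^{2j}`, with `(i, j)` at least
`(i₀, j₀)` in the lexicographic order, up to an error `O(b^n + |Z|^{2n+2})`. -/
inductive Exp (n : ℕ) (s : ℝ) (i₀ j₀ : ℕ) : (ℝ → ℝ → ℝ → ℝ) → Prop
  | mono (i j : ℕ) (φ : ℝ → ℝ) (hφ : SymM s φ) (h : i₀ < i ∨ (i₀ = i ∧ j₀ ≤ j)) :
      Exp n s i₀ j₀ (fun b r Z => b ^ i * φ r * Z ^ (2 * j))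
  | rem (f : ℝ → ℝ → ℝ → ℝ) (hf : ∀ ε > 0, Cl 2 (s - ε) n (2 * n + 2) f) : Exp n s i₀ j₀ f
  | add (f g : ℝ → ℝ → ℝ → ℝ) (hf : Exp n s i₀ j₀ f) (hg : Exp n s i₀ j₀ g) :
      Exp n s i₀ j₀ (fun b r Z => f b r Z + g b r Z)

namespace Exp
variable {n : ℕ} {s t : ℝ} {i₀ j₀ i₁ j₁ : ℕ} {f g : ℝ → ℝ → ℝ → ℝ}

theorem congr (hf : Exp n s i₀ j₀ f)
    (hfg : ∀ b r Z : ℝ, 0 < b → b < 1 → 0 < r → |Z| < 1 → f b r Z = g b r Z) :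
    Exp n s i₀ j₀ g := by
  have h1 : Exp n s i₀ j₀ (fun b r Z => g b r Z - f b r Z) :=
    .rem _ fun ε _ => (cl_zero _ _ _ _).congr fun b r Z hb hb1 hr hZ => by
      rw [hfg b r Z hb hb1 hr hZ, sub_self]
  have := add _ _ hf h1
  simpa using this

theorem zero : Exp n s i₀ j₀ (fun _ _ _ => 0) := .rem _ fun _ _ => cl_zero _ _ _ _

theorem weaken (hf : Exp n s i₀ j₀ f) (h : i₁ < i₀ ∨ (i₁ = i₀ ∧ j₁ ≤ j₀)) :
    Exp n s i₁ j₁ f := by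
  induction hf with
  | mono i j φ hφ h' => exact .mono i j φ hφ (by omega)
  | rem f hf => exact .rem f hf
  | add f g _ _ h1 h2 => exact .add f g h1 h2

theorem weaken_order (hf : Exp n s i₀ j₀ f) (h : t ≤ s) : Exp n t i₀ j₀ f := by
  induction hf with
  | mono i j φ hφ h' => exact .mono i j φ (hφ.mono h) h'
  | rem f hf => exact .rem f fun ε hε => (hf ε hε).mono (by linarith) le_rfl le_rfl
  | add f g _ _ h1 h2 => exact .add f g h1 h2

theorem cl (hf : Exp n s i₀ j₀ f) {ε : ℝ} (hε : 0 < ε) : Cl 2 (s - ε) 0 0 f := by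
  induction hf with
  | mono i j φ hφ h' => exact cl_mono (hφ.sy hε) (by simp)
  | rem f hf => exact (hf ε hε).mono le_rfl (Nat.zero_le _) (Nat.zero_le _)
  | add f g _ _ h1 h2 => exact h1.add h2

theorem mul (hf : Exp n s i₀ j₀ f) (hg : Exp n t i₁ j₁ g) :
    Exp n (s + t) (i₀ + i₁) (j₀ + j₁) (fun b r Z => f b r Z * g b r Z) := by
  induction hf with
  | mono i j φ hφ h =>
    have hm : ∀ ε > 0, Cl 2 (s - ε) 0 0 (fun b r Z => b ^ i * φ r * Z ^ (2 * j)) := fun ε hε =>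
      cl_mono (hφ.sy hε) (by simp)
    induction hg with
    | mono k l ψ hψ h' =>
      refine (Exp.mono (i + k) (j + l) _ (hφ.mul hψ) (by omega)).congr fun b r Z _ _ _ _ => ?_
      rw [mul_add 2, pow_add, pow_add]; ring
    | rem g hg =>
      refine .rem _ fun ε hε => ((hm (ε / 2) (by linarith)).mul (hg (ε / 2) (by linarith))).mono
        (by linarith) le_rfl le_rfl
    | add g g' _ _ h1 h2 =>
      exact (Exp.add _ _ h1 h2).congr fun b r Z _ _ _ _ => by ring
  | rem f hf =>
    refine .rem _ fun ε hε => ?_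
    have := (hg.cl (ε := ε / 2) (by linarith)).mul (hf (ε / 2) (by linarith))
    refine (this.mono (t := s + t - ε) (by linarith) le_rfl le_rfl).congr
      fun b r Z _ _ _ _ => by ring
  | add f f' _ _ h1 h2 => exact (Exp.add _ _ h1 h2).congr fun b r Z _ _ _ _ => by ring

theorem const_mul (c : ℝ) (hf : Exp n s i₀ j₀ f) :
    Exp n s i₀ j₀ (fun b r Z => c * f b r Z) := by
  have h0 : SymM 0 (fun _ : ℝ => c) := (sy_const c).symM fun _ => rfl
  have := (Exp.mono (n := n) 0 0 _ h0 (by omega : 0 < 0 ∨ (0 = 0 ∧ 0 ≤ 0))).mul hf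
  simpa using this

theorem sub (hf : Exp n s i₀ j₀ f) (hg : Exp n s i₀ j₀ g) :
    Exp n s i₀ j₀ (fun b r Z => f b r Z - g b r Z) :=
  (Exp.add _ _ hf (hg.const_mul (-1))).congr fun b r Z _ _ _ _ => by ring

theorem sum {ι : Type*} (S : Finset ι) {F : ι → ℝ → ℝ → ℝ → ℝ}
    (h : ∀ i ∈ S, Exp n s i₀ j₀ (F i)) : Exp n s i₀ j₀ (fun b r Z => ∑ i ∈ S, F i b r Z) := by
  classical
  induction S using Finset.induction_on with
  | empty => simpa using zero
  | insert a S ha ih =>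
    simp only [Finset.sum_insert ha]
    exact .add _ _ (h a (by simp)) (ih fun i hi => h i (by simp [hi]))

/-- The leading coefficient. -/
theorem exists_leading (hf : Exp n s i₀ j₀ f) : ∃ φ, SymM s φ ∧
    Exp n s i₀ (j₀ + 1) (fun b r Z => f b r Z - b ^ i₀ * φ r * Z ^ (2 * j₀)) := by
  induction hf with
  | mono i j φ hφ h =>
    by_cases hij : i₀ = i ∧ j₀ = j
    · obtain ⟨rfl, rfl⟩ := hij
      exact ⟨φ, hφ, by simpa using zero⟩
    · exact ⟨fun _ => 0, symM_zero s, by simpa using Exp.mono i j φ hφ (by omega)⟩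
  | rem f hf => exact ⟨fun _ => 0, symM_zero s, by simpa using Exp.rem f hf⟩
  | add f g _ _ h1 h2 =>
    obtain ⟨φ, hφ, k1⟩ := h1
    obtain ⟨ψ, hψ, k2⟩ := h2
    exact ⟨_, hφ.add hψ, (Exp.add _ _ k1 k2).congr fun b r Z _ _ _ _ => by ring⟩

/-- A power Z^{2(n+1)} already belongs to the error, so once row i₀ is cleared up to j = n the
expansion starts at the next power of b. -/
theorem next (hf : Exp n s i₀ (n + 1) f) : Exp n s (i₀ + 1) 0 f := by
  generalize hj : n + 1 = j at hf
  induction hf with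
  | mono i j φ hφ h =>
    by_cases hi : i₀ = i
    · exact .rem _ fun ε hε => cl_mono (hφ.sy hε) (by omega)
    · exact .mono i j φ hφ (by omega)
  | rem f hf => exact .rem f hf
  | add f g _ _ h1 h2 => exact .add f g h1 h2

theorem cl_of_le (hf : Exp n s i₀ j₀ f) (h : n ≤ i₀) : ∀ ε > 0, Cl 2 (s - ε) n (2 * n + 2) f := by
  induction hf with
  | mono i j φ hφ h => exact fun ε hε => cl_mono (hφ.sy hε) (by omega)
  | rem f hf => exact hf
  | add f g _ _ h1 h2 => exact fun ε hε => (h1 ε hε).add (h2 ε hε)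

/-- Taylor coefficients are peeled off until the remainder has order n + 1 in Z², at which point it
belongs to the error. -/
theorem gsRem (K : ℕ) (a : ℝ) {h : ℝ → ℝ} (hh : Sy s h) (he : Function.Even h) :
    Exp n s 0 K (fun _ r Z => CylBlowup.gsRem K a h r Z) := by
  obtain ⟨d, hd⟩ : ∃ d, n + 1 ≤ K + d := ⟨n + 1, by omega⟩
  induction d generalizing K with
  | zero =>
    refine .rem _ fun ε hε => ?_
    exact (cl_gsRem K a hh n).mono (by linarith) le_rfl (by omega)
  | succ d ih =>
    have h1 := (ih (K + 1) (by omega)).weaken (i₁ := 0) (j₁ := K) (by omega)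
    have h2 : Exp n s 0 K (fun b r Z => b ^ 0 * coef K a h r * Z ^ (2 * K)) :=
      .mono 0 K _ ((sy_coef K a hh).symM (even_coef K a he)) (by omega)
    refine (Exp.add _ _ h1 h2).congr fun b r Z _ _ _ _ => ?_
    unfold CylBlowup.gsRem
    rw [Finset.sum_range_succ]; ring

theorem gs (a : ℝ) {h : ℝ → ℝ} (hh : Sy s h) (he : Function.Even h) :
    Exp n s 0 0 (fun _ r Z => CylBlowup.gs a h r Z) := by
  simpa [CylBlowup.gsRem] using Exp.gsRem (n := n) 0 a hh he

theorem pow (hf : Exp n s 0 0 f) (k : ℕ) : Exp n (k * s) 0 0 (fun b r Z => f b r Z ^ k) := by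
  induction k with
  | zero =>
    have := Exp.mono (n := n) 0 0 _ ((sy_const 1).symM fun _ => rfl)
      (by omega : 0 < 0 ∨ (0 = 0 ∧ 0 ≤ 0))
    simpa using this
  | succ k ih =>
    have := ih.mul hf
    simp only [pow_succ]
    convert this using 1
    push_cast; ring

/-- Differences of powers. -/
theorem pow_sub_pow (hf : Exp n s 0 0 f) (hg : Exp n s i₀ j₀ g) (k : ℕ) :
    Exp n (k * s) i₀ j₀ (fun b r Z => (f b r Z + g b r Z) ^ k - f b r Z ^ k) := by
  induction k with
  | zero => simpa using zero
  | succ k ih =>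
    have hfg : Exp n s 0 0 (fun b r Z => f b r Z + g b r Z) := .add _ _ hf (hg.weaken (by omega))
    have h1 := ih.mul hfg
    have h2 := (hf.pow k).mul hg
    simp only [add_zero, zero_add] at h1 h2
    have h3 := Exp.add _ _ h1 h2
    have e : (k : ℝ) * s + s = ((k + 1 : ℕ) : ℝ) * s := by push_cast; ring
    rw [e] at h3
    exact h3.congr fun b r Z _ _ _ _ => by ring

end Exp

/-! ### Global Taylor remainder of the nonlinearity -/

/-- `m` derivatives with `|T^{(l)}(x)| ≲ |x|^{N-l}` on `ℝ`. -/
def TC : ℕ → ℕ → (ℝ → ℝ) → Prop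
  | 0, N, T => ∃ C, 0 ≤ C ∧ ∀ x, |T x| ≤ C * |x| ^ N
  | m + 1, N, T => (∃ C, 0 ≤ C ∧ ∀ x, |T x| ≤ C * |x| ^ N) ∧
      ∃ T' : ℝ → ℝ, (∀ x, HasDerivAt T (T' x) x) ∧ TC m (N - 1) T'

/-- Each derivative lowers the power of b x by one and brings out one factor b, so division by b^N
remains uniform in b. The condition `m ≤ N` keeps the exponents N - l untruncated. -/
theorem TC.cl {m : ℕ} : ∀ {N : ℕ} {T : ℝ → ℝ} {s : ℝ} {x : ℝ → ℝ → ℝ → ℝ}, TC m N T → m ≤ N →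
    Cl m s 0 0 x → Cl m (N * s) 0 0 (fun b r Z => T (b * x b r Z) / b ^ N) := by
  have key : ∀ {N : ℕ} {T : ℝ → ℝ} {s : ℝ} {x : ℝ → ℝ → ℝ → ℝ},
      (∃ C, 0 ≤ C ∧ ∀ x, |T x| ≤ C * |x| ^ N) → BdOn s 0 0 x →
      BdOn (N * s) 0 0 (fun b r Z => T (b * x b r Z) / b ^ N) := by
    rintro N T s x ⟨C, hC, hT⟩ ⟨D, hD, hx⟩
    refine ⟨C * (D * 2) ^ N, by positivity, fun b r Z hb hb1 hr hZ => ?_⟩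
    have h1 := hx b r Z hb hb1 hr hZ
    rw [abs_div, abs_of_pos (pow_pos hb N), div_le_iff₀ (pow_pos hb N)]
    refine (hT _).trans ?_
    rw [abs_mul, abs_of_pos hb, mul_pow]
    have e1 : jap r ^ (-(N * s)) = (jap r ^ (-s)) ^ N := by
      rw [← Real.rpow_natCast, ← Real.rpow_mul (jap_pos r).le]; ring_nf
    have h2 : |x b r Z| ^ N ≤ (D * 2 * jap r ^ (-s)) ^ N := by
      have : |x b r Z| ≤ D * 2 * jap r ^ (-s) := by
        refine h1.trans (le_of_eq ?_); simp only [pow_zero]; ring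
      gcongr
    have h3 : 0 ≤ (D * 2 * jap r ^ (-s)) ^ N := by
      have := jap_rpow_pos r (-s); positivity
    calc C * (b ^ N * |x b r Z| ^ N) ≤ C * (b ^ N * (D * 2 * jap r ^ (-s)) ^ N) := by gcongr
      _ ≤ C * (b ^ N * (D * 2 * jap r ^ (-s)) ^ N) * 2 := by
        have : 0 ≤ C * (b ^ N * (D * 2 * jap r ^ (-s)) ^ N) := by positivity
        linarith
      _ = _ := by rw [e1, mul_pow (D * 2)]; simp only [pow_zero]; ring
  induction m with
  | zero => intro N T s x hT _ hx; exact key hT hx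
  | succ m ih =>
    intro N T s x hT hN hx
    have hx' := hx.of_succ
    obtain ⟨h0, T', hd, hT'⟩ := hT
    obtain ⟨k0, xr, xZ, kd, k1, k2⟩ := hx
    have h1 := ih hT' (by omega) hx'
    have eN : ((N - 1 : ℕ) : ℝ) = (N : ℝ) - 1 := by
      rw [Nat.cast_sub (by omega)]; simp
    rw [eN] at h1
    have eb : ∀ b : ℝ, b ^ N = b ^ (N - 1) * b := fun b => by
      rw [← pow_succ]; congr 1; omega
    refine ⟨key h0 k0, fun b r Z => T' (b * x b r Z) / b ^ (N - 1) * xr b r Z,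
      fun b r Z => T' (b * x b r Z) / b ^ (N - 1) * xZ b r Z, fun b r Z hb hb1 hr hZ => ⟨?_, ?_⟩,
      (h1.mul k1).mono (by linarith) le_rfl le_rfl, (h1.mul k2).mono (by linarith) le_rfl le_rfl⟩
    · refine (((hd _).comp r ((kd b r Z hb hb1 hr hZ).1.const_mul b)).div_const
        (b ^ N)).congr_deriv ?_
      rw [eb]; field_simp
    · refine (((hd _).comp Z ((kd b r Z hb hb1 hr hZ).2.const_mul b)).div_const
        (b ^ N)).congr_deriv ?_
      rw [eb]; field_simp

/-- Generalized binomial coefficients. -/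
def bin : ℝ → ℕ → ℝ
  | _, 0 => 1
  | q, m + 1 => q / ((m : ℝ) + 1) * bin (q - 1) m

/-- The Taylor polynomial of `(1 + x)^q`. -/
def binPoly (q : ℝ) (N : ℕ) (x : ℝ) : ℝ := ∑ m ∈ Finset.range N, bin q m * x ^ m

theorem hasDerivAt_binPoly (q : ℝ) (N : ℕ) (x : ℝ) :
    HasDerivAt (binPoly q N) (q * binPoly (q - 1) (N - 1) x) x := by
  have h1 : HasDerivAt (binPoly q N) _ x :=
    HasDerivAt.fun_sum (u := Finset.range N) fun k _ => (hasDerivAt_pow k x).const_mul (bin q k)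
  refine h1.congr_deriv ?_
  unfold binPoly
  cases N with
  | zero => simp
  | succ N =>
    rw [Finset.sum_range_succ', Nat.add_sub_cancel, Finset.mul_sum]
    simp only [Nat.cast_zero, zero_mul, mul_zero, add_zero]
    refine Finset.sum_congr rfl fun k _ => ?_
    simp only [bin, Nat.add_sub_cancel]
    push_cast
    field_simp

/-- The derivative of the remainder of order N + 1 for q is q times the remainder of order N for q -
1, and the remainder vanishes at 0; the mean value inequality closes the induction. Every real q is
allowed since 1 + x ≥ 1/2. -/
theorem binPoly_taylor (N : ℕ) : ∀ q : ℝ, ∃ C, 0 ≤ C ∧ ∀ x : ℝ, |x| ≤ 1 / 2 →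
    |(1 + x) ^ q - binPoly q N x| ≤ C * |x| ^ N := by
  induction N with
  | zero =>
    intro q
    refine ⟨2 ^ |q|, by positivity, fun x hx => ?_⟩
    have h1 := abs_le.1 hx
    have h2 : 0 < 1 + x := by linarith
    simp only [binPoly, Finset.range_zero, Finset.sum_empty, sub_zero, pow_zero, mul_one]
    rw [abs_of_pos (by positivity)]
    have := rpow_le_of_comparable q h2 one_pos (A := 2) (by norm_num) (by linarith) (by linarith)
    simpa using this
  | succ N ih =>
    intro q
    obtain ⟨C, hC, h⟩ := ih (q - 1)
    refine ⟨|q| * C, by positivity, fun x hx => ?_⟩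
    have hmv := (convex_Icc (-|x|) |x|).norm_image_sub_le_of_norm_hasDerivWithin_le
      (f := fun y => (1 + y) ^ q - binPoly q (N + 1) y)
      (f' := fun y => q * ((1 + y) ^ (q - 1) - binPoly (q - 1) N y))
      (C := |q| * (C * |x| ^ N)) (x := 0) (y := x) (fun y hy => ?_) (fun y hy => ?_)
      ⟨by linarith [abs_nonneg x], abs_nonneg x⟩ ⟨neg_abs_le x, le_abs_self x⟩
    · have e0 : binPoly q (N + 1) 0 = 1 := by
        unfold binPoly
        rw [Finset.sum_range_succ']; simp [bin]
      simp only [e0, add_zero, Real.one_rpow, sub_self, sub_zero, Real.norm_eq_abs] at hmv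
      refine hmv.trans (le_of_eq ?_)
      rw [pow_succ]; ring
    · have h1 := abs_le.1 ((abs_le.2 hy).trans hx)
      have h2 : 1 + y ≠ 0 := by linarith
      have h3 := ((hasDerivAt_id y).const_add 1).rpow_const (p := q) (Or.inl h2)
      refine ((h3.sub (hasDerivAt_binPoly q (N + 1) y)).congr_deriv ?_).hasDerivWithinAt
      simp only [id, Nat.add_sub_cancel]; ring
    · have h1 : |y| ≤ |x| := abs_le.2 hy
      rw [Real.norm_eq_abs, abs_mul]
      gcongr
      exact (h y (h1.trans hx)).trans (by gcongr)

/-- Away from 0 the lower powers are controlled by the top one: 1 ≤ 2|x|. -/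
theorem binPoly_large (q : ℝ) (N : ℕ) : ∃ C, 0 ≤ C ∧ ∀ x : ℝ, 1 / 2 ≤ |x| →
    |binPoly q N x| ≤ C * |x| ^ N := by
  refine ⟨∑ m ∈ Finset.range N, |bin q m| * 2 ^ N, by positivity, fun x hx => ?_⟩
  unfold binPoly
  refine (Finset.abs_sum_le_sum_abs _ _).trans ?_
  rw [Finset.sum_mul]
  refine Finset.sum_le_sum fun m hm => ?_
  have hm' := Finset.mem_range.1 hm
  rw [abs_mul, abs_pow, mul_assoc]
  gcongr
  have h2 : 1 ≤ 2 * |x| := by linarith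
  have h1 : |x| ^ N = |x| ^ m * |x| ^ (N - m) := by rw [← pow_add]; congr 1; omega
  rw [h1]
  have h3 : 1 ≤ 2 ^ N * |x| ^ (N - m) := by
    calc (1 : ℝ) ≤ (2 * |x|) ^ (N - m) := one_le_pow₀ h2
      _ = 2 ^ (N - m) * |x| ^ (N - m) := mul_pow _ _ _
      _ ≤ 2 ^ N * |x| ^ (N - m) := by
        gcongr
        · norm_num
        · omega
  have h4 : 0 ≤ |x| ^ m := by positivity
  calc |x| ^ m = |x| ^ m * 1 := (mul_one _).symm
    _ ≤ |x| ^ m * (2 ^ N * |x| ^ (N - m)) := by gcongr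
    _ = _ := by ring

/-- Global bound of the Taylor remainder, for a function equal to `(1+x)^q` near `0` and of size
`|1+x|^q` everywhere. -/
theorem taylor_global {q : ℝ} {N : ℕ} (hq : 0 ≤ q) (hqN : q ≤ N) {S : ℝ → ℝ}
    (h1 : ∀ x, |x| ≤ 1 / 2 → S x = (1 + x) ^ q) (h2 : ∀ x, |S x| ≤ |1 + x| ^ q) :
    ∃ C, 0 ≤ C ∧ ∀ x, |S x - binPoly q N x| ≤ C * |x| ^ N := by
  obtain ⟨C, hC, hc⟩ := binPoly_taylor N q
  obtain ⟨D, hD, hd⟩ := binPoly_large q N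
  -- For |x| ≥ 1/2 one has |1 + x| ≤ 3|x| ≤ 6|x|, and 6|x| ≥ 1 permits raising the exponent from q
  -- to N.
  refine ⟨C + (6 ^ N + D), by positivity, fun x => ?_⟩
  have hx0 : 0 ≤ |x| ^ N := by positivity
  rcases le_total |x| (1 / 2) with hx | hx
  · rw [h1 x hx]
    refine (hc x hx).trans ?_
    have : 0 ≤ (6 ^ N + D) * |x| ^ N := by positivity
    linarith
  · have h3 := hd x hx
    have h4 : |1 + x| ^ q ≤ 6 ^ N * |x| ^ N := by
      have a1 : |1 + x| ≤ 3 * |x| := by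
        have := abs_add_le 1 x
        rw [abs_one] at this
        linarith
      have a2 : (1 : ℝ) ≤ 6 * |x| := by linarith
      calc |1 + x| ^ q ≤ (6 * |x|) ^ q :=
            Real.rpow_le_rpow (abs_nonneg _) (by linarith [abs_nonneg x]) hq
        _ ≤ (6 * |x|) ^ (N : ℝ) := Real.rpow_le_rpow_of_exponent_le a2 hqN
        _ = _ := by rw [Real.rpow_natCast, mul_pow]
    have h5 := (abs_sub (S x) (binPoly q N x))
    have h6 := h2 x
    have : 0 ≤ C * |x| ^ N := by positivity
    linarith

theorem hasDerivAt_abs_rpow_spow {q : ℝ} (hq : 1 < q) (u : ℝ) :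
    HasDerivAt (fun u : ℝ => |u| ^ q) (q * spow (q - 1) u) u := by
  refine (hasDerivAt_abs_rpow u hq).congr_deriv ?_
  rw [spow, show q - 1 - 1 = q - 2 by ring]; ring

theorem hasDerivAt_spow {p : ℝ} (hp : 2 < p) (u : ℝ) :
    HasDerivAt (spow p) (p * |u| ^ (p - 1)) u := by
  refine ((hasDerivAt_abs_rpow_spow (q := p - 1) (by linarith) u).mul
    (hasDerivAt_id u)).congr_deriv ?_
  have h1 : |u| ^ (p - 1) = |u| ^ (p - 1 - 2) * (u * u) := by
    rcases eq_or_ne u 0 with rfl | hu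
    · simp [Real.zero_rpow (by linarith : p - 1 ≠ 0)]
    · have : |u| ^ (p - 1 - 2) = |u| ^ (p - 1) / u ^ 2 := by
        rw [Real.rpow_sub (abs_pos.2 hu) (p - 1) 2, Real.rpow_two, sq_abs]
      rw [this]
      field_simp
  rw [spow, h1, show p - 1 - 1 - 1 = p - 1 - 2 by ring]
  simp only [id]
  ring

/-- The Taylor remainder of `x ↦ |1+x|^{p-1}(1+x)`. -/
def spowRem (p : ℝ) (N : ℕ) (x : ℝ) : ℝ := spow p (1 + x) - binPoly p N x

/-- Near 0 this is Taylor's formula for (1+x)^p; far away `p ≤ N` lets |x|^N dominate both |1+x|^p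
and the polynomial. Two derivatives exist across x = -1, alternating between odd and even powers of
|1+x|, and are remainders of the same kind. -/
theorem tc_spowRem {p : ℝ} {N : ℕ} (hp : 5 < p) (hN : p ≤ N) : TC 2 N (spowRem p N) := by
  have hN2 : 2 ≤ N := by
    have : (2 : ℝ) ≤ N := by linarith
    exact_mod_cast this
  have e1 : ((N - 1 : ℕ) : ℝ) = (N : ℝ) - 1 := by rw [Nat.cast_sub (by omega)]; simp
  have e2 : ((N - 1 - 1 : ℕ) : ℝ) = (N : ℝ) - 1 - 1 := by
    rw [Nat.cast_sub (by omega), Nat.cast_sub (by omega)]; simp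
  have hpos : ∀ x : ℝ, |x| ≤ 1 / 2 → 0 < 1 + x := fun x hx => by linarith [(abs_le.1 hx).1]
  have hs : ∀ {q u : ℝ}, 1 < q → |spow q u| = |u| ^ q := by
    intro q u hq
    rw [spow, abs_mul, abs_of_nonneg (Real.rpow_nonneg (abs_nonneg u) _)]
    rcases eq_or_ne u 0 with rfl | hu
    · simp [Real.zero_rpow (by linarith : q ≠ 0)]
    · rw [← Real.rpow_add_one (abs_ne_zero.2 hu)]; ring_nf
  have hs2 : ∀ {q x : ℝ}, |x| ≤ 1 / 2 → spow q (1 + x) = (1 + x) ^ q := by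
    intro q x hx
    have := hpos x hx
    rw [spow, abs_of_pos this, ← Real.rpow_add_one this.ne']; ring_nf
  refine ⟨taylor_global (by linarith) hN (fun x hx => hs2 hx) (fun x => (hs (by linarith)).le),
    fun x => p * (|1 + x| ^ (p - 1) - binPoly (p - 1) (N - 1) x), fun x => ?_, ?_,
    fun x => p * ((p - 1) * (spow (p - 1 - 1) (1 + x) - binPoly (p - 1 - 1) (N - 1 - 1) x)),
    fun x => ?_, ?_⟩
  · have h1 : HasDerivAt (fun x : ℝ => 1 + x) 1 x := (hasDerivAt_id x).const_add 1
    refine (((hasDerivAt_spow (p := p) (by linarith) (1 + x)).comp x h1).sub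
      (hasDerivAt_binPoly p N x)).congr_deriv (by ring)
  · obtain ⟨C, hC, h⟩ := taylor_global (q := p - 1) (N := N - 1) (S := fun x => |1 + x| ^ (p - 1))
      (by linarith) (by rw [e1]; linarith) (fun x hx => by simp only [abs_of_pos (hpos x hx)])
      (fun x => by rw [abs_of_nonneg (Real.rpow_nonneg (abs_nonneg _) _)])
    refine ⟨|p| * C, by positivity, fun x => ?_⟩
    rw [abs_mul, mul_assoc]
    gcongr
    exact h x
  · have h1 : HasDerivAt (fun x : ℝ => 1 + x) 1 x := (hasDerivAt_id x).const_add 1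
    refine ((((hasDerivAt_abs_rpow_spow (q := p - 1) (by linarith) (1 + x)).comp x h1).sub
      (hasDerivAt_binPoly (p - 1) (N - 1) x)).const_mul p).congr_deriv (by ring)
  · obtain ⟨C, hC, h⟩ := taylor_global (q := p - 1 - 1) (N := N - 1 - 1)
      (S := fun x => spow (p - 1 - 1) (1 + x))
      (by linarith) (by rw [e2]; linarith) (fun x hx => hs2 hx) (fun x => (hs (by linarith)).le)
    refine ⟨|p| * (|p - 1| * C), by positivity, fun x => ?_⟩
    rw [abs_mul, abs_mul, mul_assoc, mul_assoc]
    gcongr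
    exact h x

/-! ### The reduced error `psi` -/

/-- The double sum over `i < n`, `j ≤ n`. -/
def dsum (n : ℕ) (F : ℕ → ℕ → ℝ) : ℝ :=
  ∑ i ∈ Finset.range n, ∑ j ∈ Finset.range (n + 1), F i j

theorem dsum_congr {n : ℕ} {F F' : ℕ → ℕ → ℝ} (h : ∀ i j, F i j = F' i j) :
    dsum n F = dsum n F' := by
  simp only [dsum, h]

theorem dsum_add (n : ℕ) (F F' : ℕ → ℕ → ℝ) :
    dsum n (fun i j => F i j + F' i j) = dsum n F + dsum n F' := by
  simp only [dsum, Finset.sum_add_distrib]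

theorem dsum_sub (n : ℕ) (F F' : ℕ → ℕ → ℝ) :
    dsum n (fun i j => F i j - F' i j) = dsum n F - dsum n F' := by
  simp only [dsum, Finset.sum_sub_distrib]

theorem mul_dsum (n : ℕ) (c : ℝ) (F : ℕ → ℕ → ℝ) :
    c * dsum n F = dsum n (fun i j => c * F i j) := by
  simp only [dsum, Finset.mul_sum]

theorem hasDerivAt_dsum {n : ℕ} {F F' : ℕ → ℕ → ℝ → ℝ} {x : ℝ}
    (h : ∀ i j, HasDerivAt (F i j) (F' i j x) x) :
    HasDerivAt (fun x => dsum n fun i j => F i j x) (dsum n fun i j => F' i j x) x :=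
  HasDerivAt.fun_sum fun i _ => HasDerivAt.fun_sum fun j _ => h i j

/-- The index bounds ensure that the modified entry really occurs in the sum; linear terms then
change by exactly one monomial. -/
theorem dsum_single {n i₀ j₀ : ℕ} (hi : i₀ < n) (hj : j₀ ≤ n) {F F' : ℕ → ℕ → ℝ} {x : ℝ}
    (h : ∀ i j, F' i j = F i j + if i = i₀ ∧ j = j₀ then x else 0) :
    dsum n F' = dsum n F + x := by
  rw [dsum_congr h, dsum_add]
  congr 1
  unfold dsum
  rw [Finset.sum_eq_single i₀, Finset.sum_eq_single j₀]
  · simp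
  · intro j _ hj'; simp [hj']
  · intro hj'; exact absurd (Finset.mem_range.2 (by omega)) hj'
  · intro i _ hi'; simp [hi']
  · intro hi'; exact absurd (Finset.mem_range.2 hi) hi'

theorem Exp.dsum {n i₀ j₀ : ℕ} {s : ℝ} {F : ℕ → ℕ → ℝ → ℝ → ℝ → ℝ}
    (h : ∀ i j, Exp n s i₀ j₀ (F i j)) :
    Exp n s i₀ j₀ (fun b r Z => dsum n fun i j => F i j b r Z) :=
  Exp.sum _ fun i _ => Exp.sum _ fun j _ => h i j

/-- `U` with `w` added to the entry `(i₀, j₀)`. -/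
def addAt (U : ℕ → ℕ → ℝ → ℝ) (i₀ j₀ : ℕ) (w : ℝ → ℝ) (i j : ℕ) (r : ℝ) : ℝ :=
  U i j r + if i = i₀ ∧ j = j₀ then w r else 0

theorem addAt_self (U : ℕ → ℕ → ℝ → ℝ) (i₀ j₀ : ℕ) (w : ℝ → ℝ) :
    addAt U i₀ j₀ w i₀ j₀ = fun r => U i₀ j₀ r + w r := by
  ext r; simp [addAt]

theorem addAt_ne (U : ℕ → ℕ → ℝ → ℝ) {i₀ j₀ i j : ℕ} (w : ℝ → ℝ) (h : ¬(i = i₀ ∧ j = j₀)) :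
    addAt U i₀ j₀ w i j = U i j := by
  ext r; simp [addAt, h]

/-- `∑_{i<n} γ_i b^i`. -/
def poly (n : ℕ) (γ : ℕ → ℝ) (b : ℝ) : ℝ := ∑ i ∈ Finset.range n, γ i * b ^ i

theorem poly_add_single {n i₀ : ℕ} (hi : i₀ < n) (γ : ℕ → ℝ) (x b : ℝ) :
    poly n (fun i => γ i + if i = i₀ then x else 0) b = poly n γ b + x * b ^ i₀ := by
  unfold poly
  simp only [add_mul, Finset.sum_add_distrib, ite_mul, zero_mul]
  rw [Finset.sum_ite_eq' (Finset.range n) i₀ (fun i => x * b ^ i)]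
  simp [hi]

theorem exp_poly (m n : ℕ) (γ : ℕ → ℝ) : Exp m 0 0 0 (fun b _ _ => poly n γ b) := by
  refine Exp.sum _ fun i _ => ?_
  have h0 : SymM 0 (fun _ : ℝ => γ i) := (sy_const _).symM fun _ => rfl
  refine (Exp.mono i 0 _ h0 (by omega)).congr fun b r Z _ _ _ _ => ?_
  simp [mul_comm]

/-- `v(b,r,Z) = ∑ b^i U_{i,j}(r) Z^{2j}`. -/
def vsum (n : ℕ) (U : ℕ → ℕ → ℝ → ℝ) (b r Z : ℝ) : ℝ :=
  dsum n fun i j => b ^ i * U i j r * Z ^ (2 * j)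

/-- `½ Z ∂_Z` of `G + b v` plus `b ∂_b (b v)`. -/
def modB (p : ℝ) (Φ : ℝ → ℝ) (n : ℕ) (U : ℕ → ℕ → ℝ → ℝ) (b r Z : ℝ) : ℝ :=
  Z ^ 2 * gs (2 / (p - 1) + 2) (aop (2 / (p - 1)) Φ) r Z +
    b * dsum n fun i j => b ^ i * (((i : ℝ) + 1 + j) * U i j r) * Z ^ (2 * j)

/-- `Λ_r + Z ∂_Z` of `G + b v`. -/
def modM (p : ℝ) (Φ : ℝ → ℝ) (n : ℕ) (U : ℕ → ℕ → ℝ → ℝ) (b r Z : ℝ) : ℝ :=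
  gs (2 / (p - 1)) (lamR p Φ) r Z +
    2 * (Z ^ 2 * gs (2 / (p - 1) + 2) (aop (2 / (p - 1)) Φ) r Z) +
    b * dsum n fun i j => b ^ i * (lamR p (U i j) r + 2 * j * U i j r) * Z ^ (2 * j)

/-- `∂_Z² G`. -/
def gZZ (p : ℝ) (Φ : ℝ → ℝ) (r Z : ℝ) : ℝ :=
  2 * gs (2 / (p - 1) + 2) (aop (2 / (p - 1)) Φ) r Z +
    4 * (Z ^ 2 * gs (2 / (p - 1) + 2 + 2)
      (aop (2 / (p - 1) + 2) (aop (2 / (p - 1)) Φ)) r Z)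

/-- The part of `b^{-1} Ψ_b` which is polynomial in the unknowns. -/
def psi (p : ℝ) (Φ : ℝ → ℝ) (n : ℕ) (U : ℕ → ℕ → ℝ → ℝ) (γ η : ℕ → ℝ) (b r Z : ℝ) : ℝ :=
  (dsum n fun i j => b ^ i * (linR p Φ (U i j) r + j * U i j r) * Z ^ (2 * j))
    - gZZ p Φ r Z
    - b * (dsum n fun i j =>
        b ^ i * (((2 * j : ℕ) : ℝ) * ((2 * j - 1 : ℕ) : ℝ) * U i j r) * Z ^ (2 * j - 1 - 1))
    - (∑ m ∈ Finset.range (n - 1), bin p (m + 2) * (b ^ (m + 1) *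
        (gs (2 / (p - 1) * (p - (m + 2 : ℕ))) (fun r => Φ r ^ (p - (m + 2 : ℕ))) r Z *
          vsum n U b r Z ^ (m + 2))))
    - p * ((gs (2 / (p - 1) * (p - 1)) (fun r => Φ r ^ (p - 1)) r Z - Φ r ^ (p - 1)) *
        vsum n U b r Z)
    - poly n γ b * modB p Φ n U b r Z
    - poly n η b * modM p Φ n U b r Z

theorem exp_b_pow (n k : ℕ) : Exp n 0 k 0 (fun b _ _ => b ^ k) := by
  have h0 : SymM 0 (fun _ : ℝ => (1 : ℝ)) := (sy_const _).symM fun _ => rfl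
  exact (Exp.mono k 0 _ h0 (by omega)).congr fun b r Z _ _ _ _ => by simp

theorem exp_Z_pow (n k : ℕ) : Exp n 0 0 k (fun _ _ Z => Z ^ (2 * k)) := by
  have h0 : SymM 0 (fun _ : ℝ => (1 : ℝ)) := (sy_const _).symM fun _ => rfl
  exact (Exp.mono 0 k _ h0 (by omega)).congr fun b r Z _ _ _ _ => by simp

theorem SymM.lam {s p : ℝ} {f : ℝ → ℝ} (h : SymM s f) : SymM s (lamR p f) :=
  (h.const_mul _).add h.id_mul_deriv

theorem lamR_addAt (p : ℝ) (U : ℕ → ℕ → ℝ → ℝ) (i₀ j₀ i j : ℕ) {w : ℝ → ℝ}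
    (hU : ContDiff ℝ ∞ (U i j)) (hw : ContDiff ℝ ∞ w) (r : ℝ) :
    lamR p (addAt U i₀ j₀ w i j) r =
      lamR p (U i j) r + if i = i₀ ∧ j = j₀ then lamR p w r else 0 := by
  by_cases h : i = i₀ ∧ j = j₀
  · obtain ⟨rfl, rfl⟩ := h
    rw [addAt_self]
    simp only [lamR, and_self, if_true]
    rw [deriv_fun_add (hU.differentiable (by simp) r) (hw.differentiable (by simp) r)]
    ring
  · rw [addAt_ne U w h, if_neg h, add_zero]

theorem linR_add {p : ℝ} {Φ f g : ℝ → ℝ} (hf : ContDiff ℝ ∞ f) (hg : ContDiff ℝ ∞ g) (r : ℝ) :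
    linR p Φ (fun r => f r + g r) r = linR p Φ f r + linR p Φ g r := by
  have hf0 := hf.differentiable (by simp)
  have hg0 := hg.differentiable (by simp)
  have e : deriv (fun r => f r + g r) = fun r => deriv f r + deriv g r := by
    ext r; exact deriv_fun_add (hf0 r) (hg0 r)
  have hf1 : Differentiable ℝ (deriv f) :=
    (contDiff_infty_iff_deriv.1 hf).2.differentiable (by simp)
  have hg1 : Differentiable ℝ (deriv g) :=
    (contDiff_infty_iff_deriv.1 hg).2.differentiable (by simp)
  simp only [linR, lapR_eq, lamR, e]
  rw [deriv_fun_add (hf1 r) (hg1 r)]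
  ring

theorem linR_addAt (p : ℝ) (Φ : ℝ → ℝ) (U : ℕ → ℕ → ℝ → ℝ) (i₀ j₀ i j : ℕ) {w : ℝ → ℝ}
    (hU : ContDiff ℝ ∞ (U i j)) (hw : ContDiff ℝ ∞ w) (r : ℝ) :
    linR p Φ (addAt U i₀ j₀ w i j) r =
      linR p Φ (U i j) r + if i = i₀ ∧ j = j₀ then linR p Φ w r else 0 := by
  by_cases h : i = i₀ ∧ j = j₀
  · obtain ⟨rfl, rfl⟩ := h
    rw [addAt_self, linR_add hU hw]
    simp
  · rw [addAt_ne U w h, if_neg h, add_zero]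

theorem vsum_addAt {n i₀ j₀ : ℕ} (hi : i₀ < n) (hj : j₀ ≤ n) (U : ℕ → ℕ → ℝ → ℝ) (w : ℝ → ℝ)
    (b r Z : ℝ) :
    vsum n (addAt U i₀ j₀ w) b r Z = vsum n U b r Z + b ^ i₀ * w r * Z ^ (2 * j₀) := by
  refine dsum_single hi hj fun i j => ?_
  by_cases h : i = i₀ ∧ j = j₀
  · obtain ⟨rfl, rfl⟩ := h; simp [addAt]; ring
  · simp [addAt, h]

theorem exp_vsum {n : ℕ} {s : ℝ} {U : ℕ → ℕ → ℝ → ℝ} (hU : ∀ i j, SymM s (U i j)) :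
    Exp n s 0 0 (fun b r Z => vsum n U b r Z) :=
  Exp.dsum fun i j => Exp.mono i j _ (hU i j) (by omega)

/-! ### Triangular structure: effect of changing one unknown -/

namespace EvenProfile
variable {p : ℝ} {Φ : ℝ → ℝ}

/-- The effect on `psi` of a change of one coefficient. -/
theorem psi_addAt (h : EvenProfile p Φ) {n i₀ j₀ : ℕ} (hi : i₀ < n) (hj : j₀ ≤ n)
    {U : ℕ → ℕ → ℝ → ℝ} (hU : ∀ i j, SymM (2 / (p - 1)) (U i j)) (γ η : ℕ → ℝ) {w : ℝ → ℝ}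
    (hw : SymM (2 / (p - 1)) w) :
    Exp n (2 / (p - 1)) i₀ (j₀ + 1) (fun b r Z => psi p Φ n (addAt U i₀ j₀ w) γ η b r Z -
      psi p Φ n U γ η b r Z - b ^ i₀ * (linR p Φ w r + j₀ * w r) * Z ^ (2 * j₀)) := by
  set α := 2 / (p - 1) with hα
  have hαm : α * (p - 1) = 2 := h.alpha_mul
  set g : ℝ → ℝ → ℝ → ℝ := fun b r Z => b ^ i₀ * w r * Z ^ (2 * j₀) with hg
  have hgE : Exp n α i₀ j₀ g := .mono i₀ j₀ w hw (by omega)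
  have hb : Exp n 0 1 0 (fun b _ _ => b) := by simpa using exp_b_pow n 1
  -- The term b∂_Z² lowers j but raises i, which is later in the lexicographic order; for j₀ = 0 it
  -- vanishes.
  have h1 : Exp n α i₀ (j₀ + 1) (fun b r Z => b * (b ^ i₀ *
      (((2 * j₀ : ℕ) : ℝ) * ((2 * j₀ - 1 : ℕ) : ℝ) * w r) * Z ^ (2 * j₀ - 1 - 1))) := by
    cases j₀ with
    | zero => simpa using Exp.zero
    | succ k =>
      refine (Exp.mono (i₀ + 1) k _ (hw.const_mul
        (((2 * (k + 1) : ℕ) : ℝ) * ((2 * (k + 1) - 1 : ℕ) : ℝ))) (by omega)).congr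
        fun b r Z _ _ _ _ => ?_
      rw [show 2 * (k + 1) - 1 - 1 = 2 * k by omega, pow_succ]; ring
  -- The quadratic and higher terms carry an explicit factor b^{m+1}.
  have h2 : Exp n α i₀ (j₀ + 1) (fun b r Z => ∑ m ∈ Finset.range (n - 1), bin p (m + 2) *
      (b ^ (m + 1) * (gs (α * (p - (m + 2 : ℕ))) (fun r => Φ r ^ (p - (m + 2 : ℕ))) r Z *
        ((vsum n U b r Z + g b r Z) ^ (m + 2) - vsum n U b r Z ^ (m + 2))))) := by
    refine Exp.sum _ fun m _ => Exp.const_mul _ ?_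
    have := (exp_b_pow n (m + 1)).mul ((Exp.gs (n := n) (α * (p - (m + 2 : ℕ)))
      (h.sy_rpow (p - (m + 2 : ℕ))) (h.even_rpow _)).mul
        ((exp_vsum hU).pow_sub_pow hgE (m + 2)))
    refine (this.weaken (by omega)).weaken_order ?_
    rw [← hα]
    nlinarith
  -- G^{p-1} - Φ^{p-1} is the first Taylor remainder in Z², so it raises j by one.
  have h3 : Exp n α i₀ (j₀ + 1) (fun b r Z => p *
      ((gs (α * (p - 1)) (fun r => Φ r ^ (p - 1)) r Z - Φ r ^ (p - 1)) * g b r Z)) := by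
    refine Exp.const_mul _ ?_
    have := (Exp.gsRem (n := n) 1 (α * (p - 1)) (h.sy_rpow (p - 1)) (h.even_rpow _)).mul hgE
    refine ((this.weaken (i₁ := i₀) (j₁ := j₀ + 1) (by omega)).weaken_order (t := α) ?_).congr
      fun b r Z _ _ _ _ => ?_
    · rw [← hα]; nlinarith
    · simp [gsRem, coef]
  have h4 : Exp n α i₀ (j₀ + 1) (fun b r Z => poly n γ b *
      (b * (b ^ i₀ * (((i₀ : ℝ) + 1 + j₀) * w r) * Z ^ (2 * j₀)))) := by
    have := (exp_poly n n γ).mul (hb.mul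
      (Exp.mono (n := n) i₀ j₀ _ (hw.const_mul ((i₀ : ℝ) + 1 + j₀))
        (by omega : i₀ < i₀ ∨ (i₀ = i₀ ∧ j₀ ≤ j₀))))
    exact (this.weaken (by omega)).weaken_order (by linarith)
  have h5 : Exp n α i₀ (j₀ + 1) (fun b r Z => poly n η b *
      (b * (b ^ i₀ * (lamR p w r + 2 * j₀ * w r) * Z ^ (2 * j₀)))) := by
    have := (exp_poly n n η).mul (hb.mul
      (Exp.mono (n := n) i₀ j₀ _ ((hw.lam (p := p)).add (hw.const_mul (2 * j₀)))
        (by omega : i₀ < i₀ ∨ (i₀ = i₀ ∧ j₀ ≤ j₀))))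
    exact (this.weaken (by omega)).weaken_order (by linarith)
  have key := ((((h1.const_mul (-1)).sub h2).sub h3).sub h4).sub h5
  refine key.congr fun b r Z _ _ _ _ => ?_
  have e1 : (dsum n fun i j => b ^ i * (linR p Φ (addAt U i₀ j₀ w i j) r +
      j * addAt U i₀ j₀ w i j r) * Z ^ (2 * j)) =
      (dsum n fun i j => b ^ i * (linR p Φ (U i j) r + j * U i j r) * Z ^ (2 * j)) +
        b ^ i₀ * (linR p Φ w r + j₀ * w r) * Z ^ (2 * j₀) := by
    refine dsum_single hi hj fun i j => ?_
    rw [linR_addAt p Φ U i₀ j₀ i j (hU i j).1 hw.1, addAt]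
    split_ifs with h
    · rw [h.1, h.2]; ring
    · ring
  have e2 : (dsum n fun i j => b ^ i * (((2 * j : ℕ) : ℝ) * ((2 * j - 1 : ℕ) : ℝ) *
      addAt U i₀ j₀ w i j r) * Z ^ (2 * j - 1 - 1)) =
      (dsum n fun i j => b ^ i * (((2 * j : ℕ) : ℝ) * ((2 * j - 1 : ℕ) : ℝ) *
        U i j r) * Z ^ (2 * j - 1 - 1)) + b ^ i₀ *
        (((2 * j₀ : ℕ) : ℝ) * ((2 * j₀ - 1 : ℕ) : ℝ) * w r) * Z ^ (2 * j₀ - 1 - 1) := by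
    refine dsum_single hi hj fun i j => ?_
    rw [addAt]
    split_ifs with h
    · rw [h.1, h.2]; ring
    · ring
  have e3 : modB p Φ n (addAt U i₀ j₀ w) b r Z = modB p Φ n U b r Z +
      b * (b ^ i₀ * (((i₀ : ℝ) + 1 + j₀) * w r) * Z ^ (2 * j₀)) := by
    unfold modB
    rw [dsum_single hi hj (F := fun i j => b ^ i * (((i : ℝ) + 1 + j) * U i j r) * Z ^ (2 * j))
      (x := b ^ i₀ * (((i₀ : ℝ) + 1 + j₀) * w r) * Z ^ (2 * j₀))]
    · ring
    intro i j
    rw [addAt]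
    split_ifs with h
    · rw [h.1, h.2]; ring
    · ring
  have e4 : modM p Φ n (addAt U i₀ j₀ w) b r Z = modM p Φ n U b r Z +
      b * (b ^ i₀ * (lamR p w r + 2 * j₀ * w r) * Z ^ (2 * j₀)) := by
    unfold modM
    rw [dsum_single hi hj
      (F := fun i j => b ^ i * (lamR p (U i j) r + 2 * j * U i j r) * Z ^ (2 * j))
      (x := b ^ i₀ * (lamR p w r + 2 * j₀ * w r) * Z ^ (2 * j₀))]
    · ring
    intro i j
    rw [lamR_addAt p U i₀ j₀ i j (hU i j).1 hw.1, addAt]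
    split_ifs with h
    · rw [h.1, h.2]; ring
    · ring
  simp only [psi, e1, e2, e3, e4, vsum_addAt hi hj U w]
  simp only [mul_sub, Finset.sum_sub_distrib]
  ring

/-- The effect on `psi` of a change of `γ`. -/
theorem psi_add_gamma (h : EvenProfile p Φ) {n i₀ : ℕ} (hi : i₀ < n)
    {U : ℕ → ℕ → ℝ → ℝ} (hU : ∀ i j, SymM (2 / (p - 1)) (U i j)) (γ η : ℕ → ℝ) (x : ℝ) :
    Exp n (2 / (p - 1)) i₀ 2 (fun b r Z =>
      psi p Φ n U (fun i => γ i + if i = i₀ then x else 0) η b r Z - psi p Φ n U γ η b r Z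
        + b ^ i₀ * (x * aop (2 / (p - 1)) Φ r) * Z ^ (2 * 1)) := by
  set α := 2 / (p - 1) with hα
  have hb : Exp n 0 1 0 (fun b _ _ => b) := by simpa using exp_b_pow n 1
  have h1 : Exp n α i₀ 2 (fun b r Z => x * (b ^ i₀ * (Z ^ (2 * 1) *
      gsRem 1 (α + 2) (aop α Φ) r Z))) := by
    have := (exp_b_pow n i₀).mul ((exp_Z_pow n 1).mul (Exp.gsRem (n := n) 1 (α + 2)
      (h.sy.aop α) (even_aop α h.even)))
    exact ((this.weaken (by omega)).weaken_order (by rw [← hα]; linarith)).const_mul x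
  have h2 : Exp n α i₀ 2 (fun b r Z => x * (b ^ i₀ * (b *
      dsum n fun i j => b ^ i * (((i : ℝ) + 1 + j) * U i j r) * Z ^ (2 * j)))) := by
    have := (exp_b_pow n i₀).mul (hb.mul (Exp.dsum (n := n) (i₀ := 0) (j₀ := 0) fun i j =>
      Exp.mono i j _ ((hU i j).const_mul ((i : ℝ) + 1 + j)) (by omega)))
    exact ((this.weaken (by omega)).weaken_order (by linarith)).const_mul x
  refine ((h1.const_mul (-1)).sub h2).congr fun b r Z _ _ _ _ => ?_
  simp only [psi, poly_add_single hi γ x b, modB, gsRem, coef, Finset.range_one,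
    Finset.sum_singleton, mul_zero, pow_zero, mul_one]
  rw [← hα]
  ring

/-- The effect on `psi` of a change of `η`. -/
theorem psi_add_eta (h : EvenProfile p Φ) {n i₀ : ℕ} (hi : i₀ < n)
    {U : ℕ → ℕ → ℝ → ℝ} (hU : ∀ i j, SymM (2 / (p - 1)) (U i j)) (γ η : ℕ → ℝ) (x : ℝ) :
    Exp n (2 / (p - 1)) i₀ 1 (fun b r Z =>
      psi p Φ n U γ (fun i => η i + if i = i₀ then x else 0) b r Z - psi p Φ n U γ η b r Z
        + b ^ i₀ * (x * lamR p Φ r) * Z ^ (2 * 0)) := by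
  set α := 2 / (p - 1) with hα
  have hb : Exp n 0 1 0 (fun b _ _ => b) := by simpa using exp_b_pow n 1
  have h0 : Exp n α i₀ 1 (fun b r Z => x * (b ^ i₀ * gsRem 1 α (lamR p Φ) r Z)) := by
    have := (exp_b_pow n i₀).mul (Exp.gsRem (n := n) 1 α h.sy_lam h.even_lam)
    exact ((this.weaken (by omega)).weaken_order (by rw [← hα]; linarith)).const_mul x
  have h1 : Exp n α i₀ 1 (fun b r Z => x * (b ^ i₀ * (Z ^ (2 * 1) *
      gs (α + 2) (aop α Φ) r Z))) := by
    have := (exp_b_pow n i₀).mul ((exp_Z_pow n 1).mul (Exp.gs (n := n) (α + 2)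
      (h.sy.aop α) (even_aop α h.even)))
    exact ((this.weaken (by omega)).weaken_order (by rw [← hα]; linarith)).const_mul x
  have h2 : Exp n α i₀ 1 (fun b r Z => x * (b ^ i₀ * (b *
      dsum n fun i j => b ^ i * (lamR p (U i j) r + 2 * j * U i j r) * Z ^ (2 * j)))) := by
    have := (exp_b_pow n i₀).mul (hb.mul (Exp.dsum (n := n) (i₀ := 0) (j₀ := 0) fun i j =>
      Exp.mono i j _ (((hU i j).lam (p := p)).add ((hU i j).const_mul (2 * j))) (by omega)))
    exact ((this.weaken (by omega)).weaken_order (by linarith)).const_mul x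
  refine (((h0.const_mul (-1)).sub (h1.const_mul 2)).sub h2).congr fun b r Z _ _ _ _ => ?_
  simp only [psi, poly_add_single hi η x b, modM, gsRem, coef, Finset.range_one,
    Finset.sum_singleton, mul_zero, pow_zero, mul_one]
  rw [← hα]
  ring

end EvenProfile

/-! ### From the reduced error to Ψ_b -/

theorem sum_Icc_one (n : ℕ) (f : ℕ → ℝ) :
    ∑ i ∈ Finset.Icc 1 n, f i = ∑ i ∈ Finset.range n, f (i + 1) := by
  induction n with
  | zero => simp
  | succ n ih => rw [Finset.sum_Icc_succ_top (by omega), ih, Finset.sum_range_succ]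

theorem Vb_eq (n : ℕ) (U : ℕ → ℕ → ℝ → ℝ) (b r Z : ℝ) :
    Vb n (fun i j => U (i - 1) j) b r Z = b * vsum n U b r Z := by
  rw [vsum, mul_dsum, Vb, sum_Icc_one, dsum]
  refine Finset.sum_congr rfl fun i _ => Finset.sum_congr rfl fun j _ => ?_
  rw [Nat.add_sub_cancel, pow_succ]; ring

theorem polyB_eq (n : ℕ) (γ : ℕ → ℝ) (b : ℝ) :
    polyB n (fun i => γ (i - 1)) b = b * poly n γ b := by
  rw [polyB, sum_Icc_one, poly, Finset.mul_sum]
  refine Finset.sum_congr rfl fun i _ => ?_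
  rw [Nat.add_sub_cancel, pow_succ]; ring

theorem hasDerivAt_vsum_r {n : ℕ} {U : ℕ → ℕ → ℝ → ℝ} (hU : ∀ i j, Differentiable ℝ (U i j))
    (b r Z : ℝ) : HasDerivAt (fun s => vsum n U b s Z)
      (vsum n (fun i j => deriv (U i j)) b r Z) r :=
  hasDerivAt_dsum (F := fun i j s => b ^ i * U i j s * Z ^ (2 * j))
    (F' := fun i j s => b ^ i * deriv (U i j) s * Z ^ (2 * j)) fun i j =>
    (((hU i j) r).hasDerivAt.const_mul _).mul_const _

theorem hasDerivAt_vsum_Z (n : ℕ) (U : ℕ → ℕ → ℝ → ℝ) (b r Z : ℝ) :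
    HasDerivAt (fun W => vsum n U b r W)
      (dsum n fun i j => b ^ i * U i j r * (((2 * j : ℕ) : ℝ) * Z ^ (2 * j - 1))) Z :=
  hasDerivAt_dsum (F := fun i j W => b ^ i * U i j r * W ^ (2 * j))
    (F' := fun i j W => b ^ i * U i j r * (((2 * j : ℕ) : ℝ) * W ^ (2 * j - 1))) fun _ j =>
    (hasDerivAt_pow (2 * j) Z).const_mul _

theorem hasDerivAt_vsum_ZZ (n : ℕ) (U : ℕ → ℕ → ℝ → ℝ) (b r Z : ℝ) :
    HasDerivAt (fun W => dsum n fun i j => b ^ i * U i j r * (((2 * j : ℕ) : ℝ) * W ^ (2 * j - 1)))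
      (dsum n fun i j => b ^ i * (((2 * j : ℕ) : ℝ) * ((2 * j - 1 : ℕ) : ℝ) * U i j r) *
        Z ^ (2 * j - 1 - 1)) Z :=
  hasDerivAt_dsum
    (F := fun i j W => b ^ i * U i j r * (((2 * j : ℕ) : ℝ) * W ^ (2 * j - 1)))
    (F' := fun i j W => b ^ i * (((2 * j : ℕ) : ℝ) * ((2 * j - 1 : ℕ) : ℝ) * U i j r) *
        W ^ (2 * j - 1 - 1)) fun i j =>
    (((hasDerivAt_pow (2 * j - 1) Z).const_mul _).const_mul _).congr_deriv (by ring)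

theorem hasDerivAt_mul_vsum_b (n : ℕ) (U : ℕ → ℕ → ℝ → ℝ) (b r Z : ℝ) :
    HasDerivAt (fun a => a * vsum n U a r Z)
      (dsum n fun i j => b ^ i * (((i : ℝ) + 1) * U i j r) * Z ^ (2 * j)) b := by
  have e : (fun a => a * vsum n U a r Z) =
      fun a => dsum n fun i j => a ^ (i + 1) * (U i j r * Z ^ (2 * j)) := by
    ext a
    rw [vsum, mul_dsum]
    exact dsum_congr fun i j => by ring
  rw [e]
  exact hasDerivAt_dsum (F := fun i j a => a ^ (i + 1) * (U i j r * Z ^ (2 * j)))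
    (F' := fun i j a => a ^ i * (((i : ℝ) + 1) * U i j r) * Z ^ (2 * j)) fun i j =>
    ((hasDerivAt_pow (i + 1) b).mul_const _).congr_deriv (by simp; ring)

theorem Z_mul_dsum (n : ℕ) (U : ℕ → ℕ → ℝ → ℝ) (b r Z : ℝ) :
    Z * (dsum n fun i j => b ^ i * U i j r * (((2 * j : ℕ) : ℝ) * Z ^ (2 * j - 1))) =
      dsum n fun i j => b ^ i * (2 * j * U i j r) * Z ^ (2 * j) := by
  rw [mul_dsum]
  refine dsum_congr fun i j => ?_
  cases j with
  | zero => simp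
  | succ k =>
    rw [show 2 * (k + 1) - 1 = 2 * k + 1 by omega, show 2 * (k + 1) = 2 * k + 1 + 1 by ring,
      pow_succ Z (2 * k + 1)]
    push_cast
    ring

/-- The generator of scalings commutes with the rescaling r ↦ r/⟨Z⟩. -/
theorem lamR_gs (p : ℝ) (Φ : ℝ → ℝ) (r Z : ℝ) :
    2 / (p - 1) * gs (2 / (p - 1)) Φ r Z + r * gs (2 / (p - 1) + 1) (deriv Φ) r Z =
      gs (2 / (p - 1)) (lamR p Φ) r Z := by
  simp only [gs, lamR]
  rw [show -(2 / (p - 1) + 1) = -(2 / (p - 1)) - 1 by ring, Real.rpow_sub (jap_pos Z),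
    Real.rpow_one]
  ring

namespace EvenProfile
variable {p : ℝ} {Φ : ℝ → ℝ}

theorem gs_pos (h : EvenProfile p Φ) (r Z : ℝ) : 0 < gs (2 / (p - 1)) Φ r Z :=
  mul_pos (jap_rpow_pos _ _) (h.pos _)

theorem gs_rpow (h : EvenProfile p Φ) (q r Z : ℝ) :
    gs (2 / (p - 1)) Φ r Z ^ q = gs (2 / (p - 1) * q) (fun r => Φ r ^ q) r Z := by
  unfold gs
  rw [Real.mul_rpow (jap_rpow_pos _ _).le (h.pos _).le, ← Real.rpow_mul (jap_pos Z).le]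
  congr 2; ring

theorem hasDerivAt_gs_ZZ (h : EvenProfile p Φ) (r Z : ℝ) :
    HasDerivAt (fun Z => 2 * (Z * gs (2 / (p - 1) + 2) (aop (2 / (p - 1)) Φ) r Z))
      (gZZ p Φ r Z) Z := by
  refine (((hasDerivAt_id Z).mul (hasDerivAt_gs_Z _
    (h.sy.aop (2 / (p - 1))).differentiable r Z)).const_mul 2).congr_deriv ?_
  simp only [id, gZZ]
  ring

/-- Factor G + bv = G(1 + bv/G) and expand at 1 to degree n, real powers of G being rescaled powers
of Φ. The constant and linear terms are isolated since they cancel in the definition of F; the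
remainder is exact, with no smallness of bv/G required. -/
theorem spow_add (h : EvenProfile p Φ) {n : ℕ} (hn : 1 ≤ n) (b r Z v : ℝ) :
    spow p (gs (2 / (p - 1)) Φ r Z + b * v) = gs (2 / (p - 1)) Φ r Z ^ p +
      b * (p * (gs (2 / (p - 1) * (p - 1)) (fun r => Φ r ^ (p - 1)) r Z * v)) +
      b * (∑ m ∈ Finset.range (n - 1), bin p (m + 2) * (b ^ (m + 1) *
        (gs (2 / (p - 1) * (p - (m + 2 : ℕ))) (fun r => Φ r ^ (p - (m + 2 : ℕ))) r Z *
          v ^ (m + 2)))) +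
      gs (2 / (p - 1) * p) (fun r => Φ r ^ p) r Z * spowRem p (n + 1)
        (b * (gs (2 / (p - 1) * (-1)) (fun r => Φ r ^ (-1 : ℝ)) r Z * v)) := by
  simp only [← h.gs_rpow]
  set g := gs (2 / (p - 1)) Φ r Z with hg
  have hg0 : 0 < g := h.gs_pos r Z
  have e0 : g + b * v = g * (1 + b * (g ^ (-1 : ℝ) * v)) := by
    rw [Real.rpow_neg_one]; field_simp
  have e1 : spow p (g + b * v) = g ^ p * spow p (1 + b * (g ^ (-1 : ℝ) * v)) := by
    rw [e0]
    simp only [spow]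
    rw [abs_mul, abs_of_pos hg0, Real.mul_rpow hg0.le (abs_nonneg _)]
    have : g ^ p = g ^ (p - 1) * g := by rw [← Real.rpow_add_one hg0.ne']; ring_nf
    rw [this]; ring
  have e2 : ∀ m : ℕ, g ^ p * (b * (g ^ (-1 : ℝ) * v)) ^ m = b ^ m * (g ^ (p - m) * v ^ m) := by
    intro m
    rw [Real.rpow_sub hg0, Real.rpow_neg_one, Real.rpow_natCast, mul_pow, mul_pow, inv_pow]
    ring
  have e3 : g ^ p * binPoly p (n + 1) (b * (g ^ (-1 : ℝ) * v)) = g ^ p +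
      b * (p * (g ^ (p - 1) * v)) + b * ∑ m ∈ Finset.range (n - 1), bin p (m + 2) *
        (b ^ (m + 1) * (g ^ (p - (m + 2 : ℕ)) * v ^ (m + 2))) := by
    obtain ⟨k, rfl⟩ : ∃ k, n = k + 1 := ⟨n - 1, by omega⟩
    rw [binPoly, Finset.sum_range_succ', Finset.sum_range_succ', mul_add, mul_add, Finset.mul_sum,
      Finset.mul_sum, Nat.add_sub_cancel]
    have f1 : ∀ m : ℕ, g ^ p * (bin p (m + 1 + 1) * (b * (g ^ (-1 : ℝ) * v)) ^ (m + 1 + 1)) =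
        b * (bin p (m + 2) * (b ^ (m + 1) * (g ^ (p - (m + 2 : ℕ)) * v ^ (m + 2)))) := by
      intro m
      rw [mul_left_comm, e2]
      rw [pow_succ b (m + 1)]; ring
    rw [Finset.sum_congr rfl fun m _ => f1 m, mul_left_comm, e2]
    simp [bin]
    ring
  rw [e1, spowRem, mul_sub, e3]
  ring

/-- The error in terms of its polynomial part. -/
theorem errPsi_eq (h : EvenProfile p Φ) {n : ℕ} (hn : 1 ≤ n) {U : ℕ → ℕ → ℝ → ℝ}
    (hU : ∀ i j, ContDiff ℝ ∞ (U i j)) (γ η : ℕ → ℝ) (b r Z : ℝ) :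
    errPsi p Φ n (fun i j => U (i - 1) j) (fun i => γ (i - 1)) (fun i => η (i - 1)) b r Z =
      b * psi p Φ n U γ η b r Z - gs (2 / (p - 1) * p) (fun r => Φ r ^ p) r Z *
        spowRem p (n + 1) (b * (gs (2 / (p - 1) * (-1)) (fun r => Φ r ^ (-1 : ℝ)) r Z *
          vsum n U b r Z)) := by
  have hU0 : ∀ i j, Differentiable ℝ (U i j) := fun i j => (hU i j).differentiable (by simp)
  have hU1 : ∀ i j, Differentiable ℝ (deriv (U i j)) := fun i j =>
    (contDiff_infty_iff_deriv.1 (hU i j)).2.differentiable (by simp)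
  have hG : ∀ r Z, G p Φ r Z = gs (2 / (p - 1)) Φ r Z := fun r Z => rfl
  have dVr : deriv (fun s => b * vsum n U b s Z) =
      fun s => b * vsum n (fun i j => deriv (U i j)) b s Z := by
    ext s; exact ((hasDerivAt_vsum_r hU0 b s Z).const_mul b).deriv
  have dVrr : deriv (fun s => b * vsum n (fun i j => deriv (U i j)) b s Z) r =
      b * vsum n (fun i j => deriv (deriv (U i j))) b r Z :=
    ((hasDerivAt_vsum_r hU1 b r Z).const_mul b).deriv
  have dVZ : ∀ Z, HasDerivAt (fun W => b * vsum n U b r W) (b *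
      dsum n fun i j => b ^ i * U i j r * (((2 * j : ℕ) : ℝ) * Z ^ (2 * j - 1))) Z := fun Z =>
    (hasDerivAt_vsum_Z n U b r Z).const_mul b
  have dGZ := fun Z => hasDerivAt_gs_Z (2 / (p - 1)) h.sy.differentiable r Z
  have dGVZ : deriv (fun W => gs (2 / (p - 1)) Φ r W + b * vsum n U b r W) = fun Z =>
      2 * (Z * gs (2 / (p - 1) + 2) (aop (2 / (p - 1)) Φ) r Z) + b *
        dsum n fun i j => b ^ i * U i j r * (((2 * j : ℕ) : ℝ) * Z ^ (2 * j - 1)) := by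
    ext Z; exact ((dGZ Z).add (dVZ Z)).deriv
  have dGVZZ := ((h.hasDerivAt_gs_ZZ r Z).add
    ((hasDerivAt_vsum_ZZ n U b r Z).const_mul b)).deriv
  have dGVr := ((hasDerivAt_gs_r (2 / (p - 1)) h.sy.differentiable r Z).add
    ((hasDerivAt_vsum_r (n := n) hU0 b r Z).const_mul b)).deriv
  have hlin : linR p Φ (fun s => b * vsum n U b s Z) r + 1 / 2 * (b * dsum n fun i j =>
      b ^ i * (2 * j * U i j r) * Z ^ (2 * j)) = b *
      dsum n fun i j => b ^ i * (linR p Φ (U i j) r + j * U i j r) * Z ^ (2 * j) := by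
    simp only [linR, lapR_eq, lamR, dVr, dVrr]
    simp only [vsum, mul_dsum, ← dsum_add]
    rw [neg_eq_neg_one_mul]
    simp only [mul_dsum, ← dsum_add, ← dsum_sub]
    refine dsum_congr fun i j => ?_
    ring
  have hlam : 2 / (p - 1) * (b * vsum n U b r Z) + r * (b * vsum n (fun i j => deriv (U i j)) b r Z)
      + b * (dsum n fun i j => b ^ i * (2 * j * U i j r) * Z ^ (2 * j)) =
      b * dsum n fun i j => b ^ i * (lamR p (U i j) r + 2 * j * U i j r) * Z ^ (2 * j) := by
    simp only [vsum, mul_dsum, ← dsum_add, lamR]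
    refine dsum_congr fun i j => ?_
    ring
  have hE : 1 / 2 * (b * (dsum n fun i j => b ^ i * (2 * j * U i j r) * Z ^ (2 * j))) +
      b * (dsum n fun i j => b ^ i * (((i : ℝ) + 1) * U i j r) * Z ^ (2 * j)) =
      b * dsum n fun i j => b ^ i * (((i : ℝ) + 1 + j) * U i j r) * Z ^ (2 * j) := by
    simp only [mul_dsum, ← dsum_add]
    refine dsum_congr fun i j => ?_
    ring
  have hZ := Z_mul_dsum n U b r Z
  have hs := h.spow_add hn b r Z (vsum n U b r Z)
  have hs0 : spow p (gs (2 / (p - 1)) Φ r Z) = gs (2 / (p - 1)) Φ r Z ^ p := by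
    have := h.gs_pos r Z
    rw [spow, abs_of_pos this, ← Real.rpow_add_one this.ne']; ring_nf
  have hl := lamR_gs p Φ r Z
  simp only [errPsi, Vb_eq, polyB_eq, nonlin, hG, iteratedDeriv_succ, iteratedDeriv_zero, dGVZ,
    (dVZ Z).deriv, (hasDerivAt_mul_vsum_b n U b r Z).deriv]
  simp only [Pi.add_def] at dGVZZ dGVr
  rw [dGVZZ, lamR, dGVr, hs, hs0]
  simp only [psi, modB, modM]
  generalize linR p Φ (fun s => b * vsum n U b s Z) r = A at *
  generalize (dsum n fun i j => b ^ i * (linR p Φ (U i j) r + j * U i j r) * Z ^ (2 * j)) = A' at *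
  generalize (dsum n fun i j => b ^ i * U i j r * (((2 * j : ℕ) : ℝ) * Z ^ (2 * j - 1))) = D at *
  generalize (dsum n fun i j => b ^ i * (2 * j * U i j r) * Z ^ (2 * j)) = D' at *
  generalize (dsum n fun i j => b ^ i * (((i : ℝ) + 1 + j) * U i j r) * Z ^ (2 * j)) = E' at *
  generalize (dsum n fun i j => b ^ i * (((i : ℝ) + 1) * U i j r) * Z ^ (2 * j)) = E at *
  generalize (dsum n fun i j => b ^ i * (lamR p (U i j) r + 2 * j * U i j r) * Z ^ (2 * j)) = W
    at *
  linear_combination hlin + (-(b * poly n γ b)) * hE + (-(b * poly n η b)) * hlam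
    - (b * poly n η b) * hl + (1 / 2 * b - b * poly n γ b * (1 / 2) * b - b * poly n η b * b) * hZ

/-- The error of a nearly exact approximate solution. -/
theorem cl_errPsi (h : EvenProfile p Φ) {n : ℕ} (hn : p ≤ n) {U : ℕ → ℕ → ℝ → ℝ}
    (hU : ∀ i j, SymM (2 / (p - 1)) (U i j)) {γ η : ℕ → ℝ}
    (hψ : Exp n (2 / (p - 1)) n 0 (psi p Φ n U γ η)) {ε : ℝ} (hε : 0 < ε) :
    Cl 2 (2 / (p - 1) - ε) n (2 * n + 2) (fun b r Z => b⁻¹ *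
      errPsi p Φ n (fun i j => U (i - 1) j) (fun i => γ (i - 1)) (fun i => η (i - 1)) b r Z) := by
  set α := 2 / (p - 1) with hα
  have hp := h.hp
  have hαm : α * (p - 1) = 2 := h.alpha_mul
  have hn1 : 1 ≤ n := by
    have : (1 : ℝ) ≤ n := by linarith
    exact_mod_cast this
  have hN : (0 : ℝ) < ((n + 1 : ℕ) : ℝ) := by positivity
  -- The loss is taken to be ε = 1/(n+1), so that v/G grows at most like ⟨r⟩^{1/(n+1)} and its
  -- (n+1)-st power loses exactly one power of ⟨r⟩, while G^p gains two over G.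
  have h1 : Cl 2 ((-1) * α + (α - 1 / ((n + 1 : ℕ) : ℝ))) 0 0 (fun b r Z =>
      gs (α * (-1)) (fun r => Φ r ^ (-1 : ℝ)) r Z * vsum n U b r Z) :=
    (cl_gs _ (h.sy_rpow (-1))).mul ((exp_vsum hU).cl (by positivity))
  have h2 := (tc_spowRem (p := p) (N := n + 1) h.hp (by push_cast; linarith)).cl (by omega) h1
  have h3 := (cl_gs (m := 2) (α * p) (h.sy_rpow p)).mul h2
  have h4 : Cl 2 0 n (2 * n + 2) (fun b r Z => b ^ n * 1 * Z ^ 0) :=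
    cl_mono (sy_const 1) (Or.inl le_rfl)
  have h5 := (h3.mul h4).const_mul (-1)
  have h6 := (hψ.cl_of_le le_rfl ε hε).add (h5.mono (t := α - ε) ?_ le_rfl le_rfl)
  · refine h6.congr fun b r Z hb hb1 hr hZ => ?_
    rw [h.errPsi_eq hn1 fun i j => (hU i j).1]
    rw [← hα]
    simp only [pow_succ, mul_one, pow_zero]
    field_simp
    ring
  · rw [← hα]
    have : ((n + 1 : ℕ) : ℝ) * ((-1) * α + (α - 1 / ((n + 1 : ℕ) : ℝ))) = -1 := by
      field_simp; ring
    rw [this]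
    nlinarith

end EvenProfile

/-! ### The initial guess and its leading coefficient -/

/-- The numerical range of the scaling generator in `L²(r² ρ dr)`. -/
theorem innerR_lamR_self (p : ℝ) {s : ℝ} {F : ℝ → ℝ} (hF : Sy s F) :
    innerR (lamR p F) F = (2 / (p - 1) - 3 / 2) * innerR F F +
      1 / 4 * innerR (fun r => r * F r) (fun r => r * F r) := by
  have hid : Sy (-1) (fun r : ℝ => r) := ⟨contDiff_id, syO_id⟩
  have hrF : Sy (-1 + s) (fun r => r * F r) := hid.mul hF
  have hrF' : Sy s (fun r => r * deriv F r) := hF.id_mul_deriv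
  have i1 := integrableOn_inner hF hF
  have i2 := integrableOn_inner hrF hrF
  have i3 := integrableOn_inner hrF' hF
  have hc : Sy (-1 + (-1 + s) + (-1 + s)) (fun r => r * (r * F r) * (r * F r)) :=
    (hid.mul hrF).mul hrF
  -- The identity is the integral of the derivative of r³F²ρ, whose boundary values vanish.
  have hd : ∀ r ∈ Ioi (0 : ℝ), HasDerivAt (fun r => r * (r * F r) * (r * F r) * rhoR r)
      (3 * (F r * F r * rhoR r * r ^ 2) + (2 * (r * deriv F r * F r * rhoR r * r ^ 2) +
        (-1 / 2) * (r * F r * (r * F r) * rhoR r * r ^ 2))) r := by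
    intro r _
    have h1 := (hasDerivAt_id r).mul (hF.differentiable r).hasDerivAt
    refine ((((hasDerivAt_id r).mul h1).mul h1).mul (hasDerivAt_rhoR r)).congr_deriv ?_
    simp only [id, Pi.mul_apply]
    ring
  have i4 : IntegrableOn (fun r => 2 * (r * deriv F r * F r * rhoR r * r ^ 2) +
      (-1 / 2) * (r * F r * (r * F r) * rhoR r * r ^ 2)) (Ioi 0) :=
    (i3.const_mul 2).add (i2.const_mul (-1 / 2))
  have := integral_Ioi_of_hasDerivAt_of_tendsto (a := (0 : ℝ))
    (f := fun r => r * (r * F r) * (r * F r) * rhoR r)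
    (Continuous.continuousWithinAt (hc.1.continuous.mul contDiff_rhoR.continuous)) hd
    ((i1.const_mul 3).add i4)
    (tendsto_mul_rhoR (hc.2 0).isBigO)
  rw [integral_add (i1.const_mul 3) i4,
    integral_add (i3.const_mul 2) (i2.const_mul (-1 / 2)), integral_const_mul, integral_const_mul,
    integral_const_mul] at this
  have e : innerR (lamR p F) F = 2 / (p - 1) * innerR F F +
      innerR (fun r => r * deriv F r) F := by
    rw [← innerR_const_mul]
    exact innerR_add (hF.const_mul _) hrF' hF
  rw [e]
  simp only [innerR]
  simp only [zero_mul, sub_zero] at this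
  linarith

theorem symM_addAt {s : ℝ} {U : ℕ → ℕ → ℝ → ℝ} (hU : ∀ i j, SymM s (U i j)) {w : ℝ → ℝ}
    (hw : SymM s w) (i₀ j₀ i j : ℕ) : SymM s (addAt U i₀ j₀ w i j) := by
  by_cases hij : i = i₀ ∧ j = j₀
  · obtain ⟨rfl, rfl⟩ := hij
    rw [addAt_self]; exact (hU _ _).add hw
  · rw [addAt_ne U w hij]; exact hU i j

theorem linR_zero (p : ℝ) (Φ : ℝ → ℝ) (r : ℝ) : linR p Φ (fun _ => 0) r = 0 := by
  simp [linR, lapR_eq, lamR]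

theorem psi_zero (p : ℝ) (Φ : ℝ → ℝ) {n : ℕ} (hn : 1 ≤ n) (b r Z : ℝ) :
    psi p Φ n (fun _ _ _ => 0) (fun _ => 0) (fun i => 0 + if i = 0 then 1 else 0) b r Z =
      -gZZ p Φ r Z - (gs (2 / (p - 1)) (lamR p Φ) r Z +
        2 * (Z ^ 2 * gs (2 / (p - 1) + 2) (aop (2 / (p - 1)) Φ) r Z)) := by
  have e1 : poly n (fun _ => 0) b = 0 := by simp [poly]
  have e2 : vsum n (fun _ _ _ => 0) b r Z = 0 := by simp [vsum, dsum]
  have e3 : lamR p (fun _ => 0) r = 0 := by simp [lamR]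
  unfold psi
  rw [poly_add_single (by omega) (fun _ => 0), e1, e2]
  simp [linR_zero, e3, dsum, modM]

namespace EvenProfile
variable {p : ℝ} {Φ : ℝ → ℝ}

/-- The expansion of `psi` at the initial guess. -/
theorem exp_psi_zero (h : EvenProfile p Φ) {n : ℕ} (hn : 1 ≤ n) :
    Exp n (2 / (p - 1)) 0 2 (fun b r Z =>
      psi p Φ n (fun _ _ _ => 0) (fun _ => 0) (fun i => 0 + if i = 0 then 1 else 0) b r Z -
        b ^ 0 * (-(lamR p (lamR p Φ) r + 2 * lamR p Φ r)) * Z ^ (2 * 1)) := by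
  set α := 2 / (p - 1) with hα
  have ha1 : aop α Φ = fun r => -1 / 2 * lamR p Φ r := rfl
  have hs1 := h.sy.aop α
  have he1 := even_aop α h.even
  have hs2 := hs1.aop (α + 2)
  have he2 := even_aop (α + 2) he1
  have k1 : Exp n α 0 2 (fun _ r Z => gsRem 2 (α + 2) (aop α Φ) r Z) := Exp.gsRem 2 _ hs1 he1
  have k2 : Exp n α 0 2 (fun _ r Z => gsRem 2 α (aop α Φ) r Z) := Exp.gsRem 2 _ hs1 he1
  have k3 : Exp n α 0 2 (fun _ r Z => Z ^ (2 * 1) *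
      gsRem 1 (α + 2 + 2) (aop (α + 2) (aop α Φ)) r Z) :=
    (((exp_Z_pow n 1).mul (Exp.gsRem 1 (α + 2 + 2) hs2 he2)).weaken (by omega)).weaken_order
      (by rw [← hα]; linarith)
  have k4 : Exp n α 0 2 (fun _ r Z => Z ^ (2 * 1) * gsRem 1 (α + 2) (aop α Φ) r Z) :=
    (((exp_Z_pow n 1).mul (Exp.gsRem 1 (α + 2) hs1 he1)).weaken (by omega)).weaken_order
      (by rw [← hα]; linarith)
  refine ((((k1.const_mul (-2)).sub (k3.const_mul 4)).add _ _ (k2.const_mul 2)).sub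
    (k4.const_mul 2)).congr fun b r Z _ _ _ _ => ?_
  -- Since Λ_rΦ = -2 `aop α Φ`, the contributions of -∂_Z²G and -η_0Λ_rG at Z = 0 cancel when η_0 =
  -- 1; what remains starts at Z².
  have e1 : gs α (lamR p Φ) r Z = -2 * gs α (aop α Φ) r Z := by
    rw [ha1]; simp only [gs]; ring
  have e2 : deriv (aop α Φ) r = -1 / 2 * deriv (lamR p Φ) r := by
    rw [ha1]; exact ((h.sy_lam.differentiable r).hasDerivAt.const_mul _).deriv
  have e3 : aop (α + 2) (aop α Φ) r = 1 / 4 * lamR p (lamR p Φ) r + 1 / 2 * lamR p Φ r := by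
    rw [aop, e2, ha1, lamR, ← hα]; ring
  have e4 : aop α (aop α Φ) r = 1 / 4 * lamR p (lamR p Φ) r := by
    rw [aop, e2, ha1, lamR, ← hα]; ring
  have e5 : aop α Φ r = -1 / 2 * lamR p Φ r := rfl
  rw [psi_zero p Φ hn, gZZ, ← hα, e1]
  simp only [gsRem, Finset.sum_range_succ, Finset.sum_range_zero, coef, Nat.cast_zero, e3, e4, e5]
  ring

/-- The equation for one coefficient. -/
theorem exp_psi_step (h : EvenProfile p Φ) {n i₀ j₀ : ℕ} (hi : i₀ < n) (hj : j₀ ≤ n)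
    {U : ℕ → ℕ → ℝ → ℝ} (hU : ∀ i j, SymM (2 / (p - 1)) (U i j)) {γ η : ℕ → ℝ} {φ w : ℝ → ℝ}
    (hφ : Exp n (2 / (p - 1)) i₀ (j₀ + 1)
      (fun b r Z => psi p Φ n U γ η b r Z - b ^ i₀ * φ r * Z ^ (2 * j₀)))
    (hw : SymM (2 / (p - 1)) w) {x y : ℝ} (hx : j₀ = 1 ∨ x = 0) (hy : j₀ = 0 ∨ y = 0)
    (heq : ∀ r, 0 < r → linR p Φ w r + j₀ * w r =
      -φ r + x * aop (2 / (p - 1)) Φ r + y * lamR p Φ r) :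
    Exp n (2 / (p - 1)) i₀ (j₀ + 1) (psi p Φ n (addAt U i₀ j₀ w)
      (fun i => γ i + if i = i₀ then x else 0) (fun i => η i + if i = i₀ then y else 0)) := by
  have hU' := symM_addAt hU hw i₀ j₀
  have h1 := h.psi_addAt hi hj hU γ η hw
  have h2 : Exp n (2 / (p - 1)) i₀ (j₀ + 1) (fun b r Z =>
      psi p Φ n (addAt U i₀ j₀ w) (fun i => γ i + if i = i₀ then x else 0) η b r Z -
        psi p Φ n (addAt U i₀ j₀ w) γ η b r Z
        + b ^ i₀ * (x * aop (2 / (p - 1)) Φ r) * Z ^ (2 * j₀)) := by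
    rcases hx with rfl | rfl
    · exact h.psi_add_gamma hi hU' γ η x
    · simpa using Exp.zero
  have h3 : Exp n (2 / (p - 1)) i₀ (j₀ + 1) (fun b r Z =>
      psi p Φ n (addAt U i₀ j₀ w) (fun i => γ i + if i = i₀ then x else 0)
        (fun i => η i + if i = i₀ then y else 0) b r Z -
        psi p Φ n (addAt U i₀ j₀ w) (fun i => γ i + if i = i₀ then x else 0) η b r Z
        + b ^ i₀ * (y * lamR p Φ r) * Z ^ (2 * j₀)) := by
    rcases hy with rfl | rfl
    · exact h.psi_add_eta hi hU' _ η y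
    · simpa using Exp.zero
  refine (Exp.add _ _ (Exp.add _ _ (Exp.add _ _ h1 h2) h3) hφ).congr fun b r Z _ _ hr _ => ?_
  rw [heq r hr]
  ring

end EvenProfile

/-! ### Lexicographic induction on the coefficients -/

/-- The value of `c_1`. -/
def cOne (p : ℝ) (Φ : ℝ → ℝ) : ℝ :=
  4 + 2 * (innerR (lamR p (lamR p Φ)) (lamR p Φ) / innerR (lamR p Φ) (lamR p Φ))

/-- Coefficients solving the equations up to the index `(i₀, j₀)` of the lexicographic order. -/
structure Approx (p : ℝ) (Φ : ℝ → ℝ) (n i₀ j₀ : ℕ) (U : ℕ → ℕ → ℝ → ℝ) (γ η : ℕ → ℝ) :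
    Prop where
  symM : ∀ i j, SymM (2 / (p - 1)) (U i j)
  orth : ∀ i j, j ≤ 1 → innerR (U i j) (lamR p Φ) = 0
  U_zero : U 0 0 = 0
  gamma_zero : γ 0 = cOne p Φ
  eta_zero : η 0 = 1
  exp : Exp n (2 / (p - 1)) i₀ j₀ (psi p Φ n U γ η)

namespace EvenProfile
variable {p : ℝ} {Φ : ℝ → ℝ}

theorem innerR_addAt (h : EvenProfile p Φ) {U : ℕ → ℕ → ℝ → ℝ}
    (hU : ∀ i j, SymM (2 / (p - 1)) (U i j)) {w : ℝ → ℝ} (hw : SymM (2 / (p - 1)) w)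
    {i₀ j₀ i j : ℕ} (hUo : innerR (U i j) (lamR p Φ) = 0)
    (hwo : j = j₀ → innerR w (lamR p Φ) = 0) :
    innerR (addAt U i₀ j₀ w i j) (lamR p Φ) = 0 := by
  by_cases hij : i = i₀ ∧ j = j₀
  · obtain ⟨rfl, rfl⟩ := hij
    rw [addAt_self, innerR_add ((hU _ _).sy one_pos) (hw.sy one_pos) h.sy_lam, hUo, hwo rfl,
      add_zero]
  · rw [addAt_ne U w hij, hUo]

theorem innerR_aop (p : ℝ) (Φ g : ℝ → ℝ) :
    innerR (aop (2 / (p - 1)) Φ) g = -1 / 2 * innerR (lamR p Φ) g :=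
  innerR_const_mul (-1 / 2) (lamR p Φ) g

theorem symM_lam (h : EvenProfile p Φ) : SymM (2 / (p - 1)) (lamR p Φ) := h.sy_lam.symM h.even_lam

theorem symM_aop (h : EvenProfile p Φ) : SymM (2 / (p - 1)) (aop (2 / (p - 1)) Φ) :=
  (h.sy.aop _).symM (even_aop _ h.even)

/-- The first equation, of index `(0, 1)`. -/
theorem exists_approx_first (h : EvenProfile p Φ) {n : ℕ} (hn : 1 ≤ n) :
    ∃ U γ η, Approx p Φ n 0 2 U γ η := by
  have hI := h.inner_lam_pos
  have hL2 : SymM (2 / (p - 1)) (lamR p (lamR p Φ)) := h.symM_lam.lam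
  have hφ : SymM (2 / (p - 1)) (fun r => lamR p (lamR p Φ) r + 2 * lamR p Φ r) :=
    hL2.add (h.symM_lam.const_mul 2)
  have hf := hφ.add (h.symM_aop.const_mul (cOne p Φ))
  obtain ⟨w, hw, heq, hwo⟩ := h.exists_solution_one hf (by
    rw [innerR_add (hφ.sy one_pos) ((h.symM_aop.const_mul (cOne p Φ)).sy one_pos) h.sy_lam,
      innerR_add (hL2.sy one_pos) ((h.symM_lam.const_mul 2).sy one_pos) h.sy_lam,
      innerR_const_mul, innerR_const_mul, innerR_aop, cOne]
    field_simp
    ring)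
  have hU0 : ∀ i j : ℕ, SymM (2 / (p - 1)) ((fun _ _ _ => 0 : ℕ → ℕ → ℝ → ℝ) i j) :=
    fun _ _ => symM_zero _
  -- The start is U = 0, γ = 0 and η = 1 at index 0. Only the entry (0, 1) and γ_0 are changed, γ_0
  -- receiving the value that makes the source orthogonal to Λ_rΦ.
  refine ⟨_, _, _, symM_addAt hU0 hw 0 1, fun i j _ => h.innerR_addAt hU0 hw ?_ fun _ => hwo,
    ?_, ?_, ?_, h.exp_psi_step (x := cOne p Φ) (y := 0) (by omega) hn hU0 (h.exp_psi_zero hn) hw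
      (Or.inl rfl) (Or.inr rfl) fun r hr => ?_⟩
  · simp [innerR]
  · ext r; simp [addAt]
  · simp
  · simp
  · rw [Nat.cast_one, heq r hr]; ring

/-- The hypothesis `h0` places the index after (0, 1), so U_{0,0}, γ_0 and η_0 keep their values;
when j₀ ≥ 2 both modulation increments vanish. -/
theorem exists_approx_step (h : EvenProfile p Φ) {n i₀ j₀ : ℕ} {U : ℕ → ℕ → ℝ → ℝ}
    {γ η : ℕ → ℝ} (a : Approx p Φ n i₀ j₀ U γ η) (hi : i₀ < n) (hj : j₀ ≤ n)
    (h0 : 1 ≤ i₀ ∨ 2 ≤ j₀) {φ w : ℝ → ℝ}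
    (hφ : Exp n (2 / (p - 1)) i₀ (j₀ + 1)
      (fun b r Z => psi p Φ n U γ η b r Z - b ^ i₀ * φ r * Z ^ (2 * j₀)))
    (hw : SymM (2 / (p - 1)) w) (hwo : j₀ ≤ 1 → innerR w (lamR p Φ) = 0)
    {x y : ℝ} (hx : j₀ = 1 ∨ x = 0) (hy : j₀ = 0 ∨ y = 0)
    (heq : ∀ r, 0 < r → linR p Φ w r + j₀ * w r =
      -φ r + x * aop (2 / (p - 1)) Φ r + y * lamR p Φ r) :
    ∃ U γ η, Approx p Φ n i₀ (j₀ + 1) U γ η := by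
  refine ⟨_, _, _, symM_addAt a.symM hw i₀ j₀,
    fun i j hj1 => h.innerR_addAt a.symM hw (a.orth i j hj1) fun e => hwo (by omega), ?_, ?_, ?_,
    h.exp_psi_step hi hj a.symM hφ hw hx hy heq⟩
  · rw [addAt_ne U w (by omega), a.U_zero]
  · rw [a.gamma_zero]
    rcases hx with rfl | rfl
    · rw [if_neg (by omega), add_zero]
    · simp
  · rw [a.eta_zero]
    rcases hy with rfl | rfl
    · rw [if_neg (by omega), add_zero]
    · simp

/-- The leading coefficient φ of the current error is removed by solving (L_r + j₀)w = -φ, modified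
for j₀ = 0 and j₀ = 1 by the multiple of Λ_rΦ that η or γ makes available. -/
theorem exists_approx_succ (h : EvenProfile p Φ) (hspec : NonDegenerate p Φ) {n i₀ j₀ : ℕ}
    {U : ℕ → ℕ → ℝ → ℝ} {γ η : ℕ → ℝ} (a : Approx p Φ n i₀ j₀ U γ η) (hi : i₀ < n)
    (hj : j₀ ≤ n) (h0 : 1 ≤ i₀ ∨ 2 ≤ j₀) : ∃ U γ η, Approx p Φ n i₀ (j₀ + 1) U γ η := by
  have hI := h.inner_lam_pos
  obtain ⟨φ, hφ, hE⟩ := a.exp.exists_leading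
  have hnφ : SymM (2 / (p - 1)) (fun r => -1 * φ r) := hφ.const_mul (-1)
  obtain rfl | rfl | hj2 : j₀ = 0 ∨ j₀ = 1 ∨ 2 ≤ j₀ := by omega
  -- This value makes the source orthogonal to Λ_rΦ; Green's identity with j = 0 then transfers
  -- orthogonality to the solution.
  · set y := innerR φ (lamR p Φ) / innerR (lamR p Φ) (lamR p Φ) with hy
    have hf := hnφ.add (h.symM_lam.const_mul y)
    obtain ⟨w, hw, heq, hwo⟩ := h.exists_solution_of_ne_one hspec (j := 0) (by omega) hf
    rw [innerR_add (hnφ.sy one_pos) ((h.symM_lam.const_mul y).sy one_pos) h.sy_lam,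
      innerR_const_mul, innerR_const_mul, hy, div_mul_cancel₀ _ hI.ne'] at hwo
    refine h.exists_approx_step a hi hj h0 hE hw (fun _ => ?_) (x := 0) (y := y) (Or.inr rfl) (Or.inl rfl)
      fun r hr => ?_
    · simp only [Nat.cast_zero] at hwo; linarith
    · rw [heq r hr]; ring
  -- The solvability condition at the eigenvalue -1; the factor -2 compensates `aop α Φ = -Λ_rΦ/2`.
  · set x := -2 * (innerR φ (lamR p Φ) / innerR (lamR p Φ) (lamR p Φ)) with hx
    have hf := hnφ.add (h.symM_aop.const_mul x)
    obtain ⟨w, hw, heq, hwo⟩ := h.exists_solution_one hf (by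
      rw [innerR_add (hnφ.sy one_pos) ((h.symM_aop.const_mul x).sy one_pos) h.sy_lam,
        innerR_const_mul, innerR_const_mul, innerR_aop, hx]
      field_simp
      ring)
    refine h.exists_approx_step a hi hj h0 hE hw (fun _ => hwo) (x := x) (y := 0) (Or.inl rfl) (Or.inr rfl)
      fun r hr => ?_
    rw [Nat.cast_one, heq r hr]; ring
  · obtain ⟨w, hw, heq, -⟩ := h.exists_solution_of_ne_one hspec (j := j₀) (by omega) hnφ
    refine h.exists_approx_step a hi hj h0 hE hw (by omega) (x := 0) (y := 0) (Or.inr rfl) (Or.inr rfl)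
      fun r hr => ?_
    rw [heq r hr]; ring

theorem exists_approx_next (h : EvenProfile p Φ) (hspec : NonDegenerate p Φ) {n i₀ j₀ : ℕ}
    (hi : i₀ < n) (hj : j₀ ≤ n + 1) (h0 : 1 ≤ i₀ ∨ 2 ≤ j₀)
    (a : ∃ U γ η, Approx p Φ n i₀ j₀ U γ η) : ∃ U γ η, Approx p Φ n (i₀ + 1) 0 U γ η := by
  obtain ⟨d, hd⟩ : ∃ d, j₀ + d = n + 1 := ⟨n + 1 - j₀, by omega⟩
  induction d generalizing j₀ with
  | zero =>
    obtain ⟨U, γ, η, a⟩ := a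
    obtain rfl : j₀ = n + 1 := by omega
    exact ⟨U, γ, η, a.symM, a.orth, a.U_zero, a.gamma_zero, a.eta_zero, a.exp.next⟩
  | succ d ih =>
    obtain ⟨U, γ, η, a⟩ := a
    exact ih (by omega) (by omega) (h.exists_approx_succ hspec a hi (by omega) h0) (by omega)

/-- Coefficients solving all the equations. -/
theorem exists_approx (h : EvenProfile p Φ) (hspec : NonDegenerate p Φ) {n : ℕ} (hn : 1 ≤ n) :
    ∃ U γ η, Approx p Φ n n 0 U γ η := by
  have key : ∀ i, i < n → ∃ U γ η, Approx p Φ n (i + 1) 0 U γ η := by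
    intro i
    induction i with
    | zero =>
      intro hi
      exact h.exists_approx_next hspec hi (by omega) (by omega) (h.exists_approx_first hn)
    | succ i ih =>
      intro hi
      exact h.exists_approx_next hspec hi (by omega) (by omega) (ih (by omega))
  obtain ⟨k, rfl⟩ : ∃ k, n = k + 1 := ⟨n - 1, by omega⟩
  exact key k (by omega)

theorem cOne_eq (h : EvenProfile p Φ) : cOne p Φ = 2 * (2 - sc p) +
    innerR (fun r => r * lamR p Φ r) (fun r => r * lamR p Φ r) /
      (2 * innerR (lamR p Φ) (lamR p Φ)) := by
  have hI := h.inner_lam_pos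
  rw [cOne, innerR_lamR_self p h.sy_lam, sc]
  have : p - 1 ≠ 0 := by have := h.hp; intro; linarith
  field_simp
  ring

end EvenProfile

/-! ### Return to the given profile and its norms -/

/-- Reduction of the norm of a radial function to the half line. -/
theorem exists_normSqY_eq : ∃ K : ℝ, K ≠ 0 ∧ ∀ f : ℝ → ℝ, normSqY f = K * innerR f f := by
  refine ⟨(3 : ℕ) * (volume : Measure (EuclideanSpace ℝ (Fin 3))).real (Metric.ball 0 1) *
    ∫ z : ℝ, Real.exp (-(1 / 4) * z ^ 2), ?_, fun f => ?_⟩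
  · rw [integral_gaussian]
    have h1 : 0 < (volume : Measure (EuclideanSpace ℝ (Fin 3))).real (Metric.ball 0 1) :=
      ENNReal.toReal_pos (Metric.measure_ball_pos volume 0 one_pos).ne' measure_ball_lt_top.ne
    have h2 : 0 < Real.sqrt (Real.pi / (1 / 4)) := Real.sqrt_pos.2 (by positivity)
    positivity
  · have e1 : normSqY f = ∫ Y : EuclideanSpace ℝ (Fin 3) × ℝ,
        (f ‖Y.1‖ ^ 2 * Real.exp (-‖Y.1‖ ^ 2 / 4)) * Real.exp (-(1 / 4) * Y.2 ^ 2) := by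
      unfold normSqY
      congr 1; ext Y
      rw [mul_assoc, ← Real.exp_add]
      congr 2; ring
    rw [e1, Measure.volume_eq_prod, integral_prod_mul
      (fun y : EuclideanSpace ℝ (Fin 3) => f ‖y‖ ^ 2 * Real.exp (-‖y‖ ^ 2 / 4))
      (fun z : ℝ => Real.exp (-(1 / 4) * z ^ 2)),
      integral_fun_norm_addHaar volume (fun x => f x ^ 2 * Real.exp (-x ^ 2 / 4))]
    simp only [finrank_euclideanSpace, Fintype.card_fin, nsmul_eq_mul, smul_eq_mul]
    have e2 : (∫ y in Ioi (0 : ℝ), y ^ (3 - 1) * (f y ^ 2 * Real.exp (-y ^ 2 / 4))) =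
        innerR f f := by
      unfold innerR rhoR
      congr 1; ext y; ring
    rw [e2]
    ring

theorem G_abs (p : ℝ) (Φ : ℝ → ℝ) {r : ℝ} (hr : 0 < r) (Z : ℝ) :
    G p (fun x => Φ |x|) r Z = G p Φ r Z := by
  simp only [G, abs_of_pos (div_pos hr (jap_pos Z))]

theorem linR_abs (p : ℝ) (Φ u : ℝ → ℝ) {r : ℝ} (hr : 0 < r) :
    linR p (fun x => Φ |x|) u r = linR p Φ u r := by
  simp only [linR, abs_of_pos hr]

theorem lamR_abs (p : ℝ) (Φ : ℝ → ℝ) {r : ℝ} (hr : 0 < r) :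
    lamR p (fun x => Φ |x|) r = lamR p Φ r :=
  lamR_congr p (eventuallyEq_abs_of_pos hr Φ)

/-- Only values at positive radii matter. The r-derivative of G requires equality on a neighbourhood
of r, which is available because r > 0. -/
theorem errPsi_abs (p : ℝ) (Φ : ℝ → ℝ) (n : ℕ) (V : ℕ → ℕ → ℝ → ℝ) (c d : ℕ → ℝ) {b r : ℝ}
    (hr : 0 < r) (Z : ℝ) :
    errPsi p (fun x => Φ |x|) n V c d b r Z = errPsi p Φ n V c d b r Z := by
  have h1 : lamR p (fun s => G p (fun x => Φ |x|) s Z + Vb n V b s Z) r =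
      lamR p (fun s => G p Φ s Z + Vb n V b s Z) r := by
    refine lamR_congr p ?_
    filter_upwards [eventually_gt_nhds hr] with s hs
    rw [G_abs p Φ hs]
  simp only [errPsi, nonlin, h1, linR_abs p Φ _ hr, G_abs p Φ hr, abs_of_pos hr]

theorem NonDegenerate.abs {p : ℝ} {Φ : ℝ → ℝ} (h : NonDegenerate p Φ) :
    NonDegenerate p (fun x => Φ |x|) := by
  rintro m ⟨u, h1, h2, h3, h4⟩
  exact h m ⟨u, h1, h2, h3, fun r hr => (linR_abs p Φ u hr).symm.trans (h4 r hr)⟩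

theorem innerR_lamR_abs (p : ℝ) (Φ f : ℝ → ℝ) :
    innerR f (lamR p (fun x => Φ |x|)) = innerR f (lamR p Φ) :=
  innerR_congr (fun _ _ => rfl) fun _ hr => lamR_abs p Φ hr

theorem cOne_abs {p : ℝ} {Φ : ℝ → ℝ} (h : EvenProfile p (fun x => Φ |x|)) :
    cOne p (fun x => Φ |x|) = 2 * (2 - sc p) +
      normSqY (fun r => r * lamR p Φ r) / (2 * normSqY (lamR p Φ)) := by
  obtain ⟨K, hK, hN⟩ := exists_normSqY_eq
  have e1 : innerR (lamR p fun x => Φ |x|) (lamR p fun x => Φ |x|) =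
      innerR (lamR p Φ) (lamR p Φ) :=
    innerR_congr (fun _ hr => lamR_abs p Φ hr) fun _ hr => lamR_abs p Φ hr
  have e2 : innerR (fun r => r * lamR p (fun x => Φ |x|) r)
      (fun r => r * lamR p (fun x => Φ |x|) r) =
      innerR (fun r => r * lamR p Φ r) (fun r => r * lamR p Φ r) :=
    innerR_congr (fun r hr => by rw [lamR_abs p Φ hr]) fun r hr => by rw [lamR_abs p Φ hr]
  rw [h.cOne_eq, e1, e2, hN, hN, mul_left_comm 2 K, mul_div_mul_left _ _ hK]

/-- The error estimate in terms of the class `Cl`. -/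
theorem errPsi_bound {p : ℝ} {Φ : ℝ → ℝ} {n : ℕ} {V : ℕ → ℕ → ℝ → ℝ} {c d : ℕ → ℝ} {s : ℝ}
    (h : Cl 2 s n (2 * n + 2) (fun b r Z => b⁻¹ * errPsi p (fun x => Φ |x|) n V c d b r Z)) :
    ∃ C, ∀ b r Z : ℝ, 0 < b → b < 1 → 0 < r → |Z| < 1 → ∀ j k : ℕ, j + k ≤ 2 →
      |iteratedDeriv j (fun x => iteratedDeriv k (fun W => errPsi p Φ n V c d b x W) Z) r| ≤
        C * (b ^ (n + 1) + b * |Z| ^ (2 * n + 2 - k)) * jap r ^ (-(s + j)) := by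
  obtain ⟨C, -, hC⟩ := h.iteratedDeriv_bound
  refine ⟨C, fun b r Z hb hb1 hr hZ j k hjk => ?_⟩
  have h1 := hC b r Z hb hb1 hr hZ j k hjk
  have e : (fun x => iteratedDeriv k (fun W => errPsi p Φ n V c d b x W) Z) =ᶠ[𝓝 r]
      fun x => b * iteratedDeriv k
        (fun W => b⁻¹ * errPsi p (fun x => Φ |x|) n V c d b x W) Z := by
    filter_upwards [eventually_gt_nhds hr] with x hx
    rw [← iteratedDeriv_const_mul_field]
    congr 1
    ext W
    rw [errPsi_abs p Φ n V c d hx, mul_inv_cancel_left₀ hb.ne']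
  rw [e.iteratedDeriv_eq, iteratedDeriv_const_mul_field, abs_mul, abs_of_pos hb]
  calc _ ≤ b * (C * (b ^ n + |Z| ^ (2 * n + 2 - k)) * jap r ^ (-(s + j))) := by gcongr
    _ = _ := by rw [pow_succ]; ring

end

end CylBlowup

theorem lemma2p5 (p : ℝ) (hp : 5 < p) (Φ : ℝ → ℝ)
    (hΦ : CylBlowup.IsProfile p Φ) (hspec : CylBlowup.NonDegenerate p Φ)
    (n : ℕ) (hn : p ≤ (n : ℝ)) :
    ∃ (V : ℕ → ℕ → ℝ → ℝ) (c d : ℕ → ℝ),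
      -- smoothness and decay of the coefficients
      (∀ i j : ℕ, 1 ≤ i → i ≤ n → j ≤ n →
        CylBlowup.SmoothRadial (V i j) ∧
        ∀ k : ℕ, ∃ C : ℝ, ∀ r : ℝ, 0 ≤ r →
          |iteratedDeriv k (V i j) r| ≤
            C * CylBlowup.jap r ^ (-(2 / (p - 1) - 1 / (n : ℝ) + (k : ℝ)))) ∧
      -- orthogonality
      (∀ i : ℕ, 1 ≤ i → i ≤ n →
        CylBlowup.innerR (V i 0) (CylBlowup.lamR p Φ) = 0 ∧
        CylBlowup.innerR (V i 1) (CylBlowup.lamR p Φ) = 0) ∧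
      -- error estimate
      (∃ (δ₀ b₀ C : ℝ), 0 < δ₀ ∧ 0 < b₀ ∧
        ∀ δ b : ℝ, 0 < δ → δ < δ₀ → 0 < b → b < b₀ →
          ∀ r Z : ℝ, 0 < r → |Z| ≤ δ → ∀ j k : ℕ, j + k ≤ 2 →
            |iteratedDeriv j
                (fun s => iteratedDeriv k
                  (fun W => CylBlowup.errPsi p Φ n V c d b s W) Z) r| ≤
              C * (b ^ (n + 1) + b * |Z| ^ (2 * n + 2 - k)) *
                CylBlowup.jap r ^ (-(2 / (p - 1) - 1 / (n : ℝ) + (j : ℝ)))) ∧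
      -- first coefficients
      V 1 0 = 0 ∧
      c 1 = 2 * (2 - CylBlowup.sc p) +
        CylBlowup.normSqY (fun r => r * CylBlowup.lamR p Φ r) /
          (2 * CylBlowup.normSqY (CylBlowup.lamR p Φ)) ∧
      d 1 = 1 := by
  have h := hΦ.evenProfile hp
  have hn0 : (0 : ℝ) < n := by linarith
  have hn1 : 1 ≤ n := by exact_mod_cast hn0
  -- The arbitrary loss ε of the symbol classes is specialised to 1/n.
  have hε : (0 : ℝ) < 1 / n := by positivity
  obtain ⟨U, γ, η, a⟩ := h.exists_approx hspec.abs hn1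
  obtain ⟨C, hC⟩ := CylBlowup.errPsi_bound (h.cl_errPsi hn a.symM a.exp hε)
  -- The thresholds δ₀ = b₀ = 1 suffice because the Taylor remainder of the nonlinearity is
  -- controlled globally. The truncated `i - 1` is harmless since only i ≥ 1 is used.
  refine ⟨fun i j => U (i - 1) j, fun i => γ (i - 1), fun i => η (i - 1), fun i j _ _ _ =>
    ⟨⟨(a.symM _ _).1, (a.symM _ _).2.1⟩, ((a.symM (i - 1) j).sy hε).iteratedDeriv_bound⟩,
    fun i _ _ => ⟨?_, ?_⟩, ⟨1, 1, C, one_pos, one_pos, fun δ b _ hδ hb hb1 r Z hr hZ j k hjk =>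
      hC b r Z hb hb1 hr (hZ.trans_lt hδ) j k hjk⟩, a.U_zero,
    a.gamma_zero.trans (CylBlowup.cOne_abs h), a.eta_zero⟩
  · rw [← CylBlowup.innerR_lamR_abs]; exact a.orth _ 0 (by omega)
  · rw [← CylBlowup.innerR_lamR_abs]; exact a.orth _ 1 le_rfl
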